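/- **Setting.** Let $\Sigma$ be a finite set of $N$ models, and let $G$ be an undirected graph on $\Sigma$ with positive integer edge lengths. When a model $s$ is proposed to a user, the user answers either $s' = s$ (confirmation) or a neighbour $s'$ of $s$ in $G$. Let $R(s,s)=\{s\}$ and, for $s'\ne s$, let $R(s,s')$ be the set of all $\hat s$ such that $s'$ lies on a shortest path from $s$ to $\hat s$; the models in $R(s,s')$ are called consistent with the response $(s,s')$. For node weights $w\ge 0$ with $w(\Sigma)>0$ let $$\Phi_w(s) = \frac{1}{w(\Sigma)}\max_{s'\ne s,\ (s,s')\in G} w(R(s,s'))$$ (the maximum over the empty set being $0$). Fix a set $S_{\rm init}\subseteq\Sigma$ and $p\in(\frac12,1]$. For a finite list $Q$ of query responses, the likelihood $w_Q(s)$ is $0$ if $s\notin S_{\rm init}$, and otherwise $p^a(1-p)^b$, where $a$ (resp. $b$) is the number of responses in $Q$ that $s$ is consistent with (resp. not consistent with). For $p=1$ this is the indicator function of the models in $S_{\rm init}$ that are consistent with all responses. **Assumptions.** Let $n$ be a measure of the input size. $\log N$, the maximum degree of $G$ and the diameter of $G$ with respect to the edge lengths are at most $\mathrm{poly}(n)$.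 Let $0\le\Delta<\frac14$ be a constant. There is an oracle that, given a list $Q$ of responses with $w_Q(\Sigma)>0$, returns in time $\mathrm{poly}(n,|Q|)$ a model drawn from a distribution whose total variation distance from $w_Q/w_Q(\Sigma)$ is at most $\Delta$. There is a procedure that decides in time $\mathrm{poly}(n,|Q|)$ whether a given model is consistent with all the responses in a given list $Q$, and a procedure that lists the neighbours of a given model in time $\mathrm{poly}(n)$. Algorithms get access to models only through these procedures, copying, and comparison. The programs below depend only on the constant $\Delta$, on the polynomials in these assumptions and, in 3, on $p$; their running times are bounded by polynomials that depend on the same data. **The learning algorithms.** *Algorithm 1 with $\beta$* starts with $S=S_{\rm init}$. While $|S|>1$, it proposes a model $s$ with $\Phi_{1_S}(s)\le\beta$, receives an answer $s'$, and replaces $S$ by $S\cap R(s,s')$. It returns the only remaining model. *Algorithm 2 on $(S_0,K)$ with $\beta$* starts with likelihood $w=1_{S_0}$ and performs $\lceil K\rceil+1$ iterations. In each of them it marks all models $s$ with $w(s)\ge\frac12 w(S_0)$, then proposes a model $s$ with $\Phi_w(s)\le\beta$, receives an answer $s'$, and multiplies $w$ by $p$ on $R(s,s')$ and by $1-p$ elsewhere.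 It returns the set of marked models. Since likelihoods are known only up to the error of the oracle, an iteration may also mark further models $s$ as long as $w(s)\ge(\frac12-2\Delta-\epsilon)\,w(S_0)$. *Algorithm 3 with $\beta$*, given $S_{\rm init}$ and $\delta\in(0,1)$. Let $\tau=\beta p+(1-\beta)(1-p)$, $H(p)=-p\log p-(1-p)\log(1-p)$ (with $\log=\log_2$), $\delta'=\delta/5$, $\gamma=\log(1/\tau)-H(p)$, $\ell=\log\frac{p}{1-p}$, $\lambda_2=\frac{\gamma}{2\ell}$, and $\lambda_1=\min\{\sqrt{1/\log\log|S_{\rm init}|},\,\lambda_2\}$ (and $\lambda_1=\lambda_2$ if $|S_{\rm init}|\le2$). For $\lambda\in\{\lambda_1,\lambda_2\}$ put $$K(\lambda,M)=\max\Bigl\{\frac{\log M}{\gamma-\lambda\ell}+\frac{\log(1/\tau)}{\log(1/\delta')},\ \frac{\ln(1/\delta')}{\lambda^2}\Bigr\}+1 .$$ Run Algorithm 2 on $(S_{\rm init},K(\lambda_1,|S_{\rm init}|))$ to get $S_1$. Run Algorithm 2 on $(S_1,K(\lambda_2,|S_1|))$ to get $S_2$ (with $S_2=\emptyset$ and no queries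 if $S_1=\emptyset$). For the $s\in S_2$ in turn, propose $s$ exactly $\lceil 2\ln(|S_2|/\delta')/(2p-1)^2\rceil$ times, and return $s$ if it is confirmed in at least half of these queries. Return failure if no $s\in S_2$ is returned. **Theorem.** 1. There is an algorithm that, for every $\epsilon>0$, every $k\in\mathbb N$ and every list $Q$ of responses with $w_Q(\Sigma)>0$, runs in time $\mathrm{poly}(n,\frac1\epsilon,k,|Q|)$, asks the user nothing, and with probability at least $1-2^{-k}$ finds a model $s$ with $\Phi_{w_Q}(s)\le\frac12+2\Delta+\epsilon$. 2. Let $p=1$. There is $\epsilon_0>0$, depending only on $\Delta$ and the polynomials in the assumptions, and an interactive program such that, for all $0<\epsilon\le\epsilon_0$, every $k$, every ground truth $s^*\in S_{\rm init}$, and every (randomized, adaptive) user who answers correctly (confirms $s^*$, and answers every $s\neq s^*$ by a neighbour of $s$ on a shortest path from $s$ to $s^*$), the program runs in time $\mathrm{poly}(n,\frac1\epsilon,k)$, and with probability at least $1-2^{-k}$ its interaction with the user and its output are those of an execution of Algorithm 1 with $\beta=\frac12+2\Delta+\epsilon$. 3. Let $\frac12<p<1$ be a constant such that $\log(1/\tau)>H(p)$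 holds for $\beta=\frac12+2\Delta$, and let $S_{\rm init}\neq\emptyset$. There is $\epsilon_0>0$, depending only on $\Delta$, $p$ and the polynomials in the assumptions, and an interactive program such that, for all $0<\epsilon\le\epsilon_0$, all $\delta\in(0,1)$, every $k$, and every (randomized, adaptive) user who gives allowed answers, correct or not, the program runs in time $\mathrm{poly}(n,\frac1\epsilon,k,\log\frac1\delta)$, and with probability at least $1-2^{-k}$ its interaction with the user and its output are those of an execution of Algorithm 3 with $\beta=\frac12+2\Delta+\epsilon$. In 1 and 2 the algorithms use only integer arithmetic, charged by bit length; in 3 the algorithm also computes with the real parameters, at unit cost per operation ($+,-,\times,/$, $\ln$, square root, comparison; no rounding to integers). -/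

import Mathlib

open scoped ENNReal

namespace InteractiveLearning

noncomputable section

/-! ## Feedback graphs, consistency sets, weights -/

/-- An undirected graph on the set `V` of models with positive integer edge lengths. -/
structure FeedbackGraph (V : Type) where
  G : SimpleGraph V
  len : V → V → ℕ
  len_symm : ∀ s t, len s t = len t s
  len_pos : ∀ s t, G.Adj s t → 0 < len s t

/-- A query response `(s, s')`: the model `s` was proposed, the user answered `s'`. -/
abbrev Response (V : Type) := V × V

namespace FeedbackGraph

variable {V : Type} (D : FeedbackGraph V)

/-- Total edge length of a walk. -/
def walkLen : {s t : V} → D.G.Walk s t → ℕ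
  | _, _, .nil => 0
  | s, _, .cons (v := v) _ w => D.len s v + walkLen w

/-- `s'` lies on a shortest path from `s` to `t`. -/
def OnShortestPath (s s' t : V) : Prop :=
  ∃ w : D.G.Walk s t, (∀ w' : D.G.Walk s t, D.walkLen w ≤ D.walkLen w') ∧ s' ∈ w.support

/-- The set of models that are consistent with the answer `s'` to the proposal `s`. -/
def reach (s s' : V) : Set V :=
  {t | (s' = s ∧ t = s) ∨ (s' ≠ s ∧ D.OnShortestPath s s' t)}

/-- The answers that a user may give to `s`: confirming `s`, or a neighbour of `s`. -/
def Allowed (s s' : V) : Prop := s' = s ∨ D.G.Adj s s'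

/-- A list of query responses, each of them an allowed one. -/
def ValidResponses (Q : List (Response V)) : Prop := ∀ r ∈ Q, D.Allowed r.1 r.2

open Classical in
/-- Likelihood of the responses `Q` if the target is `s`, where models outside `S₀` get weight `0`:
a factor `p` for every response that `s` is consistent with, and `1 - p` for every other one.
For `p = 1` this is the indicator function of the models in `S₀` consistent with all of `Q`. -/
def weight (p : ℝ) (S₀ : Finset V) (Q : List (Response V)) (s : V) : ℝ :=
  if s ∈ S₀ then (Q.map fun r => if s ∈ D.reach r.1 r.2 then p else 1 - p).prod else 0

variable [Fintype V]

open Classical in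
/-- The potential `Φ_w(s)`: the largest fraction of the weight that is consistent with some
answer `s' ≠ s` along an edge `(s, s')` (and `0` if `s` has no neighbour). -/
def potential (w : V → ℝ) (s : V) : ℝ :=
  (∑ t, w t)⁻¹ * ⨆ s' : {s' : V // D.G.Adj s s'}, ∑ t with t ∈ D.reach s s', w t

/-- Number of models, degrees and diameter are bounded: `log N ≤ P(n)`, every node has at most
`P(n)` neighbours, and any two nodes are joined by a path of length at most `P(n)`. -/
def Bounded (P : Polynomial ℕ) (n : ℕ) : Prop :=
  Real.logb 2 (Fintype.card V) ≤ P.eval n ∧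
  (∀ s, {t | D.G.Adj s t}.ncard ≤ P.eval n) ∧
  (∀ s t, ∃ w : D.G.Walk s t, D.walkLen w ≤ P.eval n)

end FeedbackGraph

/-! ## Oracles -/

/-- The procedures an algorithm may call, together with their running times. -/
structure Oracles (V : Type) where
  /-- draw a model, given a list of query responses -/
  sample : List (Response V) → PMF V
  sampleTime : List (Response V) → ℕ
  /-- is the given model consistent with all of the given responses? -/
  check : List (Response V) → V → Bool
  checkTime : List (Response V) → V → ℕ
  /-- list the neighbours of a model in the graph -/
  nbrs : V → List V
  nbrsTime : V → ℕ

/-- Total variation distance of `μ` from the distribution proportional to `w`. -/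
def tvDist {V : Type} [Fintype V] (w : V → ℝ) (μ : PMF V) : ℝ :=
  (1 / 2) * ∑ s, |w s / (∑ t, w t) - (μ s).toReal|

/-- The oracles do what they should for the initial set `S₀` and the correctness probability `p`,
with sampling error at most `Δ`, in time polynomial in `n` and the number of responses. -/
structure Oracles.Correct {V : Type} [Fintype V] (O : Oracles V) (D : FeedbackGraph V)
    (S₀ : Finset V) (p Δ : ℝ) (P : Polynomial ℕ) (n : ℕ) : Prop where
  sample_close : ∀ Q, D.ValidResponses Q → 0 < ∑ t, D.weight p S₀ Q t →
    tvDist (D.weight p S₀ Q) (O.sample Q) ≤ Δ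
  sample_time : ∀ Q, D.ValidResponses Q → O.sampleTime Q ≤ P.eval (n + Q.length)
  check_iff : ∀ Q, D.ValidResponses Q → ∀ s, O.check Q s = true ↔ ∀ r ∈ Q, s ∈ D.reach r.1 r.2
  check_time : ∀ Q, D.ValidResponses Q → ∀ s, O.checkTime Q s ≤ P.eval (n + Q.length)
  nbrs_nodup : ∀ s, (O.nbrs s).Nodup
  mem_nbrs : ∀ s t, t ∈ O.nbrs s ↔ D.G.Adj s t
  nbrs_time : ∀ s, O.nbrsTime s ≤ P.eval n

/-- A (randomized, adaptive) user: the law of the answer to a proposal, given the interaction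
so far. -/
abbrev User (V : Type) := List (Response V) → V → PMF V

/-- The user gives only allowed answers, which otherwise are arbitrary. -/
def User.IsAllowed {V : Type} (U : User V) (D : FeedbackGraph V) : Prop :=
  ∀ h s, ∀ s' ∈ (U h s).support, D.Allowed s s'

/-- The user gives only correct answers when the ground truth is `target`: the proposal itself if
it is the target, and otherwise a neighbour on a shortest path to the target. -/
def User.IsCorrect {V : Type} (U : User V) (D : FeedbackGraph V) (target : V) : Prop :=
  ∀ h s, ∀ s' ∈ (U h s).support, (s = target ∧ s' = s) ∨
    (s ≠ target ∧ D.G.Adj s s' ∧ D.OnShortestPath s s' target)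

/-! ## The machine model

Structured programs over registers that hold natural numbers, real numbers, models, lists of models
and lists of query responses. Models can be copied, compared and passed to the oracles, nothing
else. Arithmetic on natural numbers is charged by the bit length, arithmetic on real numbers is
charged by the unit (there is no rounding of a real number to an integer), an operation on models
is charged by the bit length of the name of a model, and an oracle call by its running time. -/

/-- Natural number expressions. -/
inductive NExp
  | const (k : ℕ)
  | var (x : ℕ)
  | lengthL (l : ℕ)
  | lengthQ (q : ℕ)
  | add (a b : NExp)
  | sub (a b : NExp)
  | mul (a b : NExp)
  | div (a b : NExp)

/-- Real number expressions. -/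
inductive RExp
  | nat (a : NExp)
  | var (x : ℕ)
  | add (a b : RExp)
  | sub (a b : RExp)
  | mul (a b : RExp)
  | div (a b : RExp)
  | ln (a : RExp)
  | sqrt (a : RExp)

/-- Tests. -/
inductive BExp
  | le (a b : NExp)
  | leR (a b : RExp)
  | eqM (x y : ℕ)
  | not (b : BExp)

/-- Programs. -/
inductive Prog
  | skip
  | seq (c d : Prog)
  | ite (b : BExp) (c d : Prog)
  /-- run `c` as many times as the value that `a` has at the beginning -/
  | loop (a : NExp) (c : Prog)
  /-- for each element of the model list `l` in turn, put it into model register `x`, run `c` -/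
  | forL (x l : ℕ) (c : Prog)
  /-- for each element of the response list `q` in turn, put it into model registers `x`, `y`,
  run `c` -/
  | forQ (x y q : ℕ) (c : Prog)
  | setN (x : ℕ) (a : NExp)
  | setR (x : ℕ) (a : RExp)
  | copyM (x y : ℕ)
  | clearL (l : ℕ)
  | pushL (l x : ℕ)
  | clearQ (q : ℕ)
  | pushQ (q x y : ℕ)
  /-- model register `x` receives a sample for the response list `q` -/
  | sample (x q : ℕ)
  /-- number register `z` becomes `1` or `0`: is model `x` consistent with response list `q`? -/
  | check (z x q : ℕ)
  /-- list register `l` receives the neighbours of model `x` -/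
  | nbrs (l x : ℕ)
  /-- propose model `x` to the user, put the answer into model register `y` -/
  | ask (y x : ℕ)

/-- Machine states; `hist` records the interaction with the user, `time` the steps made. -/
structure State (V : Type) where
  nat : ℕ → ℕ
  real : ℕ → ℝ
  mdl : ℕ → V
  lst : ℕ → List V
  resp : ℕ → List (Response V)
  hist : List (Response V)
  time : ℕ

namespace NExp

variable {V : Type}

def eval (σ : State V) : NExp → ℕ
  | const k => k
  | var x => σ.nat x
  | lengthL l => (σ.lst l).length
  | lengthQ q => (σ.resp q).length
  | add a b => a.eval σ + b.eval σ
  | sub a b => a.eval σ - b.eval σ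
  | mul a b => a.eval σ * b.eval σ
  | div a b => a.eval σ / b.eval σ

/-- Every operation costs one step plus the bit length of its result. -/
def cost (σ : State V) : NExp → ℕ
  | const k => 1 + k.size
  | var x => 1 + (σ.nat x).size
  | lengthL l => 1 + (σ.lst l).length.size
  | lengthQ q => 1 + (σ.resp q).length.size
  | add a b => a.cost σ + b.cost σ + 1 + (eval σ (add a b)).size
  | sub a b => a.cost σ + b.cost σ + 1 + (eval σ (sub a b)).size
  | mul a b => a.cost σ + b.cost σ + 1 + (eval σ (mul a b)).size
  | div a b => a.cost σ + b.cost σ + 1 + (eval σ (div a b)).size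

end NExp

namespace RExp

variable {V : Type}

def eval (σ : State V) : RExp → ℝ
  | nat a => (a.eval σ : ℝ)
  | var x => σ.real x
  | add a b => a.eval σ + b.eval σ
  | sub a b => a.eval σ - b.eval σ
  | mul a b => a.eval σ * b.eval σ
  | div a b => a.eval σ / b.eval σ
  | ln a => Real.log (a.eval σ)
  | sqrt a => Real.sqrt (a.eval σ)

def cost (σ : State V) : RExp → ℕ
  | nat a => a.cost σ + 1
  | var _ => 1
  | add a b => a.cost σ + b.cost σ + 1
  | sub a b => a.cost σ + b.cost σ + 1
  | mul a b => a.cost σ + b.cost σ + 1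
  | div a b => a.cost σ + b.cost σ + 1
  | ln a => a.cost σ + 1
  | sqrt a => a.cost σ + 1

end RExp

namespace BExp

variable {V : Type}

def Holds (σ : State V) : BExp → Prop
  | le a b => a.eval σ ≤ b.eval σ
  | leR a b => a.eval σ ≤ b.eval σ
  | eqM x y => σ.mdl x = σ.mdl y
  | not b => ¬ b.Holds σ

/-- `bits` is the bit length of the name of a model. -/
def cost (bits : ℕ) (σ : State V) : BExp → ℕ
  | le a b => a.cost σ + b.cost σ + 1
  | leR a b => a.cost σ + b.cost σ + 1
  | eqM _ _ => 1 + bits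
  | not b => b.cost bits σ + 1

/-- The test does not involve real numbers. -/
def RealFree : BExp → Prop
  | le _ _ => True
  | leR _ _ => False
  | eqM _ _ => True
  | not b => b.RealFree

end BExp

namespace State

variable {V : Type}

def tick (σ : State V) (k : ℕ) : State V := { σ with time := σ.time + k }

def setNat (σ : State V) (x k : ℕ) : State V := { σ with nat := Function.update σ.nat x k }

def setReal (σ : State V) (x : ℕ) (a : ℝ) : State V :=
  { σ with real := Function.update σ.real x a }

def setMdl (σ : State V) (x : ℕ) (s : V) : State V := { σ with mdl := Function.update σ.mdl x s }

def setLst (σ : State V) (l : ℕ) (L : List V) : State V :=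
  { σ with lst := Function.update σ.lst l L }

def setResp (σ : State V) (q : ℕ) (Q : List (Response V)) : State V :=
  { σ with resp := Function.update σ.resp q Q }

/-- The state at the beginning: the number and real registers hold the given inputs (followed by
zeros), all model registers hold an arbitrary model `v₀`, response list `0` holds `Q`. -/
def initial (nats : List ℕ) (reals : List ℝ) (Q : List (Response V)) (v₀ : V) : State V where
  nat x := nats.getD x 0
  real x := reals.getD x 0
  mdl _ := v₀
  lst _ := []
  resp q := if q = 0 then Q else []
  hist := []
  time := 0

end State

namespace Prog

variable {V : Type} [Fintype V]

open Classical in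
/-- The law of the final state of a program, for given oracles and a given user. -/
def run (O : Oracles V) (U : User V) : Prog → State V → PMF (State V)
  | skip, σ => PMF.pure (σ.tick 1)
  | seq c d, σ => (c.run O U σ).bind (d.run O U)
  | ite b c d, σ =>
      let σ' := σ.tick (1 + b.cost (Nat.clog 2 (Fintype.card V)) σ)
      if b.Holds σ then c.run O U σ' else d.run O U σ'
  | loop a c, σ =>
      (fun μ => μ.bind fun τ => c.run O U (τ.tick 1))^[a.eval σ]
        (PMF.pure (σ.tick (1 + a.cost σ)))
  | forL x l c, σ =>
      (σ.lst l).foldl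
        (fun μ s => μ.bind fun τ =>
          c.run O U ((τ.setMdl x s).tick (1 + Nat.clog 2 (Fintype.card V))))
        (PMF.pure (σ.tick 1))
  | forQ x y q c, σ =>
      (σ.resp q).foldl
        (fun μ r => μ.bind fun τ =>
          c.run O U (((τ.setMdl x r.1).setMdl y r.2).tick (1 + 2 * Nat.clog 2 (Fintype.card V))))
        (PMF.pure (σ.tick 1))
  | setN x a, σ => PMF.pure ((σ.setNat x (a.eval σ)).tick (1 + a.cost σ))
  | setR x a, σ => PMF.pure ((σ.setReal x (a.eval σ)).tick (1 + a.cost σ))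
  | copyM x y, σ => PMF.pure ((σ.setMdl x (σ.mdl y)).tick (1 + Nat.clog 2 (Fintype.card V)))
  | clearL l, σ => PMF.pure ((σ.setLst l []).tick 1)
  | pushL l x, σ =>
      PMF.pure ((σ.setLst l (σ.lst l ++ [σ.mdl x])).tick (1 + Nat.clog 2 (Fintype.card V)))
  | clearQ q, σ => PMF.pure ((σ.setResp q []).tick 1)
  | pushQ q x y, σ =>
      PMF.pure ((σ.setResp q (σ.resp q ++ [(σ.mdl x, σ.mdl y)])).tick
        (1 + 2 * Nat.clog 2 (Fintype.card V)))
  | sample x q, σ =>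
      (O.sample (σ.resp q)).map fun s =>
        (σ.setMdl x s).tick (1 + Nat.clog 2 (Fintype.card V) + O.sampleTime (σ.resp q))
  | check z x q, σ =>
      PMF.pure ((σ.setNat z (if O.check (σ.resp q) (σ.mdl x) then 1 else 0)).tick
        (1 + Nat.clog 2 (Fintype.card V) + O.checkTime (σ.resp q) (σ.mdl x)))
  | nbrs l x, σ =>
      PMF.pure ((σ.setLst l (O.nbrs (σ.mdl x))).tick
        (1 + (1 + (O.nbrs (σ.mdl x)).length) * (1 + Nat.clog 2 (Fintype.card V)) +
          O.nbrsTime (σ.mdl x)))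
  | ask y x, σ =>
      (U σ.hist (σ.mdl x)).map fun s' =>
        ({ σ.setMdl y s' with hist := σ.hist ++ [(σ.mdl x, s')] } : State V).tick
          (1 + 2 * Nat.clog 2 (Fintype.card V))

/-- The program uses no real numbers (so that all its arithmetic is charged by the bit). -/
def RealFree : Prog → Prop
  | seq c d => c.RealFree ∧ d.RealFree
  | ite b c d => b.RealFree ∧ c.RealFree ∧ d.RealFree
  | loop _ c => c.RealFree
  | forL _ _ c => c.RealFree
  | forQ _ _ _ c => c.RealFree
  | setR _ _ => False
  | _ => True

end Prog

/-! ## The learning algorithms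

For each of them, a predicate that says that an interaction with the user (the list of proposals
and answers, in order) and an output are those of an execution of the algorithm. -/

section Algorithms

variable {V : Type} [Fintype V] (D : FeedbackGraph V)

open Classical in
/-- Learning without feedback errors, where every proposed model `s` satisfies `Φ_S(s) ≤ β`:
while the set `S` of remaining candidates has more than one element, propose such an `s`,
receive `s'`, and intersect `S` with the set of models consistent with that answer; finally
return the only remaining candidate. -/
def IsNoiselessRun (β : ℝ) : Finset V → List (Response V) → V → Prop
  | S, [], out => S = {out}
  | S, (s, s') :: h, out =>
      1 < S.card ∧ D.potential (fun t => if t ∈ S then 1 else 0) s ≤ β ∧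
        IsNoiselessRun β (S.filter (· ∈ D.reach s s')) h out

open Classical in
/-- The multiplicative weights procedure on the candidate set `S₀`, where every proposed model has
potential at most `β`. Each iteration first marks models and then proposes one. The iteration
marks all models that carry at least half of the total weight, and no models that carry
less than a `θ` fraction of it. `M` is the set of marked models at the end. -/
def IsMultWeightsRun (p β θ : ℝ) (S₀ : Finset V) (h : List (Response V)) (M : Finset V) : Prop :=
  ∃ mark : ℕ → Finset V,
    (∀ (i : ℕ) (hi : i < h.length),
      (∀ s, (1 / 2) * ∑ t, D.weight p S₀ (h.take i) t ≤ D.weight p S₀ (h.take i) s →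
        s ∈ mark i) ∧
      (∀ s ∈ mark i, θ * ∑ t, D.weight p S₀ (h.take i) t ≤ D.weight p S₀ (h.take i) s) ∧
      D.potential (D.weight p S₀ (h.take i)) (h[i]).1 ≤ β) ∧
    M = (Finset.range h.length).biUnion mark

open Classical in
/-- The final stage: for the candidates in turn, propose the candidate `r` times, and return it if
it is confirmed in at least half of these queries; return failure if there is no such candidate. -/
def IsVerificationRun (r : ℕ) : List V → List (Response V) → Option V → Prop
  | [], h, out => h = [] ∧ out = none
  | s :: l, h, out => ∃ h₁ h₂, h = h₁ ++ h₂ ∧ h₁.length = r ∧ (∀ x ∈ h₁, x.1 = s) ∧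
      if r ≤ 2 * h₁.countP (fun x => x.2 = s) then h₂ = [] ∧ out = some s
      else IsVerificationRun r l h₂ out

/-- Binary entropy, in bits. -/
def entropy (p : ℝ) : ℝ := -p * Real.logb 2 p - (1 - p) * Real.logb 2 (1 - p)

/-- The expected factor by which the total likelihood decreases. -/
def tau (p β : ℝ) : ℝ := β * p + (1 - β) * (1 - p)

/-- `log (1/τ) - H(p)`. -/
def gap (p τ : ℝ) : ℝ := Real.logb 2 (1 / τ) - entropy p

def lambda2 (p τ : ℝ) : ℝ := gap p τ / (2 * Real.logb 2 (p / (1 - p)))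

/-- For `N ≤ 2` the first term of the minimum is infinite or undefined. -/
def lambda1 (p τ : ℝ) (N : ℕ) : ℝ :=
  if N ≤ 2 then lambda2 p τ
  else min (Real.sqrt (1 / Real.logb 2 (Real.logb 2 N))) (lambda2 p τ)

/-- The parameter `K` of the multiplicative weights procedure, for `N` candidates. -/
def rounds (p τ δ' lam : ℝ) (N : ℕ) : ℝ :=
  max (Real.logb 2 N / (gap p τ - lam * Real.logb 2 (p / (1 - p))) +
      Real.logb 2 (1 / τ) / Real.logb 2 (1 / δ'))
    (Real.log (1 / δ') / lam ^ 2) + 1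

open Classical in
/-- Learning with imperfect feedback, with initial candidates `S₀`, threshold `τ`, and target error
probability `δ`, where every model that is proposed by the multiplicative weights procedure has
potential at most `β`. The output `none` means failure. -/
def IsNoisyRun (p β θ τ δ : ℝ) (S₀ : Finset V) (h : List (Response V)) (out : Option V) : Prop :=
  ∃ (h₁ h₂ h₃ : List (Response V)) (S₁ S₂ : Finset V),
    h = h₁ ++ h₂ ++ h₃ ∧
    h₁.length = ⌈rounds p τ (δ / 5) (lambda1 p τ S₀.card) S₀.card⌉₊ + 1 ∧
    IsMultWeightsRun D p β θ S₀ h₁ S₁ ∧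
    (if S₁ = ∅ then h₂ = [] ∧ S₂ = ∅
      else h₂.length = ⌈rounds p τ (δ / 5) (lambda2 p τ) S₁.card⌉₊ + 1 ∧
        IsMultWeightsRun D p β θ S₁ h₂ S₂) ∧
    ∃ order : List V, order.Nodup ∧ (∀ s, s ∈ order ↔ s ∈ S₂) ∧
      IsVerificationRun ⌈2 * Real.log (S₂.card / (δ / 5)) / (2 * p - 1) ^ 2⌉₊ order h₃ out

end Algorithms

/-- The output of a learning program: failure, or the model in register `0`. -/
def State.output {V : Type} (σ : State V) : Option V :=
  if σ.nat 0 = 0 then none else some (σ.mdl 0)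

end

end InteractiveLearning

open InteractiveLearning

/-! The geometric core is that a weighted median has potential at most 1/2. If the neighbour s' of s
attracts a weight m out of the total W, then moving from s to s' brings every model of R(s,s')
closer by d(s,s') and takes every other model away by at most as much. So the weighted sum of
distances falls as soon as m > W/2. Local search that moves only if m/W exceeds 1/2 + 1/(2X), where
X is the input measure, lowers the sum by at least W/X per move. The sum starts at no more than the
diameter times W, so polynomially many moves suffice (`distSum_move`, `swp_searchProg`).

The likelihoods of exponentially many models cannot be summed, so they are replaced by frequencies
in a list of samples. An exponential moment bound and a union bound over all pairs (s,s') and both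
signs show that polynomially many samples make the frequencies of all sets R(s,s') accurate at once
(`drawProg_accurate`). This uniformity lets the search depend on the samples. Total variation
distance adds Δ to the potential (`Accurate.potential_le`). Since R(s,s) = {s}, the same accuracy
covers single models. This decides whether one candidate is left, with the threshold 3/4 and thanks
to Δ < 1/4 (`Accurate.candidates_iff`), and it finds the models to be marked, where Δ is lost twice
(`Accurate.heavy`).

Without feedback errors, β is bounded away from 1, so every query shrinks the candidate set
geometrically and polynomially many rounds suffice. With feedback errors, the first run of Algorithm
2 works with samples. The second run starts from S₁, for which the oracle is of no use; but S₁ is a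
short explicit list, so its likelihoods are computed exactly in real registers (`swp_exactStep`).
The round numbers are polynomial because, by continuity, the gap stays bounded below for small ε
(`exists_rounds_bound`).

Programs are verified by a weakest precondition calculus that ignores time and also certifies that
all resources stay below a number B (`swp_sound`). The running time is then a fixed polynomial in B.
The triples `HT` combine sure assertions, which keep the program within its resources even if
samples are inaccurate, with assertions that hold up to an error probability. Only drawing samples
contributes to the error, and the errors of all rounds are added. -/

namespace InteractiveLearning

noncomputable section

/-! ## Running time of programs in bounded states -/

namespace NExp

/-- The bit length of the value is at most `sizeBound * (B + 1)` in a state bounded by `B`. -/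
def sizeBound : NExp → ℕ
  | const k => k.size + 1
  | var _ => 1
  | lengthL _ => 1
  | lengthQ _ => 1
  | add a b => a.sizeBound + b.sizeBound
  | sub a _ => a.sizeBound
  | mul a b => a.sizeBound + b.sizeBound
  | div a _ => a.sizeBound

/-- The cost is at most `costBound * (B + 1)` in a state bounded by `B`. -/
def costBound : NExp → ℕ
  | const k => k.size + 1
  | var _ => 1
  | lengthL _ => 1
  | lengthQ _ => 1
  | add a b => a.costBound + b.costBound + 1 + (a.sizeBound + b.sizeBound)
  | sub a b => a.costBound + b.costBound + 1 + a.sizeBound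
  | mul a b => a.costBound + b.costBound + 1 + (a.sizeBound + b.sizeBound)
  | div a b => a.costBound + b.costBound + 1 + a.sizeBound

lemma one_le_sizeBound (a : NExp) : 1 ≤ a.sizeBound := by
  induction a <;> simp only [sizeBound] <;> omega

end NExp

/-- All number registers have at most `B` bits, all lists at most `B` elements. -/
structure State.Bounded {V : Type} (B : ℕ) (σ : State V) : Prop where
  nat : ∀ x, (σ.nat x).size ≤ B
  lst : ∀ l, (σ.lst l).length ≤ B
  resp : ∀ q, (σ.resp q).length ≤ B

lemma Nat_size_le_self (n : ℕ) : n.size ≤ n := Nat.size_le.2 Nat.lt_two_pow_self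

lemma Nat_size_mono {a b : ℕ} (h : a ≤ b) : a.size ≤ b.size := Nat.size_le_size h

namespace NExp

variable {V : Type} {B : ℕ} {σ : State V}

/-- Bit lengths at most add up under products, and also under sums once both bounds are positive;
truncated subtraction and division never increase a value. The hypothesis limits bit lengths and not
values because one input register holds the cardinality of the initial candidate set, which may be
exponential in n. -/
lemma size_eval_le (h : σ.Bounded B) (a : NExp) :
    (a.eval σ).size ≤ a.sizeBound * (B + 1) := by
  induction a with
  | const k => simp only [eval, sizeBound]; nlinarith
  | var x => simp only [eval, sizeBound]; have := h.nat x; omega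
  | lengthL l =>
    simp only [eval, sizeBound]; have := h.lst l
    have := Nat_size_le_self (σ.lst l).length; omega
  | lengthQ q =>
    simp only [eval, sizeBound]; have := h.resp q
    have := Nat_size_le_self (σ.resp q).length; omega
  | add a b iha ihb =>
    simp only [eval, sizeBound]
    rw [Nat.size_le] at *
    have h1 := a.one_le_sizeBound
    have h2 := b.one_le_sizeBound
    -- For x, y ≥ 2 the sum x + y is at most the product x y.
    have h3 : 2 ^ 1 ≤ 2 ^ (a.sizeBound * (B + 1)) := Nat.pow_le_pow_right (by norm_num) (by nlinarith)
    have h4 : 2 ^ 1 ≤ 2 ^ (b.sizeBound * (B + 1)) := Nat.pow_le_pow_right (by norm_num) (by nlinarith)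
    rw [add_mul, pow_add]
    nlinarith
  | sub a b iha ihb =>
    simp only [eval, sizeBound]
    exact (Nat_size_mono (Nat.sub_le _ _)).trans iha
  | mul a b iha ihb =>
    simp only [eval, sizeBound]
    rw [Nat.size_le] at *
    rw [add_mul, pow_add]
    exact Nat.mul_lt_mul'' iha ihb
  | div a b iha ihb =>
    simp only [eval, sizeBound]
    exact (Nat_size_mono (Nat.div_le_self _ _)).trans iha

lemma cost_le (h : σ.Bounded B) (a : NExp) : a.cost σ ≤ a.costBound * (B + 1) := by
  induction a with
  | const k => simp only [cost, costBound]; nlinarith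
  | var x => simp only [cost, costBound]; have := h.nat x; omega
  | lengthL l =>
    simp only [cost, costBound]; have := h.lst l
    have := Nat_size_le_self (σ.lst l).length; omega
  | lengthQ q =>
    simp only [cost, costBound]; have := h.resp q
    have := Nat_size_le_self (σ.resp q).length; omega
  | add a b iha ihb =>
    have := size_eval_le h (add a b)
    simp only [cost, costBound, sizeBound] at *; nlinarith
  | sub a b iha ihb =>
    have := size_eval_le h (sub a b)
    simp only [cost, costBound, sizeBound] at *; nlinarith
  | mul a b iha ihb =>
    have := size_eval_le h (mul a b)
    simp only [cost, costBound, sizeBound] at *; nlinarith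
  | div a b iha ihb =>
    have := size_eval_le h (div a b)
    simp only [cost, costBound, sizeBound] at *; nlinarith

end NExp

namespace RExp

def costBound : RExp → ℕ
  | nat a => a.costBound + 1
  | var _ => 1
  | add a b => a.costBound + b.costBound + 1
  | sub a b => a.costBound + b.costBound + 1
  | mul a b => a.costBound + b.costBound + 1
  | div a b => a.costBound + b.costBound + 1
  | ln a => a.costBound + 1
  | sqrt a => a.costBound + 1

lemma cost_le {V : Type} {B : ℕ} {σ : State V} (h : σ.Bounded B) (a : RExp) :
    a.cost σ ≤ a.costBound * (B + 1) := by
  induction a with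
  | nat a => simp only [cost, costBound]; have := NExp.cost_le h a; nlinarith
  | var x => simp only [cost, costBound]; omega
  | _ => simp only [cost, costBound] at *; nlinarith

end RExp

namespace BExp

def costBound : BExp → ℕ
  | le a b => a.costBound + b.costBound + 1
  | leR a b => a.costBound + b.costBound + 1
  | eqM _ _ => 1
  | not b => b.costBound + 1

lemma cost_le {V : Type} {B bits : ℕ} {σ : State V} (h : σ.Bounded B) (hb : bits ≤ B) (b : BExp) :
    b.cost bits σ ≤ b.costBound * (B + 1) := by
  induction b with
  | le a b =>
    simp only [cost, costBound]; have := NExp.cost_le h a; have := NExp.cost_le h b; nlinarith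
  | leR a b =>
    simp only [cost, costBound]; have := RExp.cost_le h a; have := RExp.cost_le h b; nlinarith
  | eqM => simp only [cost, costBound]; omega
  | not b ih => simp only [cost, costBound]; nlinarith

end BExp

namespace Prog

/-- A bound for the time that a program takes if all states on the way, all numbers of iterations
and all oracle times are bounded by `B`. -/
def timeBound : Prog → ℕ → ℕ
  | skip, _ => 1
  | seq c d, B => c.timeBound B + d.timeBound B
  | ite b c d, B => 1 + b.costBound * (B + 1) + c.timeBound B + d.timeBound B
  | loop a c, B => 1 + a.costBound * (B + 1) + B * (1 + c.timeBound B)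
  | forL _ _ c, B => 1 + B * (1 + B + c.timeBound B)
  | forQ _ _ _ c, B => 1 + B * (1 + 2 * B + c.timeBound B)
  | setN _ a, B => 1 + a.costBound * (B + 1)
  | setR _ a, B => 1 + a.costBound * (B + 1)
  | copyM _ _, B => 1 + B
  | clearL _, _ => 1
  | pushL _ _, B => 1 + B
  | clearQ _, _ => 1
  | pushQ _ _ _, B => 1 + 2 * B
  | sample _ _, B => 1 + B + B
  | check _ _ _, B => 1 + B + B
  | nbrs _ _, B => 1 + (1 + B) * (1 + B) + B
  | ask _ _, B => 1 + 2 * B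

-- Composing this polynomial with a polynomial bound for the resources B in terms of the input gives
-- the running time of each of the learning programs.
open Polynomial in
lemma exists_timeBound_eq_eval (c : Prog) : ∃ R : Polynomial ℕ, ∀ B, c.timeBound B = R.eval B := by
  induction c with
  | seq c d hc hd =>
    obtain ⟨R, hR⟩ := hc; obtain ⟨S, hS⟩ := hd
    exact ⟨R + S, fun B => by simp [timeBound, hR, hS]⟩
  | ite b c d hc hd =>
    obtain ⟨R, hR⟩ := hc; obtain ⟨S, hS⟩ := hd
    exact ⟨1 + C b.costBound * (X + 1) + R + S, fun B => by simp [timeBound, hR, hS]⟩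
  | loop a c hc =>
    obtain ⟨R, hR⟩ := hc
    exact ⟨1 + C a.costBound * (X + 1) + X * (1 + R), fun B => by simp [timeBound, hR]⟩
  | forL x l c hc =>
    obtain ⟨R, hR⟩ := hc
    exact ⟨1 + X * (1 + X + R), fun B => by simp [timeBound, hR]⟩
  | forQ x y q c hc =>
    obtain ⟨R, hR⟩ := hc
    exact ⟨1 + X * (1 + C 2 * X + R), fun B => by simp [timeBound, hR]⟩
  | skip => exact ⟨1, fun B => by simp [timeBound]⟩
  | setN x a => exact ⟨1 + C a.costBound * (X + 1), fun B => by simp [timeBound]⟩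
  | setR x a => exact ⟨1 + C a.costBound * (X + 1), fun B => by simp [timeBound]⟩
  | copyM => exact ⟨1 + X, fun B => by simp [timeBound]⟩
  | clearL => exact ⟨1, fun B => by simp [timeBound]⟩
  | clearQ => exact ⟨1, fun B => by simp [timeBound]⟩
  | pushL => exact ⟨1 + X, fun B => by simp [timeBound]⟩
  | pushQ => exact ⟨1 + C 2 * X, fun B => by simp [timeBound]⟩
  | sample => exact ⟨1 + X + X, fun B => by simp [timeBound]⟩
  | check => exact ⟨1 + X + X, fun B => by simp [timeBound]⟩
  | nbrs => exact ⟨1 + (1 + X) * (1 + X) + X, fun B => by simp [timeBound]⟩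
  | ask => exact ⟨1 + C 2 * X, fun B => by simp [timeBound]⟩

end Prog

/-! ## A weakest precondition calculus that ignores time -/

namespace State

variable {V : Type}

/-- The state with its clock set to zero. -/
def erase (σ : State V) : State V := { σ with time := 0 }

/-- The state after the interaction `(s, s')` with the user. -/
def addHist (σ : State V) (s s' : V) : State V := { σ with hist := σ.hist ++ [(s, s')] }

end State

/-- No expression or test reads the clock, so assertions can be made about states with the clock
erased, and time is accounted for separately. -/
lemma NExp.eval_erase {V : Type} (σ : State V) (a : NExp) : a.eval σ.erase = a.eval σ := by
  induction a <;> simp_all [NExp.eval, State.erase]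

lemma RExp.eval_erase {V : Type} (σ : State V) (a : RExp) : a.eval σ.erase = a.eval σ := by
  induction a <;> simp_all [RExp.eval, State.erase]
  exact NExp.eval_erase σ _

lemma BExp.holds_erase {V : Type} (σ : State V) (b : BExp) : b.Holds σ.erase ↔ b.Holds σ := by
  induction b <;> simp_all [BExp.Holds, RExp.eval_erase, NExp.eval_erase]
  simp [State.erase]

variable {V : Type}

/-- `swp O U B c Q σ`: started in the state `σ`, the program `c` surely leads to a state with `Q`,
and on the way every number that is stored, every number of iterations, every length of a list
and every oracle time is at most `B`. -/
def swp (O : Oracles V) (U : User V) (B : ℕ) : Prog → (State V → Prop) → State V → Prop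
  | .skip, Q, σ => Q σ
  | .seq c d, Q, σ => swp O U B c (fun τ => swp O U B d Q τ) σ
  | .ite b c d, Q, σ => (b.Holds σ → swp O U B c Q σ) ∧ (¬ b.Holds σ → swp O U B d Q σ)
  | .loop a c, Q, σ => a.eval σ ≤ B ∧ (swp O U B c)^[a.eval σ] Q σ
  | .forL x l c, Q, σ => (σ.lst l).foldr (fun s R τ => swp O U B c R (τ.setMdl x s)) Q σ
  | .forQ x y q c, Q, σ =>
      (σ.resp q).foldr (fun r R τ => swp O U B c R ((τ.setMdl x r.1).setMdl y r.2)) Q σ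
  | .setN x a, Q, σ => a.eval σ ≤ B ∧ Q (σ.setNat x (a.eval σ))
  | .setR x a, Q, σ => Q (σ.setReal x (a.eval σ))
  | .copyM x y, Q, σ => Q (σ.setMdl x (σ.mdl y))
  | .clearL l, Q, σ => Q (σ.setLst l [])
  | .pushL l x, Q, σ => (σ.lst l).length + 1 ≤ B ∧ Q (σ.setLst l (σ.lst l ++ [σ.mdl x]))
  | .clearQ q, Q, σ => Q (σ.setResp q [])
  | .pushQ q x y, Q, σ =>
      (σ.resp q).length + 1 ≤ B ∧ Q (σ.setResp q (σ.resp q ++ [(σ.mdl x, σ.mdl y)]))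
  | .sample x q, Q, σ => O.sampleTime (σ.resp q) ≤ B ∧
      ∀ s ∈ (O.sample (σ.resp q)).support, Q (σ.setMdl x s)
  | .check z x q, Q, σ => 1 ≤ B ∧ O.checkTime (σ.resp q) (σ.mdl x) ≤ B ∧
      Q (σ.setNat z (if O.check (σ.resp q) (σ.mdl x) then 1 else 0))
  | .nbrs l x, Q, σ => (O.nbrs (σ.mdl x)).length ≤ B ∧ O.nbrsTime (σ.mdl x) ≤ B ∧
      Q (σ.setLst l (O.nbrs (σ.mdl x)))
  | .ask y x, Q, σ => ∀ s' ∈ (U σ.hist (σ.mdl x)).support,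
      Q ((σ.setMdl y s').addHist (σ.mdl x) s')

variable {O : Oracles V} {U : User V} {B : ℕ}

namespace State.Bounded

variable {σ : State V}

lemma tick (h : σ.Bounded B) (k : ℕ) : (σ.tick k).Bounded B := ⟨h.nat, h.lst, h.resp⟩

lemma setMdl (h : σ.Bounded B) (x : ℕ) (s : V) : (σ.setMdl x s).Bounded B :=
  ⟨h.nat, h.lst, h.resp⟩

lemma setReal (h : σ.Bounded B) (x : ℕ) (s : ℝ) : (σ.setReal x s).Bounded B :=
  ⟨h.nat, h.lst, h.resp⟩

lemma addHist (h : σ.Bounded B) (s s' : V) : (σ.addHist s s').Bounded B :=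
  ⟨h.nat, h.lst, h.resp⟩

lemma setNat (h : σ.Bounded B) (x : ℕ) {k : ℕ} (hk : k ≤ B) : (σ.setNat x k).Bounded B := by
  refine ⟨fun y => ?_, h.lst, h.resp⟩
  simp only [State.setNat, Function.update_apply]
  split_ifs
  · exact (Nat_size_le_self k).trans hk
  · exact h.nat y

lemma setLst (h : σ.Bounded B) (x : ℕ) {L : List V} (hL : L.length ≤ B) :
    (σ.setLst x L).Bounded B := by
  refine ⟨h.nat, fun y => ?_, h.resp⟩
  simp only [State.setLst, Function.update_apply]
  split_ifs
  · exact hL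
  · exact h.lst y

lemma setResp (h : σ.Bounded B) (x : ℕ) {L : List (Response V)} (hL : L.length ≤ B) :
    (σ.setResp x L).Bounded B := by
  refine ⟨h.nat, h.lst, fun y => ?_⟩
  simp only [State.setResp, Function.update_apply]
  split_ifs
  · exact hL
  · exact h.resp y

end State.Bounded

variable [Fintype V]

/-- The resource side conditions in `swp` are just what is needed to keep states bounded and to
charge each instruction by `timeBound`. The argument is a structural induction over all states in
the support of the law. -/
lemma swp_sound (hbits : Nat.clog 2 (Fintype.card V) ≤ B) (c : Prog) :
    ∀ (Q : State V → Prop) (σ : State V), σ.Bounded B → swp O U B c Q σ.erase →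
      ∀ τ ∈ (c.run O U σ).support,
        Q τ.erase ∧ τ.Bounded B ∧ τ.time ≤ σ.time + c.timeBound B := by
  induction c with
  | skip =>
    intro Q σ hσ h τ hτ
    simp only [Prog.run, PMF.support_pure, Set.mem_singleton_iff] at hτ
    subst hτ
    exact ⟨h, hσ.tick _, by simp [Prog.timeBound, State.tick]⟩
  | seq c d ihc ihd =>
    intro Q σ hσ h τ hτ
    simp only [Prog.run, PMF.mem_support_bind_iff] at hτ
    obtain ⟨ρ, hρ, hτ⟩ := hτ
    obtain ⟨h1, h2, h3⟩ := ihc _ σ hσ h ρ hρ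
    obtain ⟨h4, h5, h6⟩ := ihd _ ρ h2 h1 τ hτ
    exact ⟨h4, h5, by simp only [Prog.timeBound]; omega⟩
  | ite b c d ihc ihd =>
    intro Q σ hσ h τ hτ
    have hb := BExp.cost_le hσ hbits b
    simp only [swp, BExp.holds_erase] at h
    simp only [Prog.run] at hτ
    split_ifs at hτ with hif
    · obtain ⟨h1, h2, h3⟩ := ihc Q _ (hσ.tick _) (h.1 hif) τ hτ
      refine ⟨h1, h2, ?_⟩
      simp only [State.tick, Prog.timeBound] at *; omega
    · obtain ⟨h1, h2, h3⟩ := ihd Q _ (hσ.tick _) (h.2 hif) τ hτ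
      refine ⟨h1, h2, ?_⟩
      simp only [State.tick, Prog.timeBound] at *; omega
  | loop a c ih =>
    intro Q σ hσ h τ hτ
    have ha := NExp.cost_le hσ a
    simp only [swp, NExp.eval_erase] at h
    simp only [Prog.run] at hτ
    -- The law of a loop is unrolled from its first iteration, and the iterated precondition is
    -- peeled off on the outside. The two match if the induction on k allows an arbitrary starting
    -- law and an arbitrary time bound for it.
    have key : ∀ (k : ℕ) (μ : PMF (State V)) (t : ℕ),
        (∀ ρ ∈ μ.support, (swp O U B c)^[k] Q ρ.erase ∧ ρ.Bounded B ∧ ρ.time ≤ t) →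
        ∀ τ ∈ ((fun μ => μ.bind fun τ => c.run O U (τ.tick 1))^[k] μ).support,
          Q τ.erase ∧ τ.Bounded B ∧ τ.time ≤ t + k * (1 + c.timeBound B) := by
      intro k
      induction k with
      | zero => intro μ t hμ τ hτ; simpa using hμ τ hτ
      | succ k ihk =>
        intro μ t hμ τ hτ
        rw [Function.iterate_succ_apply] at hτ
        obtain ⟨h1, h2, h3⟩ := ihk _ (t + (1 + c.timeBound B)) (by
          intro ρ hρ
          simp only [PMF.mem_support_bind_iff] at hρ
          obtain ⟨π, hπ, hρ⟩ := hρ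
          obtain ⟨g1, g2, g3⟩ := hμ π hπ
          rw [Function.iterate_succ_apply'] at g1
          obtain ⟨f1, f2, f3⟩ := ih _ _ (g2.tick 1) g1 ρ hρ
          refine ⟨f1, f2, ?_⟩
          simp only [State.tick] at f3; omega) τ hτ
        exact ⟨h1, h2, by rw [add_one_mul]; omega⟩
    obtain ⟨h1, h2, h3⟩ := key _ _ (σ.time + (1 + a.cost σ)) (by
      intro ρ hρ
      simp only [PMF.support_pure, Set.mem_singleton_iff] at hρ
      subst hρ
      exact ⟨h.2, hσ.tick _, le_rfl⟩) τ hτ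
    refine ⟨h1, h2, ?_⟩
    have := Nat.mul_le_mul_right (1 + c.timeBound B) h.1
    simp only [Prog.timeBound]; omega
  | forL x l c ih =>
    intro Q σ hσ h τ hτ
    simp only [Prog.run] at hτ
    have key : ∀ (L : List V) (μ : PMF (State V)) (t : ℕ),
        (∀ ρ ∈ μ.support, L.foldr (fun s R τ => swp O U B c R (τ.setMdl x s)) Q ρ.erase ∧
          ρ.Bounded B ∧ ρ.time ≤ t) →
        ∀ τ ∈ (L.foldl (fun μ s => μ.bind fun τ =>
          c.run O U ((τ.setMdl x s).tick (1 + Nat.clog 2 (Fintype.card V)))) μ).support,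
          Q τ.erase ∧ τ.Bounded B ∧ τ.time ≤ t + L.length * (1 + B + c.timeBound B) := by
      intro L
      induction L with
      | nil => intro μ t hμ τ hτ; simpa using hμ τ hτ
      | cons s L ihk =>
        intro μ t hμ τ hτ
        rw [List.foldl_cons] at hτ
        obtain ⟨h1, h2, h3⟩ := ihk _ (t + (1 + B + c.timeBound B)) (by
          intro ρ hρ
          simp only [PMF.mem_support_bind_iff] at hρ
          obtain ⟨π, hπ, hρ⟩ := hρ
          obtain ⟨g1, g2, g3⟩ := hμ π hπ
          rw [List.foldr_cons] at g1
          obtain ⟨f1, f2, f3⟩ := ih _ _ ((g2.setMdl x s).tick _) g1 ρ hρ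
          refine ⟨f1, f2, ?_⟩
          simp only [State.tick, State.setMdl] at f3; omega) τ hτ
        exact ⟨h1, h2, by rw [List.length_cons, add_one_mul]; omega⟩
    obtain ⟨h1, h2, h3⟩ := key _ _ (σ.time + 1) (by
      intro ρ hρ
      simp only [PMF.support_pure, Set.mem_singleton_iff] at hρ
      subst hρ
      exact ⟨h, hσ.tick _, le_rfl⟩) τ hτ
    refine ⟨h1, h2, ?_⟩
    have := Nat.mul_le_mul_right (1 + B + c.timeBound B) (hσ.lst l)
    simp only [Prog.timeBound]; omega
  | forQ x y q c ih =>
    intro Q σ hσ h τ hτ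
    simp only [Prog.run] at hτ
    have key : ∀ (L : List (Response V)) (μ : PMF (State V)) (t : ℕ),
        (∀ ρ ∈ μ.support,
          L.foldr (fun r R τ => swp O U B c R ((τ.setMdl x r.1).setMdl y r.2)) Q ρ.erase ∧
          ρ.Bounded B ∧ ρ.time ≤ t) →
        ∀ τ ∈ (L.foldl (fun μ r => μ.bind fun τ => c.run O U
          (((τ.setMdl x r.1).setMdl y r.2).tick (1 + 2 * Nat.clog 2 (Fintype.card V)))) μ).support,
          Q τ.erase ∧ τ.Bounded B ∧ τ.time ≤ t + L.length * (1 + 2 * B + c.timeBound B) := by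
      intro L
      induction L with
      | nil => intro μ t hμ τ hτ; simpa using hμ τ hτ
      | cons r L ihk =>
        intro μ t hμ τ hτ
        rw [List.foldl_cons] at hτ
        obtain ⟨h1, h2, h3⟩ := ihk _ (t + (1 + 2 * B + c.timeBound B)) (by
          intro ρ hρ
          simp only [PMF.mem_support_bind_iff] at hρ
          obtain ⟨π, hπ, hρ⟩ := hρ
          obtain ⟨g1, g2, g3⟩ := hμ π hπ
          rw [List.foldr_cons] at g1
          obtain ⟨f1, f2, f3⟩ := ih _ _ (((g2.setMdl x r.1).setMdl y r.2).tick _) g1 ρ hρ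
          refine ⟨f1, f2, ?_⟩
          simp only [State.tick, State.setMdl] at f3; omega) τ hτ
        exact ⟨h1, h2, by rw [List.length_cons, add_one_mul]; omega⟩
    obtain ⟨h1, h2, h3⟩ := key _ _ (σ.time + 1) (by
      intro ρ hρ
      simp only [PMF.support_pure, Set.mem_singleton_iff] at hρ
      subst hρ
      exact ⟨h, hσ.tick _, le_rfl⟩) τ hτ
    refine ⟨h1, h2, ?_⟩
    have := Nat.mul_le_mul_right (1 + 2 * B + c.timeBound B) (hσ.resp q)
    simp only [Prog.timeBound]; omega
  | setN x a =>
    intro Q σ hσ h τ hτ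
    have ha := NExp.cost_le hσ a
    simp only [Prog.run, PMF.support_pure, Set.mem_singleton_iff] at hτ
    simp only [swp, NExp.eval_erase] at h
    subst hτ
    exact ⟨h.2, (hσ.setNat x h.1).tick _, by simp [Prog.timeBound, State.tick, State.setNat, ha]⟩
  | setR x a =>
    intro Q σ hσ h τ hτ
    have ha := RExp.cost_le hσ a
    simp only [Prog.run, PMF.support_pure, Set.mem_singleton_iff] at hτ
    simp only [swp, RExp.eval_erase] at h
    subst hτ
    exact ⟨h, (hσ.setReal x _).tick _, by simp [Prog.timeBound, State.tick, State.setReal, ha]⟩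
  | copyM x y =>
    intro Q σ hσ h τ hτ
    simp only [Prog.run, PMF.support_pure, Set.mem_singleton_iff] at hτ
    subst hτ
    exact ⟨h, (hσ.setMdl x _).tick _, by simp [Prog.timeBound, State.tick, State.setMdl, hbits]⟩
  | clearL l =>
    intro Q σ hσ h τ hτ
    simp only [Prog.run, PMF.support_pure, Set.mem_singleton_iff] at hτ
    subst hτ
    exact ⟨h, (hσ.setLst l (by simp)).tick _, by simp [Prog.timeBound, State.tick, State.setLst]⟩
  | pushL l x =>
    intro Q σ hσ h τ hτ
    simp only [Prog.run, PMF.support_pure, Set.mem_singleton_iff] at hτ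
    subst hτ
    exact ⟨h.2, (hσ.setLst l (by simpa [State.erase] using h.1)).tick _,
      by simp [Prog.timeBound, State.tick, State.setLst, hbits]⟩
  | clearQ q =>
    intro Q σ hσ h τ hτ
    simp only [Prog.run, PMF.support_pure, Set.mem_singleton_iff] at hτ
    subst hτ
    exact ⟨h, (hσ.setResp q (by simp)).tick _,
      by simp [Prog.timeBound, State.tick, State.setResp]⟩
  | pushQ q x y =>
    intro Q σ hσ h τ hτ
    simp only [Prog.run, PMF.support_pure, Set.mem_singleton_iff] at hτ
    subst hτ
    exact ⟨h.2, (hσ.setResp q (by simpa [State.erase] using h.1)).tick _,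
      by simp [Prog.timeBound, State.tick, State.setResp, hbits]⟩
  | sample x q =>
    intro Q σ hσ h τ hτ
    simp only [Prog.run, PMF.support_map, Set.mem_image] at hτ
    obtain ⟨s, hs, rfl⟩ := hτ
    refine ⟨h.2 s hs, (hσ.setMdl x s).tick _, ?_⟩
    have : O.sampleTime (σ.resp q) ≤ B := h.1
    simp only [Prog.timeBound, State.tick, State.setMdl]; omega
  | check z x q =>
    intro Q σ hσ h τ hτ
    simp only [Prog.run, PMF.support_pure, Set.mem_singleton_iff] at hτ
    subst hτ
    refine ⟨h.2.2, (hσ.setNat z ?_).tick _, ?_⟩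
    · have := h.1; split_ifs <;> omega
    · have : O.checkTime (σ.resp q) (σ.mdl x) ≤ B := h.2.1
      simp only [Prog.timeBound, State.tick, State.setNat]; omega
  | nbrs l x =>
    intro Q σ hσ h τ hτ
    simp only [Prog.run, PMF.support_pure, Set.mem_singleton_iff] at hτ
    subst hτ
    have h1 : (O.nbrs (σ.mdl x)).length ≤ B := h.1
    have h2 : O.nbrsTime (σ.mdl x) ≤ B := h.2.1
    refine ⟨h.2.2, (hσ.setLst l h1).tick _, ?_⟩
    have : (1 + (O.nbrs (σ.mdl x)).length) * (1 + Nat.clog 2 (Fintype.card V)) ≤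
      (1 + B) * (1 + B) := Nat.mul_le_mul (by omega) (by omega)
    simp only [Prog.timeBound, State.tick, State.setLst]; omega
  | ask y x =>
    intro Q σ hσ h τ hτ
    simp only [Prog.run, PMF.support_map, Set.mem_image] at hτ
    obtain ⟨s, hs, rfl⟩ := hτ
    refine ⟨h s hs, ((hσ.setMdl y s).addHist (σ.mdl x) s).tick _, ?_⟩
    simp only [Prog.timeBound, State.tick, State.setMdl]; omega

omit [Fintype V] in
lemma swp_mono {c : Prog} {Q Q' : State V → Prop} {σ : State V} (h : swp O U B c Q σ)
    (hQ : ∀ τ, Q τ → Q' τ) : swp O U B c Q' σ := by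
  induction c generalizing Q Q' σ with
  | skip => exact hQ _ h
  | seq c d ihc ihd => exact ihc h fun τ hτ => ihd hτ hQ
  | ite b c d ihc ihd => exact ⟨fun hb => ihc (h.1 hb) hQ, fun hb => ihd (h.2 hb) hQ⟩
  | loop a c ih =>
    refine ⟨h.1, ?_⟩
    have key : ∀ k σ, (swp O U B c)^[k] Q σ → (swp O U B c)^[k] Q' σ := by
      intro k
      induction k with
      | zero => exact fun σ h => hQ σ h
      | succ k ihk =>
        intro σ h
        rw [Function.iterate_succ_apply'] at h ⊢
        exact ih h ihk
    exact key _ _ h.2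
  | forL x l c ih =>
    have key : ∀ (L : List V) σ, L.foldr (fun s R τ => swp O U B c R (τ.setMdl x s)) Q σ →
        L.foldr (fun s R τ => swp O U B c R (τ.setMdl x s)) Q' σ := by
      intro L
      induction L with
      | nil => exact fun σ h => hQ σ h
      | cons s L ihk => exact fun σ h => ih h ihk
    exact key _ _ h
  | forQ x y q c ih =>
    have key : ∀ (L : List (Response V)) σ,
        L.foldr (fun r R τ => swp O U B c R ((τ.setMdl x r.1).setMdl y r.2)) Q σ →
        L.foldr (fun r R τ => swp O U B c R ((τ.setMdl x r.1).setMdl y r.2)) Q' σ := by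
      intro L
      induction L with
      | nil => exact fun σ h => hQ σ h
      | cons s L ihk => exact fun σ h => ih h ihk
    exact key _ _ h
  | setN x a => exact ⟨h.1, hQ _ h.2⟩
  | setR x a => exact hQ _ h
  | copyM x y => exact hQ _ h
  | clearL l => exact hQ _ h
  | pushL l x => exact ⟨h.1, hQ _ h.2⟩
  | clearQ q => exact hQ _ h
  | pushQ q x y => exact ⟨h.1, hQ _ h.2⟩
  | sample x q => exact ⟨h.1, fun s hs => hQ _ (h.2 s hs)⟩
  | check z x q => exact ⟨h.1, h.2.1, hQ _ h.2.2⟩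
  | nbrs l x => exact ⟨h.1, h.2.1, hQ _ h.2.2⟩
  | ask y x => exact fun s hs => hQ _ (h s hs)

/-! ## Frames -/

/-- Which registers a program may write to, and whether it may talk to the user. -/
structure Writes where
  nat : ℕ → Bool
  real : ℕ → Bool
  mdl : ℕ → Bool
  lst : ℕ → Bool
  resp : ℕ → Bool
  hist : Bool

namespace Writes

def none : Writes := ⟨fun _ => false, fun _ => false, fun _ => false, fun _ => false,
  fun _ => false, false⟩

def union (v w : Writes) : Writes := ⟨fun x => v.nat x || w.nat x, fun x => v.real x || w.real x,
  fun x => v.mdl x || w.mdl x, fun x => v.lst x || w.lst x, fun x => v.resp x || w.resp x,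
  v.hist || w.hist⟩

structure Sub (v w : Writes) : Prop where
  nat : ∀ x, w.nat x = false → v.nat x = false
  real : ∀ x, w.real x = false → v.real x = false
  mdl : ∀ x, w.mdl x = false → v.mdl x = false
  lst : ∀ x, w.lst x = false → v.lst x = false
  resp : ∀ x, w.resp x = false → v.resp x = false
  hist : w.hist = false → v.hist = false

lemma Sub.refl (v : Writes) : v.Sub v :=
  ⟨fun _ => id, fun _ => id, fun _ => id, fun _ => id, fun _ => id, id⟩

lemma Sub.trans {u v w : Writes} (h : u.Sub v) (h' : v.Sub w) : u.Sub w :=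
  ⟨fun x hx => h.nat x (h'.nat x hx), fun x hx => h.real x (h'.real x hx),
    fun x hx => h.mdl x (h'.mdl x hx), fun x hx => h.lst x (h'.lst x hx),
    fun x hx => h.resp x (h'.resp x hx), fun hx => h.hist (h'.hist hx)⟩

lemma sub_union_left (v w : Writes) : v.Sub (v.union w) := by
  constructor <;> simp +contextual [union]

lemma sub_union_right (v w : Writes) : w.Sub (v.union w) := by
  constructor <;> simp +contextual [union]

end Writes

/-- The registers that a program may write to. -/
def Prog.writes : Prog → Writes
  | .skip => .none
  | .seq c d => c.writes.union d.writes
  | .ite _ c d => c.writes.union d.writes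
  | .loop _ c => c.writes
  | .forL x _ c => Writes.union { Writes.none with mdl := fun i => i == x } c.writes
  | .forQ x y _ c => Writes.union { Writes.none with mdl := fun i => i == x || i == y } c.writes
  | .setN x _ => { Writes.none with nat := fun i => i == x }
  | .setR x _ => { Writes.none with real := fun i => i == x }
  | .copyM x _ => { Writes.none with mdl := fun i => i == x }
  | .clearL l => { Writes.none with lst := fun i => i == l }
  | .pushL l _ => { Writes.none with lst := fun i => i == l }
  | .clearQ q => { Writes.none with resp := fun i => i == q }
  | .pushQ q _ _ => { Writes.none with resp := fun i => i == q }
  | .sample x _ => { Writes.none with mdl := fun i => i == x }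
  | .check z _ _ => { Writes.none with nat := fun i => i == z }
  | .nbrs l _ => { Writes.none with lst := fun i => i == l }
  | .ask y _ => { Writes.none with mdl := fun i => i == y, hist := true }

/-- `τ` agrees with `σ` off the registers in `W`. -/
structure Frame (W : Writes) (σ τ : State V) : Prop where
  nat : ∀ x, W.nat x = false → τ.nat x = σ.nat x
  real : ∀ x, W.real x = false → τ.real x = σ.real x
  mdl : ∀ x, W.mdl x = false → τ.mdl x = σ.mdl x
  lst : ∀ x, W.lst x = false → τ.lst x = σ.lst x
  resp : ∀ x, W.resp x = false → τ.resp x = σ.resp x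
  hist : W.hist = false → τ.hist = σ.hist

namespace Frame

omit [Fintype V]

variable {W : Writes} {σ τ ρ : State V}

lemma refl (W : Writes) (σ : State V) : Frame W σ σ :=
  ⟨fun _ _ => rfl, fun _ _ => rfl, fun _ _ => rfl, fun _ _ => rfl, fun _ _ => rfl, fun _ => rfl⟩

lemma trans (h : Frame W σ τ) (h' : Frame W τ ρ) : Frame W σ ρ :=
  ⟨fun x hx => (h'.nat x hx).trans (h.nat x hx), fun x hx => (h'.real x hx).trans (h.real x hx),
    fun x hx => (h'.mdl x hx).trans (h.mdl x hx), fun x hx => (h'.lst x hx).trans (h.lst x hx),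
    fun x hx => (h'.resp x hx).trans (h.resp x hx), fun hx => (h'.hist hx).trans (h.hist hx)⟩

lemma mono {W' : Writes} (h : Frame W σ τ) (hW : W.Sub W') : Frame W' σ τ :=
  ⟨fun x hx => h.nat x (hW.nat x hx), fun x hx => h.real x (hW.real x hx),
    fun x hx => h.mdl x (hW.mdl x hx), fun x hx => h.lst x (hW.lst x hx),
    fun x hx => h.resp x (hW.resp x hx), fun hx => h.hist (hW.hist hx)⟩

lemma setMdl (h : Frame W σ τ) {x : ℕ} (hx : W.mdl x = true) (s : V) :
    Frame W σ (τ.setMdl x s) := by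
  refine ⟨h.nat, h.real, fun y hy => ?_, h.lst, h.resp, h.hist⟩
  have : y ≠ x := by rintro rfl; simp [hx] at hy
  simp [State.setMdl, this, h.mdl y hy]

lemma setNat (h : Frame W σ τ) {x : ℕ} (hx : W.nat x = true) (k : ℕ) :
    Frame W σ (τ.setNat x k) := by
  refine ⟨fun y hy => ?_, h.real, h.mdl, h.lst, h.resp, h.hist⟩
  have : y ≠ x := by rintro rfl; simp [hx] at hy
  simp [State.setNat, this, h.nat y hy]

lemma setLst (h : Frame W σ τ) {x : ℕ} (hx : W.lst x = true) (L : List V) :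
    Frame W σ (τ.setLst x L) := by
  refine ⟨h.nat, h.real, h.mdl, fun y hy => ?_, h.resp, h.hist⟩
  have : y ≠ x := by rintro rfl; simp [hx] at hy
  simp [State.setLst, this, h.lst y hy]

end Frame

-- The frame refers to a fixed earlier state σ₀ and not to the start of `c`, so that it passes
-- through sequences and loops unchanged.
omit [Fintype V] in
lemma swp_frame {W : Writes} {c : Prog} {σ₀ σ : State V} {Q : State V → Prop}
    (hW : c.writes.Sub W) (hF : Frame W σ₀ σ) (h : swp O U B c Q σ) :
    swp O U B c (fun τ => Frame W σ₀ τ ∧ Q τ) σ := by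
  induction c generalizing Q σ with
  | skip => exact ⟨hF, h⟩
  | seq c d ihc ihd =>
    exact swp_mono (c := c) (ihc ((Writes.sub_union_left _ _).trans hW) hF h)
      fun τ hτ => ihd ((Writes.sub_union_right _ _).trans hW) hτ.1 hτ.2
  | ite b c d ihc ihd =>
    exact ⟨fun hb => ihc ((Writes.sub_union_left _ _).trans hW) hF (h.1 hb),
      fun hb => ihd ((Writes.sub_union_right _ _).trans hW) hF (h.2 hb)⟩
  | loop a c ih =>
    refine ⟨h.1, ?_⟩
    have key : ∀ k σ, Frame W σ₀ σ → (swp O U B c)^[k] Q σ →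
        (swp O U B c)^[k] (fun τ => Frame W σ₀ τ ∧ Q τ) σ := by
      intro k
      induction k with
      | zero => exact fun σ hF h => ⟨hF, h⟩
      | succ k ihk =>
        intro σ hF h
        rw [Function.iterate_succ_apply'] at h ⊢
        exact swp_mono (ih hW hF h) fun τ hτ => ihk τ hτ.1 hτ.2
    exact key _ _ hF h.2
  | forL x l c ih =>
    have hx : W.mdl x = true := by
      by_contra hx
      have := hW.mdl x (by simpa using hx)
      simp [Prog.writes, Writes.union] at this
    have key : ∀ (L : List V) σ, Frame W σ₀ σ →
        L.foldr (fun s R τ => swp O U B c R (τ.setMdl x s)) Q σ →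
        L.foldr (fun s R τ => swp O U B c R (τ.setMdl x s)) (fun τ => Frame W σ₀ τ ∧ Q τ) σ := by
      intro L
      induction L with
      | nil => exact fun σ hF h => ⟨hF, h⟩
      | cons s L ihk =>
        intro σ hF h
        exact swp_mono (ih ((Writes.sub_union_right _ _).trans hW) (hF.setMdl hx s) h)
          fun τ hτ => ihk τ hτ.1 hτ.2
    exact key _ _ hF h
  | forQ x y q c ih =>
    have hx : W.mdl x = true := by
      by_contra hx
      have := hW.mdl x (by simpa using hx)
      simp [Prog.writes, Writes.union] at this
    have hy : W.mdl y = true := by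
      by_contra hx
      have := hW.mdl y (by simpa using hx)
      simp [Prog.writes, Writes.union] at this
    have key : ∀ (L : List (Response V)) σ, Frame W σ₀ σ →
        L.foldr (fun r R τ => swp O U B c R ((τ.setMdl x r.1).setMdl y r.2)) Q σ →
        L.foldr (fun r R τ => swp O U B c R ((τ.setMdl x r.1).setMdl y r.2))
          (fun τ => Frame W σ₀ τ ∧ Q τ) σ := by
      intro L
      induction L with
      | nil => exact fun σ hF h => ⟨hF, h⟩
      | cons s L ihk =>
        intro σ hF h
        exact swp_mono (ih ((Writes.sub_union_right _ _).trans hW)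
          ((hF.setMdl hx s.1).setMdl hy s.2) h) fun τ hτ => ihk τ hτ.1 hτ.2
    exact key _ _ hF h
  | setN x a =>
    refine ⟨h.1, hF.trans ((?_ : Frame _ _ _).mono hW), h.2⟩
    constructor <;> simp +contextual [Prog.writes, State.setNat]
  | setR x a =>
    refine ⟨hF.trans ((?_ : Frame _ _ _).mono hW), h⟩
    constructor <;> simp +contextual [Prog.writes, State.setReal]
  | copyM x y =>
    refine ⟨hF.trans ((?_ : Frame _ _ _).mono hW), h⟩
    constructor <;> simp +contextual [Prog.writes, State.setMdl]
  | clearL l =>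
    refine ⟨hF.trans ((?_ : Frame _ _ _).mono hW), h⟩
    constructor <;> simp +contextual [Prog.writes, State.setLst]
  | pushL l x =>
    refine ⟨h.1, hF.trans ((?_ : Frame _ _ _).mono hW), h.2⟩
    constructor <;> simp +contextual [Prog.writes, State.setLst]
  | clearQ q =>
    refine ⟨hF.trans ((?_ : Frame _ _ _).mono hW), h⟩
    constructor <;> simp +contextual [Prog.writes, State.setResp]
  | pushQ q x y =>
    refine ⟨h.1, hF.trans ((?_ : Frame _ _ _).mono hW), h.2⟩
    constructor <;> simp +contextual [Prog.writes, State.setResp]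
  | sample x q =>
    refine ⟨h.1, fun s hs => ⟨hF.trans ((?_ : Frame _ _ _).mono hW), h.2 s hs⟩⟩
    constructor <;> simp +contextual [Prog.writes, State.setMdl]
  | check z x q =>
    refine ⟨h.1, h.2.1, hF.trans ((?_ : Frame _ _ _).mono hW), h.2.2⟩
    constructor <;> simp +contextual [Prog.writes, State.setNat]
  | nbrs l x =>
    refine ⟨h.1, h.2.1, hF.trans ((?_ : Frame _ _ _).mono hW), h.2.2⟩
    constructor <;> simp +contextual [Prog.writes, State.setLst]
  | ask y x =>
    refine fun s hs => ⟨hF.trans ((?_ : Frame _ _ _).mono hW), h s hs⟩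
    constructor <;>
      simp +contextual [Prog.writes, State.setMdl, State.addHist]

/-! ## Rules -/

section Rules

omit [Fintype V]

variable {σ : State V} {Q : State V → Prop}

/-- The specification of a subprogram need not mention the registers that it leaves alone: as
`writes` evaluates on concrete programs, the equations in the frame are available by `rfl`. -/
lemma swp_call {c : Prog} {P : State V → Prop} (h : swp O U B c P σ)
    (hQ : ∀ τ, Frame c.writes σ τ → P τ → Q τ) : swp O U B c Q σ :=
  swp_mono (swp_frame (Writes.Sub.refl _) (Frame.refl _ _) h) fun τ hτ => hQ τ hτ.1 hτ.2

/-- The count is read once, at the start, so the invariant is indexed by the number of completed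
iterations; the induction runs over those that remain. -/
lemma swp_loop {a : NExp} {c : Prog} (I : ℕ → State V → Prop) (hB : a.eval σ ≤ B) (h0 : I 0 σ)
    (step : ∀ i τ, i < a.eval σ → Frame c.writes σ τ → I i τ → swp O U B c (I (i + 1)) τ)
    (post : ∀ τ, Frame c.writes σ τ → I (a.eval σ) τ → Q τ) : swp O U B (.loop a c) Q σ := by
  refine ⟨hB, ?_⟩
  have key : ∀ k i τ, i + k = a.eval σ → Frame c.writes σ τ → I i τ →
      (swp O U B c)^[k] Q τ := by
    intro k
    induction k with
    | zero => intro i τ hi hF hI; exact post τ hF (by rwa [← hi])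
    | succ k ih =>
      intro i τ hi hF hI
      rw [Function.iterate_succ_apply']
      exact swp_mono (swp_frame (Writes.Sub.refl _) hF (step i τ (by omega) hF hI))
        fun ρ hρ => ih (i + 1) ρ (by omega) hρ.1 hρ.2
  exact key _ 0 σ (by simp) (Frame.refl _ _) h0

lemma swp_forL {x l : ℕ} {c : Prog} (I : List V → State V → Prop) (h0 : I [] σ)
    (step : ∀ pre s suf τ, σ.lst l = pre ++ s :: suf → Frame (Prog.forL x l c).writes σ τ →
      I pre τ → swp O U B c (I (pre ++ [s])) (τ.setMdl x s))
    (post : ∀ τ, Frame (Prog.forL x l c).writes σ τ → I (σ.lst l) τ → Q τ) :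
    swp O U B (.forL x l c) Q σ := by
  have hx : (Prog.forL x l c).writes.mdl x = true := by simp [Prog.writes, Writes.union]
  have key : ∀ (L pre : List V) (τ : State V), σ.lst l = pre ++ L →
      Frame (Prog.forL x l c).writes σ τ → I pre τ →
      L.foldr (fun s R τ => swp O U B c R (τ.setMdl x s)) Q τ := by
    intro L
    induction L with
    | nil => intro pre τ hL hF hI; exact post τ hF (by rwa [hL, List.append_nil])
    | cons s L ih =>
      intro pre τ hL hF hI
      exact swp_mono (swp_frame (Writes.sub_union_right _ _) (hF.setMdl hx s)
        (step pre s L τ hL hF hI)) fun ρ hρ => ih (pre ++ [s]) ρ (by simp [hL]) hρ.1 hρ.2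
  exact key _ [] σ rfl (Frame.refl _ _) h0

lemma swp_forQ {x y q : ℕ} {c : Prog} (I : List (Response V) → State V → Prop) (h0 : I [] σ)
    (step : ∀ pre r suf τ, σ.resp q = pre ++ r :: suf → Frame (Prog.forQ x y q c).writes σ τ →
      I pre τ → swp O U B c (I (pre ++ [r])) ((τ.setMdl x r.1).setMdl y r.2))
    (post : ∀ τ, Frame (Prog.forQ x y q c).writes σ τ → I (σ.resp q) τ → Q τ) :
    swp O U B (.forQ x y q c) Q σ := by
  have hx : (Prog.forQ x y q c).writes.mdl x = true := by simp [Prog.writes, Writes.union]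
  have hy : (Prog.forQ x y q c).writes.mdl y = true := by simp [Prog.writes, Writes.union]
  have key : ∀ (L pre : List (Response V)) (τ : State V), σ.resp q = pre ++ L →
      Frame (Prog.forQ x y q c).writes σ τ → I pre τ →
      L.foldr (fun r R τ => swp O U B c R ((τ.setMdl x r.1).setMdl y r.2)) Q τ := by
    intro L
    induction L with
    | nil => intro pre τ hL hF hI; exact post τ hF (by rwa [hL, List.append_nil])
    | cons r L ih =>
      intro pre τ hL hF hI
      exact swp_mono (swp_frame (Writes.sub_union_right _ _) ((hF.setMdl hx r.1).setMdl hy r.2)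
        (step pre r L τ hL hF hI)) fun ρ hρ => ih (pre ++ [r]) ρ (by simp [hL]) hρ.1 hρ.2
  exact key _ [] σ rfl (Frame.refl _ _) h0

end Rules

end

end InteractiveLearning

namespace InteractiveLearning

noncomputable section

/-! ## Distances and potentials -/

namespace FeedbackGraph

variable {V : Type} (D : FeedbackGraph V)

lemma walkLen_append {s t u : V} (w : D.G.Walk s t) (w' : D.G.Walk t u) :
    D.walkLen (w.append w') = D.walkLen w + D.walkLen w' := by
  induction w with
  | nil => simp [walkLen]
  | cons h w ih => simp [walkLen, ih, add_assoc]

lemma walkLen_reverse {s t : V} (w : D.G.Walk s t) : D.walkLen w.reverse = D.walkLen w := by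
  induction w with
  | nil => simp [walkLen]
  | cons h w ih =>
    simp [walkLen, walkLen_append, ih, D.len_symm, add_comm]

/-- The length of a shortest path. -/
def dist (s t : V) : ℕ := sInf (Set.range fun w : D.G.Walk s t => D.walkLen w)

variable {D}

lemma dist_le {s t : V} (w : D.G.Walk s t) : D.dist s t ≤ D.walkLen w := Nat.sInf_le ⟨w, rfl⟩

lemma exists_walkLen_eq_dist (hc : D.G.Preconnected) (s t : V) :
    ∃ w : D.G.Walk s t, D.walkLen w = D.dist s t := by
  obtain ⟨w⟩ := hc s t
  exact Nat.sInf_mem (s := Set.range fun w : D.G.Walk s t => D.walkLen w) ⟨_, w, rfl⟩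

lemma dist_triangle (hc : D.G.Preconnected) (s t u : V) :
    D.dist s u ≤ D.dist s t + D.dist t u := by
  obtain ⟨w, hw⟩ := exists_walkLen_eq_dist hc s t
  obtain ⟨w', hw'⟩ := exists_walkLen_eq_dist hc t u
  rw [← hw, ← hw', ← walkLen_append]
  exact dist_le _

lemma dist_comm (hc : D.G.Preconnected) (s t : V) : D.dist s t = D.dist t s := by
  have key : ∀ s t, D.dist s t ≤ D.dist t s := fun s t => by
    obtain ⟨w, hw⟩ := exists_walkLen_eq_dist hc t s
    rw [← hw, ← walkLen_reverse]
    exact dist_le _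
  exact (key s t).antisymm (key t s)

lemma dist_pos (hc : D.G.Preconnected) {s t : V} (h : s ≠ t) : 1 ≤ D.dist s t := by
  obtain ⟨w, hw⟩ := exists_walkLen_eq_dist hc s t
  rw [← hw]
  cases w with
  | nil => exact absurd rfl h
  | cons h w => simp only [walkLen]; have := D.len_pos _ _ h; omega

/-- A shortest walk through s' is cut there; each part is at least as long as the corresponding
distance, and the triangle inequality gives the converse. -/
lemma OnShortestPath.dist_eq {s s' t : V} (hc : D.G.Preconnected) (h : D.OnShortestPath s s' t) :
    D.dist s t = D.dist s s' + D.dist s' t := by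
  classical
  obtain ⟨w, hmin, hs'⟩ := h
  refine (dist_triangle hc s s' t).antisymm ?_
  obtain ⟨w', hw'⟩ := exists_walkLen_eq_dist hc s t
  have h1 := hmin w'
  have h2 : D.walkLen w = D.walkLen (w.takeUntil s' hs') + D.walkLen (w.dropUntil s' hs') := by
    rw [← walkLen_append, SimpleGraph.Walk.take_spec]
  have h3 := dist_le (w.takeUntil s' hs')
  have h4 := dist_le (w.dropUntil s' hs')
  omega

lemma mem_reach_self {s t : V} : t ∈ D.reach s s ↔ t = s := by
  simp [reach]

lemma Bounded.preconnected [Fintype V] {P : Polynomial ℕ} {n : ℕ} (h : D.Bounded P n) :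
    D.G.Preconnected := fun s t => ⟨(h.2.2 s t).choose⟩

variable [Fintype V]

open Classical in
/-- The total weight of the models that are consistent with a response. -/
def mass (D : FeedbackGraph V) (w : V → ℝ) (s s' : V) : ℝ := ∑ t with t ∈ D.reach s s', w t

/-- The weighted sum of the distances from a model. -/
def distSum (D : FeedbackGraph V) (w : V → ℝ) (s : V) : ℝ := ∑ t, w t * D.dist s t

/-- The assumption 0 ≤ β takes care of a model without neighbours, where the supremum is 0. -/
lemma potential_le {w : V → ℝ} {s : V} {β : ℝ} (hw : 0 < ∑ t, w t) (hβ : 0 ≤ β)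
    (h : ∀ s', D.G.Adj s s' → D.mass w s s' ≤ β * ∑ t, w t) : D.potential w s ≤ β := by
  rw [potential, inv_mul_le_iff₀ hw]
  refine Real.iSup_le (fun s' => ?_) (by positivity)
  have := h s' s'.2
  rw [mul_comm]
  exact this

lemma mass_le_of_potential_le {w : V → ℝ} {s s' : V} {β : ℝ} (hw : 0 < ∑ t, w t)
    (h : D.potential w s ≤ β) (hs : D.G.Adj s s') : D.mass w s s' ≤ β * ∑ t, w t := by
  rw [potential, inv_mul_le_iff₀ hw] at h
  rw [mul_comm]
  refine le_trans ?_ h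
  exact le_ciSup (f := fun s' : {s' : V // D.G.Adj s s'} => D.mass w s s')
    (Set.finite_range _).bddAbove ⟨s', hs⟩

/-- Moving along an edge that a large fraction of the weight is consistent with. -/
lemma distSum_move (hc : D.G.Preconnected) {w : V → ℝ} (hw : ∀ t, 0 ≤ w t) {s s' : V}
    (hs : D.G.Adj s s') {x : ℝ} (hx : 0 ≤ x)
    (h : (x + 1) * ∑ t, w t ≤ 2 * x * D.mass w s s') :
    x * D.distSum w s' + ∑ t, w t ≤ x * D.distSum w s := by
  classical
  -- A model in R(s,s') gets closer by exactly d(s,s'), any other one gets farther by at most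
  -- d(s,s').
  have h1 : D.distSum w s' ≤ D.distSum w s + D.dist s s' * (∑ t, w t - 2 * D.mass w s s') := by
    simp only [distSum, mass, Finset.sum_filter, Finset.mul_sum, ← Finset.sum_sub_distrib,
      ← Finset.sum_add_distrib]
    refine Finset.sum_le_sum fun t _ => ?_
    split_ifs with ht
    · have h2 : D.dist s t = D.dist s s' + D.dist s' t := by
        rcases ht with ⟨h, -⟩ | ⟨-, h⟩
        · exact absurd h hs.ne'
        · exact h.dist_eq hc
      rw [h2]; push_cast; nlinarith [hw t]
    · have h2 : (D.dist s' t : ℝ) ≤ D.dist s s' + D.dist s t := by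
        rw [dist_comm hc s s']; exact_mod_cast dist_triangle hc s' s t
      nlinarith [hw t]
  have h2 : (1 : ℝ) ≤ D.dist s s' := by exact_mod_cast dist_pos hc hs.ne
  have h3 : 0 ≤ ∑ t, w t := Finset.sum_nonneg fun t _ => hw t
  have h4 : x * D.distSum w s' ≤
      x * (D.distSum w s + D.dist s s' * (∑ t, w t - 2 * D.mass w s s')) :=
    mul_le_mul_of_nonneg_left h1 hx
  -- By hypothesis x (W - 2m) ≤ -W for the total weight W and the mass m; since d(s,s') ≥ 1, the
  -- scaled distance sum falls by at least W.
  have h5 : (D.dist s s' : ℝ) * (x * ∑ t, w t - 2 * x * D.mass w s s') ≤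
      D.dist s s' * (- ∑ t, w t) := mul_le_mul_of_nonneg_left (by linarith) (by linarith)
  nlinarith

lemma distSum_nonneg {w : V → ℝ} (hw : ∀ t, 0 ≤ w t) (s : V) : 0 ≤ D.distSum w s :=
  Finset.sum_nonneg fun t _ => mul_nonneg (hw t) (Nat.cast_nonneg _)

lemma Bounded.distSum_le {P : Polynomial ℕ} {n : ℕ} (h : D.Bounded P n) {w : V → ℝ}
    (hw : ∀ t, 0 ≤ w t) (s : V) : D.distSum w s ≤ P.eval n * ∑ t, w t := by
  rw [distSum, Finset.mul_sum]
  refine Finset.sum_le_sum fun t _ => ?_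
  obtain ⟨v, hv⟩ := h.2.2 s t
  rw [mul_comm]
  exact mul_le_mul_of_nonneg_right (by exact_mod_cast (dist_le v).trans hv) (hw t)

lemma Bounded.card_le {P : Polynomial ℕ} {n : ℕ} (h : D.Bounded P n) :
    Fintype.card V ≤ 2 ^ (P.eval n) := by
  rcases (Fintype.card V).eq_zero_or_pos with h0 | h0
  · simp [h0]
  have h1 := h.1
  rw [Real.logb_le_iff_le_rpow (by norm_num) (by exact_mod_cast h0), Real.rpow_natCast] at h1
  exact_mod_cast h1

omit [Fintype V] in
lemma weight_nonneg {p : ℝ} (hp : 0 ≤ p) (hp1 : p ≤ 1) (S₀ : Finset V) (Q : List (Response V))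
    (s : V) : 0 ≤ D.weight p S₀ Q s := by
  classical
  rw [weight]
  split_ifs
  · refine List.prod_nonneg fun x hx => ?_
    obtain ⟨r, -, rfl⟩ := List.mem_map.1 hx
    split_ifs <;> linarith
  · exact le_rfl

end FeedbackGraph

lemma PMF_sum_toReal {V : Type} [Fintype V] (μ : PMF V) : ∑ s, (μ s).toReal = 1 := by
  have := μ.tsum_coe
  rw [tsum_fintype] at this
  rw [← ENNReal.toReal_sum (fun s _ => μ.apply_ne_top s), this, ENNReal.toReal_one]

/-- The signed differences of two probability vectors sum to 0, so their sums over A and over its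
complement have the same absolute value. Together these two are at most the ℓ¹ distance, which is
twice the total variation distance. -/
lemma tvDist_bound {V : Type} [Fintype V] {w : V → ℝ} {μ : PMF V} {Δ : ℝ}
    (hw : 0 < ∑ t, w t) (h : tvDist w μ ≤ Δ) (A : Finset V) :
    |(∑ t ∈ A, w t) / (∑ t, w t) - ∑ t ∈ A, (μ t).toReal| ≤ Δ := by
  classical
  refine le_trans ?_ h
  set f : V → ℝ := fun s => w s / (∑ t, w t) - (μ s).toReal with hf
  have h0 : ∑ s, f s = 0 := by
    rw [hf, Finset.sum_sub_distrib, ← Finset.sum_div, div_self hw.ne', PMF_sum_toReal, sub_self]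
  have h1 : (∑ t ∈ A, w t) / (∑ t, w t) - ∑ t ∈ A, (μ t).toReal = ∑ s ∈ A, f s := by
    rw [hf, Finset.sum_sub_distrib, ← Finset.sum_div]
  have h2 : ∑ s ∈ A, f s + ∑ s ∈ Aᶜ, f s = 0 := by rw [Finset.sum_add_sum_compl, h0]
  have h3 : ∑ s ∈ A, |f s| + ∑ s ∈ Aᶜ, |f s| = ∑ s, |f s| := Finset.sum_add_sum_compl _ _
  have h4 := Finset.abs_sum_le_sum_abs f A
  have h5 := Finset.abs_sum_le_sum_abs f Aᶜ
  have h6 : |∑ s ∈ Aᶜ, f s| = |∑ s ∈ A, f s| := by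
    rw [← abs_neg, neg_eq_of_add_eq_zero_left h2]
  rw [h1, tvDist]
  change |∑ s ∈ A, f s| ≤ 1 / 2 * ∑ s, |f s|
  linarith

/-! ## Concentration of empirical frequencies -/

-- For |x| ≤ 1 one has exp x ≤ 1 + x + x². The linear term has mean 0 because the indicator is
-- centred, and the square of the centred indicator is at most 1, which leaves 1 + l² ≤ exp(l²).
open Classical in
lemma exp_moment_le {V : Type} [Fintype V] (μ : PMF V) (A : Finset V) {l : ℝ} (hl : |l| ≤ 1) :
    ∑ s, (μ s).toReal * Real.exp (l * ((if s ∈ A then 1 else 0) - ∑ t ∈ A, (μ t).toReal)) ≤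
      Real.exp (l ^ 2) := by
  set q := ∑ t ∈ A, (μ t).toReal with hq
  have hs := PMF_sum_toReal μ
  have hq0 : 0 ≤ q := Finset.sum_nonneg fun _ _ => ENNReal.toReal_nonneg
  have hq1 : q ≤ 1 := by
    rw [← hs]
    exact Finset.sum_le_sum_of_subset_of_nonneg (Finset.subset_univ _)
      fun _ _ _ => ENNReal.toReal_nonneg
  have hq' : ∑ s, (μ s).toReal * (if s ∈ A then 1 else 0 : ℝ) = q := by
    simp [hq, Finset.sum_ite_mem]
  calc _ ≤ ∑ s, (μ s).toReal * (1 + l * ((if s ∈ A then 1 else 0) - q) + l ^ 2) := by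
        refine Finset.sum_le_sum fun s _ => mul_le_mul_of_nonneg_left ?_ ENNReal.toReal_nonneg
        set y : ℝ := (if s ∈ A then 1 else 0) - q with hy
        have hy1 : |y| ≤ 1 := by
          rw [abs_le]; constructor <;> rw [hy] <;> split_ifs <;> linarith
        have hx : |l * y| ≤ 1 := by rw [abs_mul]; nlinarith [abs_nonneg l, abs_nonneg y]
        have h1 := (abs_le.1 (Real.abs_exp_sub_one_sub_id_le hx)).2
        have h2 : y ^ 2 ≤ 1 := by rw [← sq_abs]; nlinarith [abs_nonneg y]
        nlinarith [sq_nonneg l]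
    _ = 1 + l ^ 2 := by
        have : ∀ s, (μ s).toReal * (1 + l * ((if s ∈ A then 1 else 0) - q) + l ^ 2) =
            (1 - l * q + l ^ 2) * (μ s).toReal +
              l * ((μ s).toReal * (if s ∈ A then 1 else 0 : ℝ)) := fun s => by ring
        simp only [this, Finset.sum_add_distrib, ← Finset.mul_sum, hs, hq']
        ring
    _ ≤ Real.exp (l ^ 2) := by linarith [Real.add_one_le_exp (l ^ 2)]

/-! ### Expectations, Markov's inequality and union bounds. -/

/-- The expectation of a nonnegative function. -/
def expect {α : Type*} (p : PMF α) (f : α → ℝ≥0∞) : ℝ≥0∞ := ∑' a, p a * f a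

lemma expect_bind {α β : Type*} (p : PMF α) (g : α → PMF β) (f : β → ℝ≥0∞) :
    expect (p.bind g) f = ∑' a, p a * expect (g a) f := by
  simp only [expect, PMF.bind_apply, ← ENNReal.tsum_mul_right, ← ENNReal.tsum_mul_left]
  rw [ENNReal.tsum_comm]
  simp only [mul_assoc]

/-- With f' equal to f this is the induction step for exponential moments: each further sample costs
a factor c. -/
lemma expect_bind_le {α β : Type*} {p : PMF α} {g : α → PMF β} {f : β → ℝ≥0∞} {f' : α → ℝ≥0∞}
    {c : ℝ≥0∞} (h : ∀ a ∈ p.support, expect (g a) f ≤ c * f' a) :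
    expect (p.bind g) f ≤ c * expect p f' := by
  rw [expect_bind, expect, ← ENNReal.tsum_mul_left]
  refine ENNReal.tsum_le_tsum fun a => ?_
  by_cases ha : a ∈ p.support
  · calc p a * expect (g a) f ≤ p a * (c * f' a) := by gcongr; exact h a ha
      _ = c * (p a * f' a) := by ring
  · simp [(PMF.apply_eq_zero_iff p a).2 ha]

lemma expect_pure {α : Type*} (a : α) (f : α → ℝ≥0∞) : expect (PMF.pure a) f = f a := by
  classical
  rw [expect, tsum_eq_single a]
  · simp
  · intro b hb; simp [hb]

/-- Markov's inequality, with f dominating the indicator of A. The domination is required only on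
the support, where invariants of the program are available. -/
lemma toOuterMeasure_le_expect {α : Type*} (p : PMF α) (f : α → ℝ≥0∞) (A : Set α)
    (h : ∀ a ∈ p.support, a ∈ A → 1 ≤ f a) : p.toOuterMeasure A ≤ expect p f := by
  rw [PMF.toOuterMeasure_apply, expect]
  refine ENNReal.tsum_le_tsum fun a => ?_
  by_cases ha : a ∈ A
  · rw [Set.indicator_of_mem ha]
    by_cases hp : a ∈ p.support
    · calc p a = p a * 1 := (mul_one _).symm
        _ ≤ _ := by gcongr; exact h a hp ha
    · simp [(PMF.apply_eq_zero_iff p a).2 hp]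
  · simp [ha]

lemma toOuterMeasure_le_one {α : Type*} (p : PMF α) (A : Set α) : p.toOuterMeasure A ≤ 1 := by
  refine (toOuterMeasure_le_expect p (fun _ => 1) A fun _ _ _ => le_rfl).trans ?_
  simp [expect, p.tsum_coe]

/-- If a first stage fails with probability at most `e` and, unless it failed, the second one with
probability at most `e'`, then failure has probability at most `e + e'`. -/
lemma toOuterMeasure_bind_le {α β : Type*} {p : PMF α} {g : α → PMF β} {A : Set α} {A' : Set β}
    {e e' : ℝ≥0∞} (h : p.toOuterMeasure A ≤ e)
    (h' : ∀ a ∈ p.support, a ∉ A → (g a).toOuterMeasure A' ≤ e') :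
    (p.bind g).toOuterMeasure A' ≤ e + e' := by
  rw [PMF.toOuterMeasure_bind_apply]
  calc ∑' a, p a * (g a).toOuterMeasure A'
      ≤ ∑' a, (A.indicator p a + p a * e') := by
        refine ENNReal.tsum_le_tsum fun a => ?_
        by_cases hp : a ∈ p.support
        · by_cases ha : a ∈ A
          · rw [Set.indicator_of_mem ha]
            calc p a * (g a).toOuterMeasure A' ≤ p a * 1 := by
                  gcongr; exact toOuterMeasure_le_one _ _
              _ ≤ _ := by rw [mul_one]; exact le_self_add
          · rw [Set.indicator_of_notMem ha, zero_add]
            gcongr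
            exact h' a hp ha
        · simp [(PMF.apply_eq_zero_iff p a).2 hp]
    _ = p.toOuterMeasure A + e' := by
        rw [ENNReal.tsum_add, ENNReal.tsum_mul_right, p.tsum_coe, one_mul,
          PMF.toOuterMeasure_apply]
    _ ≤ e + e' := by gcongr

lemma toOuterMeasure_iUnion_fintype_le {α ι : Type*} [Fintype ι] (p : PMF α) (A : ι → Set α)
    (e : ℝ≥0∞) (h : ∀ i, p.toOuterMeasure (A i) ≤ e) :
    p.toOuterMeasure (⋃ i, A i) ≤ Fintype.card ι * e := by
  refine (MeasureTheory.measure_iUnion_fintype_le _ _).trans ?_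
  refine (Finset.sum_le_sum fun i _ => h i).trans ?_
  simp

end

end InteractiveLearning

namespace InteractiveLearning

noncomputable section

/-! ## Polynomial expressions -/

lemma polynomial_eval_mono (P : Polynomial ℕ) {a b : ℕ} (h : a ≤ b) : P.eval a ≤ P.eval b := by
  rw [Polynomial.eval_eq_sum_range, Polynomial.eval_eq_sum_range]
  gcongr

/-- The expression is chosen before the type of models and the state, so programs that use it depend
on the polynomial alone. -/
lemma NExp.exists_poly (P : Polynomial ℕ) (a : NExp) :
    ∃ e : NExp, ∀ (V : Type) (σ : State V), e.eval σ = P.eval (a.eval σ) := by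
  induction P using Polynomial.induction_on' with
  | add P Q hP hQ =>
    obtain ⟨e, he⟩ := hP
    obtain ⟨f, hf⟩ := hQ
    exact ⟨.add e f, fun V σ => by simp [eval, he, hf]⟩
  | monomial k c =>
    induction k with
    | zero => exact ⟨.const c, fun V σ => by simp [eval]⟩
    | succ k ih =>
      obtain ⟨e, he⟩ := ih
      exact ⟨.mul e a, fun V σ => by simp [eval, he, Polynomial.eval_monomial]; ring⟩

/-- An expression for the value of a polynomial at the value of number register `10`. -/
def NExp.poly (P : Polynomial ℕ) : NExp := (NExp.exists_poly P (.var 10)).choose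

@[simp] lemma NExp.eval_poly {V : Type} (P : Polynomial ℕ) (σ : State V) :
    (NExp.poly P).eval σ = P.eval (σ.nat 10) :=
  (NExp.exists_poly P (.var 10)).choose_spec V σ

/-! ## Drawing a list of samples -/

/-- List `0` receives independent samples for response list `0`. -/
def drawProg (L : Polynomial ℕ) : Prog :=
  .seq (.clearL 0) (.loop (.poly L) (.seq (.sample 3 0) (.pushL 0 3)))

open Classical in
/-- Up to an error of `1 / E`, the frequencies in the list agree with the probabilities, for all
sets of models that are consistent with a response. -/
def Accurate {V : Type} [Fintype V] (D : FeedbackGraph V) (μ : PMF V) (E : ℕ) (ls : List V) :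
    Prop :=
  ∀ s s', |(ls.countP (· ∈ D.reach s s') : ℝ) -
    (∑ t with t ∈ D.reach s s', (μ t).toReal) * ls.length| * E ≤ ls.length

/-- A sufficient number of samples. -/
def sampleSize (P E A : Polynomial ℕ) : Polynomial ℕ := 4 * E ^ 2 * (A + 2 * P + 1)

variable {V : Type} {O : Oracles V} {U : User V} {B : ℕ}

lemma swp_drawProg {L : Polynomial ℕ} {σ : State V}
    (hL : L.eval (σ.nat 10) ≤ B) (ht : O.sampleTime (σ.resp 0) ≤ B) :
    swp O U B (drawProg L) (fun τ => (τ.lst 0).length = L.eval (σ.nat 10)) σ := by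
  change swp O U B (.loop _ _) _ (σ.setLst 0 [])
  refine swp_loop (fun i τ => (τ.lst 0).length = i) (by simpa [State.setLst] using hL)
    (by simp [State.setLst]) ?_ ?_
  · intro i τ hi hF hI
    rw [NExp.eval_poly] at hi
    have h0 : τ.resp 0 = σ.resp 0 := hF.resp 0 rfl
    simp only [swp, h0]
    refine ⟨ht, fun s hs => ⟨?_, ?_⟩⟩
    · simp only [State.setMdl, hI]
      have : L.eval ((σ.setLst 0 []).nat 10) ≤ B := hL
      omega
    · simp [State.setLst, State.setMdl, hI]
  · intro τ hF h
    simpa [State.setLst] using h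

variable [Fintype V]

open Classical in
/-- Exponential of the scaled deviation of a frequency. -/
def expDev (μ : PMF V) (A : Finset V) (l : ℝ) (σ : State V) : ℝ≥0∞ :=
  ENNReal.ofReal (Real.exp (l * ((σ.lst 0).countP (· ∈ A) -
    (∑ t ∈ A, (μ t).toReal) * (σ.lst 0).length)))

/-- The exponent is additive along the list, so a new sample s contributes an independent factor
exp(l (1_A(s) - μ(A))), whose mean is bounded by `exp_moment_le`. -/
lemma expect_expDev_step (A : Finset V) {l : ℝ} (hl : |l| ≤ 1) (σ : State V) :
    expect ((Prog.seq (.sample 3 0) (.pushL 0 3)).run O U (σ.tick 1))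
      (expDev (O.sample (σ.resp 0)) A l) ≤
      ENNReal.ofReal (Real.exp (l ^ 2)) * expDev (O.sample (σ.resp 0)) A l σ := by
  classical
  set μ := O.sample (σ.resp 0) with hμ
  simp only [Prog.run, PMF.bind_map, expect_bind, Function.comp_apply, expect_pure]
  have hr : (σ.tick 1).resp 0 = σ.resp 0 := rfl
  rw [tsum_fintype, hr, ← hμ]
  set q := ∑ t ∈ A, (μ t).toReal with hq
  -- The argument on the left is the state after the sample s was drawn and appended, with its clock
  -- spelled out; only list 0 matters for the deviation.
  have : ∀ s, expDev μ A l
      ((((((σ.tick 1).setMdl 3 s).tick (1 + Nat.clog 2 (Fintype.card V) +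
        O.sampleTime (σ.resp 0))).setLst 0
        (((((σ.tick 1).setMdl 3 s).tick (1 + Nat.clog 2 (Fintype.card V) +
        O.sampleTime (σ.resp 0))).lst 0) ++ [((((σ.tick 1).setMdl 3 s).tick
          (1 + Nat.clog 2 (Fintype.card V) + O.sampleTime (σ.resp 0))).mdl 3)])).tick
          (1 + Nat.clog 2 (Fintype.card V)))) =
      ENNReal.ofReal (Real.exp (l * ((if s ∈ A then 1 else 0) - q))) * expDev μ A l σ := by
    intro s
    rw [expDev, expDev, ← ENNReal.ofReal_mul (Real.exp_pos _).le, ← Real.exp_add]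
    congr 2
    simp only [State.setLst, State.setMdl, State.tick, Function.update_self,
      List.countP_append, List.length_append, List.length_singleton, List.countP_singleton,
      decide_eq_true_eq]
    push_cast
    rw [← hq]
    ring
  simp only [this, ← mul_assoc, ← Finset.sum_mul]
  gcongr
  have h2 : ∀ s, μ s * ENNReal.ofReal (Real.exp (l * ((if s ∈ A then 1 else 0) - q))) =
      ENNReal.ofReal ((μ s).toReal * Real.exp (l * ((if s ∈ A then 1 else 0) - q))) := by
    intro s
    rw [ENNReal.ofReal_mul ENNReal.toReal_nonneg, ENNReal.ofReal_toReal (μ.apply_ne_top s)]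
  simp only [h2]
  rw [← ENNReal.ofReal_sum_of_nonneg fun s _ =>
    mul_nonneg ENNReal.toReal_nonneg (Real.exp_pos _).le]
  exact ENNReal.ofReal_le_ofReal (exp_moment_le μ A hl)

/-- Both claims are proved in one induction: the moment step needs that response list 0 is still Q
on the support, so that each sample has the same law. -/
lemma expect_expDev_iterate (Q : List (Response V)) (σ : State V) (hQ : σ.resp 0 = Q)
    (hσ : σ.lst 0 = []) (k : ℕ) :
    (∀ τ ∈ ((fun μ : PMF (State V) => μ.bind fun τ =>
        (Prog.seq (.sample 3 0) (.pushL 0 3)).run O U (τ.tick 1))^[k] (PMF.pure σ)).support,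
      τ.resp 0 = Q ∧ (τ.lst 0).length = k) ∧
    ∀ (A : Finset V) (l : ℝ), |l| ≤ 1 →
      expect ((fun μ : PMF (State V) => μ.bind fun τ =>
        (Prog.seq (.sample 3 0) (.pushL 0 3)).run O U (τ.tick 1))^[k] (PMF.pure σ))
        (expDev (O.sample Q) A l) ≤ ENNReal.ofReal (Real.exp (l ^ 2)) ^ k := by
  induction k with
  | zero =>
    refine ⟨fun τ hτ => ?_, fun A l hl => ?_⟩
    · simp only [Function.iterate_zero, id_eq, PMF.support_pure, Set.mem_singleton_iff] at hτ
      subst hτ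
      simp [hQ, hσ]
    · simp [expect_pure, expDev, hσ]
  | succ k ih =>
    rw [Function.iterate_succ_apply']
    refine ⟨fun τ hτ => ?_, fun A l hl => ?_⟩
    · rw [PMF.mem_support_bind_iff] at hτ
      obtain ⟨ρ, hρ, hτ⟩ := hτ
      obtain ⟨h1, h2⟩ := ih.1 ρ hρ
      simp only [Prog.run, PMF.bind_map, PMF.mem_support_bind_iff, Function.comp_apply,
        PMF.support_pure, Set.mem_singleton_iff] at hτ
      obtain ⟨s, -, rfl⟩ := hτ
      simp [State.setLst, State.setMdl, State.tick, h1, h2]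
    · refine (expect_bind_le (f' := expDev (O.sample Q) A l)
        (c := ENNReal.ofReal (Real.exp (l ^ 2))) fun τ hτ => ?_).trans ?_
      · have h1 := (ih.1 τ hτ).1
        rw [← h1]
        exact expect_expDev_step A hl τ
      · rw [pow_succ' _ k]
        exact mul_le_mul_right (ih.2 A l hl) _

/-- The final arithmetic of the union bound: there is one event for each pair of models and each
sign, hence at most 2^(2b+1) of them, and exp(-1) ≤ 1/2. -/
lemma two_mul_card_sq_mul_le {N a b : ℕ} (h : N ≤ 2 ^ b) :
    ((N * (N * 2) : ℕ) : ℝ≥0∞) * ENNReal.ofReal (Real.exp (-((a + 2 * b + 1 : ℕ) : ℝ))) ≤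
      (1 / 2) ^ a := by
  have h1 : ENNReal.ofReal (Real.exp (-((a + 2 * b + 1 : ℕ) : ℝ))) ≤ (1 / 2) ^ (a + 2 * b + 1) := by
    have h2 : Real.exp (-((a + 2 * b + 1 : ℕ) : ℝ)) = Real.exp (-1) ^ (a + 2 * b + 1) := by
      rw [← Real.exp_nat_mul]; congr 1; ring
    have h3 : Real.exp (-1) ≤ 1 / 2 := by
      rw [Real.exp_neg, one_div]
      exact inv_anti₀ (by norm_num) (by linarith [Real.add_one_le_exp 1])
    rw [h2, ENNReal.ofReal_pow (Real.exp_pos _).le]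
    refine pow_le_pow_left' ((ENNReal.ofReal_le_ofReal h3).trans ?_) _
    rw [ENNReal.ofReal_div_of_pos (by norm_num)]
    simp
  have h4 : ((N * (N * 2) : ℕ) : ℝ≥0∞) ≤ 2 ^ (2 * b + 1) := by
    have : N * (N * 2) ≤ 2 ^ (2 * b + 1) := by
      calc N * (N * 2) ≤ 2 ^ b * (2 ^ b * 2) := by gcongr
        _ = 2 ^ (2 * b + 1) := by ring
    exact_mod_cast this
  calc _ ≤ (2 : ℝ≥0∞) ^ (2 * b + 1) * (1 / 2) ^ (a + 2 * b + 1) := by gcongr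
    _ = (2 * (1 / 2)) ^ (2 * b + 1) * (1 / 2) ^ a := by
        rw [mul_pow, add_assoc, pow_add (1 / 2 : ℝ≥0∞) a]; ring
    _ = (1 / 2) ^ a := by
        rw [one_div, ENNReal.mul_inv_cancel (by norm_num) (by norm_num), one_pow, one_mul]

/-- The samples are accurate with high probability. -/
lemma drawProg_accurate (D : FeedbackGraph V) {P E A : Polynomial ℕ} {n : ℕ}
    (hD : D.Bounded P n) (σ : State V) (hn : n ≤ σ.nat 10) (hE : 1 ≤ E.eval (σ.nat 10)) :
    ((drawProg (sampleSize P E A)).run O U σ).toOuterMeasure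
      {τ | ¬ Accurate D (O.sample (σ.resp 0)) (E.eval (σ.nat 10)) (τ.lst 0)} ≤
      (1 / 2) ^ (A.eval (σ.nat 10)) := by
  classical
  set e := E.eval (σ.nat 10) with he
  -- Each event will have probability at most exp(-j). The summand 2P + 1 pays for the union over
  -- 2N² events, A for the required error. The sample size is 4e²j.
  set j := A.eval (σ.nat 10) + 2 * P.eval (σ.nat 10) + 1 with hj
  set L := (sampleSize P E A).eval (σ.nat 10) with hL
  have hLe : L = 4 * e ^ 2 * j := by simp [hL, hj, he, sampleSize]
  set μ := O.sample (σ.resp 0) with hμ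
  simp only [drawProg, Prog.run, PMF.pure_bind]
  have hev : (NExp.poly (sampleSize P E A)).eval ((σ.setLst 0 []).tick 1) = L := by
    rw [NExp.eval_poly]; rfl
  rw [hev]
  set σ' := (((σ.setLst 0 []).tick 1).tick
    (1 + (NExp.poly (sampleSize P E A)).cost ((σ.setLst 0 []).tick 1))) with hσ'
  obtain ⟨hsup, hexp⟩ := expect_expDev_iterate (O := O) (U := U) (σ.resp 0) σ' rfl
    (by simp [hσ', State.setLst, State.tick]) L
  simp only [Prog.run] at hsup hexp
  set ν := (fun μ : PMF (State V) => μ.bind fun τ =>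
    ((O.sample ((τ.tick 1).resp 0)).map fun s => ((τ.tick 1).setMdl 3 s).tick
      (1 + Nat.clog 2 (Fintype.card V) + O.sampleTime ((τ.tick 1).resp 0))).bind fun σ =>
        PMF.pure ((σ.setLst 0 (σ.lst 0 ++ [σ.mdl 3])).tick
          (1 + Nat.clog 2 (Fintype.card V))))^[L] (PMF.pure σ') with hν
  let R : V → V → Finset V := fun s s' => {t | t ∈ D.reach s s'}
  have he0 : (0 : ℝ) < e := by exact_mod_cast hE
  -- The factor 2el is the sign of l. A deviation of more than a fraction 1/e of the 4e²j samples
  -- makes l times the deviation exceed 2j, while the exponential moment is at most exp(4e²j l²) =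
  -- exp(j). Markov's inequality gives exp(j - 2j).
  have tail : ∀ (A' : Finset V) (l : ℝ), |l| = 1 / (2 * e) →
      ν.toOuterMeasure {τ | (τ.lst 0).length < e * (2 * e * l) *
        ((τ.lst 0).countP (· ∈ A') - (∑ t ∈ A', (μ t).toReal) * (τ.lst 0).length : ℝ)} ≤
      ENNReal.ofReal (Real.exp (-(j : ℝ))) := by
    intro A' l hl
    have hl1 : |l| ≤ 1 := by
      rw [hl, div_le_one (by positivity)]
      have : (1 : ℝ) ≤ e := by exact_mod_cast hE
      linarith
    have hl2 : l ^ 2 = 1 / (4 * e ^ 2) := by rw [← sq_abs, hl]; field_simp; norm_num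
    have h1 := hexp A' l hl1
    rw [← ENNReal.ofReal_pow (Real.exp_pos _).le, ← Real.exp_nat_mul, hl2, hLe] at h1
    have h2 : ((4 * e ^ 2 * j : ℕ) : ℝ) * (1 / (4 * (e : ℝ) ^ 2)) = j := by
      push_cast; field_simp
    rw [h2] at h1
    calc _ ≤ expect ν (fun τ => ENNReal.ofReal (Real.exp (-(2 * j : ℝ))) * expDev μ A' l τ) := by
          refine toOuterMeasure_le_expect _ _ _ fun τ hτ hA => ?_
          rw [expDev, ← ENNReal.ofReal_mul (Real.exp_pos _).le, ← Real.exp_add,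
            ENNReal.one_le_ofReal, Real.one_le_exp_iff]
          simp only [Set.mem_ofPred_eq] at hA
          set d := ((τ.lst 0).countP (· ∈ A') -
            (∑ t ∈ A', (μ t).toReal) * (τ.lst 0).length : ℝ)
          have h3 : ((τ.lst 0).length : ℝ) = 4 * e ^ 2 * j := by
            rw [(hsup τ hτ).2, hLe]; push_cast; ring
          rw [h3] at hA
          have h4 : 2 * (e : ℝ) ^ 2 * (2 * j) < 2 * e ^ 2 * (l * d) := by linarith
          have h5 := lt_of_mul_lt_mul_left h4 (by positivity)
          linarith
      _ = ENNReal.ofReal (Real.exp (-(2 * j : ℝ))) * expect ν (expDev μ A' l) := by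
          rw [expect, expect, ← ENNReal.tsum_mul_left]
          exact tsum_congr fun τ => by ring
      _ ≤ ENNReal.ofReal (Real.exp (-(2 * j : ℝ))) * ENNReal.ofReal (Real.exp j) := by
          gcongr
      _ = ENNReal.ofReal (Real.exp (-(j : ℝ))) := by
          rw [← ENNReal.ofReal_mul (Real.exp_pos _).le, ← Real.exp_add]; congr 2; ring
  -- The Boolean chooses between too high and too low a frequency.
  let bad : V × V × Bool → Set (State V) := fun i => {τ | (τ.lst 0).length <
    e * (2 * e * (if i.2.2 then 1 / (2 * e) else -(1 / (2 * e)) : ℝ)) *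
      ((τ.lst 0).countP (· ∈ R i.1 i.2.1) -
        (∑ t ∈ R i.1 i.2.1, (μ t).toReal) * (τ.lst 0).length : ℝ)}
  have hsub : {τ : State V | ¬ Accurate D μ e (τ.lst 0)} ⊆ ⋃ i, bad i := by
    intro τ hτ
    simp only [Set.mem_ofPred_eq, Accurate, not_forall, not_le] at hτ
    obtain ⟨s, s', h⟩ := hτ
    rw [Set.mem_iUnion]
    have hR : ∀ t, t ∈ R s s' ↔ t ∈ D.reach s s' := fun t => by simp [R]
    rcases le_total 0 ((((τ.lst 0).countP (· ∈ D.reach s s') : ℕ) : ℝ) -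
      (∑ t with t ∈ D.reach s s', (μ t).toReal) * (τ.lst 0).length) with h0 | h0
    · refine ⟨(s, s', true), ?_⟩
      rw [abs_of_nonneg h0] at h
      simp only [bad, Set.mem_ofPred_eq, if_true, hR]
      have : (e : ℝ) * (2 * e * (1 / (2 * e))) = e := by field_simp
      rw [this, mul_comm]
      exact h
    · refine ⟨(s, s', false), ?_⟩
      rw [abs_of_nonpos h0] at h
      simp only [bad, Set.mem_ofPred_eq, hR]
      have : (e : ℝ) * (2 * e * (-(1 / (2 * e)))) = -e := by field_simp
      simp only [Bool.false_eq_true, if_false]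
      rw [this]
      linarith
  refine (MeasureTheory.measure_mono hsub).trans ?_
  refine (toOuterMeasure_iUnion_fintype_le ν bad (ENNReal.ofReal (Real.exp (-(j : ℝ))))
    fun i => ?_).trans ?_
  · refine tail (R i.1 i.2.1) _ ?_
    split_ifs
    · exact abs_of_pos (by positivity)
    · rw [abs_neg]; exact abs_of_pos (by positivity)
  · rw [Fintype.card_prod, Fintype.card_prod, Fintype.card_bool]
    exact two_mul_card_sq_mul_le (hD.card_le.trans
      (Nat.pow_le_pow_right (by norm_num) (polynomial_eval_mono P hn)))

end

end InteractiveLearning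

namespace InteractiveLearning

noncomputable section

variable {V : Type}

/-! ## Reading registers -/

namespace State

variable (σ : State V)

@[simp] lemma nat_setNat (x k y : ℕ) : (σ.setNat x k).nat y = if y = x then k else σ.nat y := by
  simp [setNat, Function.update_apply]
@[simp] lemma real_setNat (x k : ℕ) : (σ.setNat x k).real = σ.real := rfl
@[simp] lemma mdl_setNat (x k : ℕ) : (σ.setNat x k).mdl = σ.mdl := rfl
@[simp] lemma lst_setNat (x k : ℕ) : (σ.setNat x k).lst = σ.lst := rfl
@[simp] lemma resp_setNat (x k : ℕ) : (σ.setNat x k).resp = σ.resp := rfl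
@[simp] lemma hist_setNat (x k : ℕ) : (σ.setNat x k).hist = σ.hist := rfl

@[simp] lemma real_setReal (x : ℕ) (a : ℝ) (y : ℕ) :
    (σ.setReal x a).real y = if y = x then a else σ.real y := by
  simp [setReal, Function.update_apply]
@[simp] lemma nat_setReal (x : ℕ) (a : ℝ) : (σ.setReal x a).nat = σ.nat := rfl
@[simp] lemma mdl_setReal (x : ℕ) (a : ℝ) : (σ.setReal x a).mdl = σ.mdl := rfl
@[simp] lemma lst_setReal (x : ℕ) (a : ℝ) : (σ.setReal x a).lst = σ.lst := rfl
@[simp] lemma resp_setReal (x : ℕ) (a : ℝ) : (σ.setReal x a).resp = σ.resp := rfl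
@[simp] lemma hist_setReal (x : ℕ) (a : ℝ) : (σ.setReal x a).hist = σ.hist := rfl

@[simp] lemma mdl_setMdl (x : ℕ) (s : V) (y : ℕ) :
    (σ.setMdl x s).mdl y = if y = x then s else σ.mdl y := by
  simp [setMdl, Function.update_apply]
@[simp] lemma nat_setMdl (x : ℕ) (s : V) : (σ.setMdl x s).nat = σ.nat := rfl
@[simp] lemma real_setMdl (x : ℕ) (s : V) : (σ.setMdl x s).real = σ.real := rfl
@[simp] lemma lst_setMdl (x : ℕ) (s : V) : (σ.setMdl x s).lst = σ.lst := rfl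
@[simp] lemma resp_setMdl (x : ℕ) (s : V) : (σ.setMdl x s).resp = σ.resp := rfl
@[simp] lemma hist_setMdl (x : ℕ) (s : V) : (σ.setMdl x s).hist = σ.hist := rfl

@[simp] lemma lst_setLst (x : ℕ) (L : List V) (y : ℕ) :
    (σ.setLst x L).lst y = if y = x then L else σ.lst y := by
  simp [setLst, Function.update_apply]
@[simp] lemma nat_setLst (x : ℕ) (L : List V) : (σ.setLst x L).nat = σ.nat := rfl
@[simp] lemma real_setLst (x : ℕ) (L : List V) : (σ.setLst x L).real = σ.real := rfl
@[simp] lemma mdl_setLst (x : ℕ) (L : List V) : (σ.setLst x L).mdl = σ.mdl := rfl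
@[simp] lemma resp_setLst (x : ℕ) (L : List V) : (σ.setLst x L).resp = σ.resp := rfl
@[simp] lemma hist_setLst (x : ℕ) (L : List V) : (σ.setLst x L).hist = σ.hist := rfl

@[simp] lemma resp_setResp (x : ℕ) (L : List (Response V)) (y : ℕ) :
    (σ.setResp x L).resp y = if y = x then L else σ.resp y := by
  simp [setResp, Function.update_apply]
@[simp] lemma nat_setResp (x : ℕ) (L : List (Response V)) : (σ.setResp x L).nat = σ.nat := rfl
@[simp] lemma real_setResp (x : ℕ) (L : List (Response V)) : (σ.setResp x L).real = σ.real := rfl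
@[simp] lemma mdl_setResp (x : ℕ) (L : List (Response V)) : (σ.setResp x L).mdl = σ.mdl := rfl
@[simp] lemma lst_setResp (x : ℕ) (L : List (Response V)) : (σ.setResp x L).lst = σ.lst := rfl
@[simp] lemma hist_setResp (x : ℕ) (L : List (Response V)) : (σ.setResp x L).hist = σ.hist := rfl

@[simp] lemma hist_addHist (s s' : V) : (σ.addHist s s').hist = σ.hist ++ [(s, s')] := rfl
@[simp] lemma nat_addHist (s s' : V) : (σ.addHist s s').nat = σ.nat := rfl
@[simp] lemma real_addHist (s s' : V) : (σ.addHist s s').real = σ.real := rfl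
@[simp] lemma mdl_addHist (s s' : V) : (σ.addHist s s').mdl = σ.mdl := rfl
@[simp] lemma lst_addHist (s s' : V) : (σ.addHist s s').lst = σ.lst := rfl
@[simp] lemma resp_addHist (s s' : V) : (σ.addHist s s').resp = σ.resp := rfl

end State

/-- The oracles answer queries about a single response correctly and in time `B`. -/
structure Oracles.Ready (O : Oracles V) (D : FeedbackGraph V) (B : ℕ) : Prop where
  check_iff : ∀ s s', D.Allowed s s' → ∀ t, O.check [(s, s')] t = true ↔ t ∈ D.reach s s'
  check_time : ∀ s s', D.Allowed s s' → ∀ t, O.checkTime [(s, s')] t ≤ B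
  mem_nbrs : ∀ s t, t ∈ O.nbrs s ↔ D.G.Adj s t
  length_nbrs : ∀ s, (O.nbrs s).length ≤ B
  nbrs_time : ∀ s, O.nbrsTime s ≤ B
  one_le : 1 ≤ B

/-- The consistency oracle is only ever called for lists with a single response, so its time is at
most P(n + 1). -/
lemma Oracles.Correct.ready [Fintype V] {O : Oracles V} {D : FeedbackGraph V} {S₀ : Finset V}
    {p Δ : ℝ} {P : Polynomial ℕ} {n B : ℕ} (h : O.Correct D S₀ p Δ P n) (hD : D.Bounded P n)
    (hB : P.eval (n + 1) ≤ B) (h1 : 1 ≤ B) : O.Ready D B := by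
  classical
  have hv : ∀ s s', D.Allowed s s' → D.ValidResponses [(s, s')] := fun s s' h => by
    simpa [FeedbackGraph.ValidResponses] using h
  have hP : P.eval n ≤ B := (polynomial_eval_mono P n.le_succ).trans hB
  refine ⟨fun s s' hs t => by simp [h.check_iff _ (hv s s' hs)],
    fun s s' hs t => (h.check_time _ (hv s s' hs) t).trans hB, h.mem_nbrs, fun s => ?_,
    fun s => (h.nbrs_time s).trans hP, h1⟩
  refine le_trans (le_of_eq ?_) ((hD.2.1 s).trans hP)
  rw [← List.toFinset_card_of_nodup (h.nbrs_nodup s), ← Set.ncard_coe_finset]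
  congr 1
  ext t
  simp [h.mem_nbrs]

/-! ## Local search for a median -/

/-- Local search from the model in register `0`, where `test` sets number register `12` to `1` if
one should move from the model in register `0` to the one in register `1`. -/
def searchProg (P : Polynomial ℕ) (test : Prog) : Prog :=
  .loop (.poly (P * .X + 1)) <|
    .seq (.nbrs 1 0) <| .seq (.setN 13 (.const 0)) <|
    .seq (.forL 1 1 <| .seq test <|
      .ite (.le (.const 1) (.var 12)) (.seq (.copyM 2 1) (.setN 13 (.const 1))) .skip) <|
    .ite (.le (.const 1) (.var 13)) (.copyM 0 2) .skip

variable {O : Oracles V} {U : User V} {B : ℕ} [Fintype V] {D : FeedbackGraph V}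

/-- X times the distance sum is at most X P(n) W at the start, and each move lowers it by at least
the total weight W. So X P(X) + 1 rounds cannot all contain a move, and a model without an improving
edge is never left. The weights W and the test are abstract in order to serve both for frequencies
of samples and for exact likelihoods; `Inv` carries what the test needs. -/
lemma swp_searchProg {P : Polynomial ℕ} {test : Prog} {n X : ℕ} {W : V → ℝ} {σ : State V}
    (hR : O.Ready D B) (hD : D.Bounded P n) (hn : n ≤ X)
    (hW : ∀ t, 0 ≤ W t) (hpos : 0 < ∑ t, W t)
    (w0 : test.writes.mdl 0 = false) (w1 : test.writes.mdl 1 = false)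
    (w2 : test.writes.mdl 2 = false) (w13 : test.writes.nat 13 = false)
    (hB : P.eval X * X + 1 ≤ B)
    (Inv : State V → Prop)
    (hInv : ∀ σ τ, Inv σ → Frame (searchProg P test).writes σ τ → Inv τ)
    (hX : ∀ σ, Inv σ → σ.nat 10 = X)
    (htest : ∀ τ, Inv τ → D.G.Adj (τ.mdl 0) (τ.mdl 1) →
      swp O U B test (fun ρ => 1 ≤ ρ.nat 12 ↔
        ((X : ℝ) + 1) * ∑ t, W t < 2 * X * D.mass W (τ.mdl 0) (τ.mdl 1)) τ)
    (hσ : Inv σ) :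
    swp O U B (searchProg P test) (fun τ => ∀ s', D.G.Adj (τ.mdl 0) s' →
      2 * X * D.mass W (τ.mdl 0) s' ≤ ((X : ℝ) + 1) * ∑ t, W t) σ := by
  set imp : V → V → Prop := fun s s' => D.G.Adj s s' ∧
    ((X : ℝ) + 1) * ∑ t, W t < 2 * X * D.mass W s s' with himp
  have hB1 : 1 ≤ B := hR.one_le
  rw [searchProg]
  -- Either the search has reached a local optimum, or each of the i rounds so far has made a move
  -- and thereby gained W.
  refine swp_loop (fun i τ => (∀ s', ¬ imp (τ.mdl 0) s') ∨
    X * D.distSum W (τ.mdl 0) + i * ∑ t, W t ≤ X * (P.eval n * ∑ t, W t)) ?_ ?_ ?_ ?_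
  · simpa [hX σ hσ] using hB
  · right
    have := hD.distSum_le hW (σ.mdl 0)
    simpa using mul_le_mul_of_nonneg_left this (Nat.cast_nonneg X)
  · intro i τ hi hF hI
    have hτ : Inv τ := hInv σ τ hσ (hF.mono (Writes.Sub.refl _))
    -- The effect of one round: stay at a local optimum, or move along some improving edge. If
    -- several neighbours qualify, the last one found is taken.
    refine swp_mono (Q := fun ρ => (ρ.mdl 0 = τ.mdl 0 ∧ ∀ s', ¬ imp (τ.mdl 0) s') ∨
      imp (τ.mdl 0) (ρ.mdl 0)) ?_ ?_
    · refine ⟨hR.length_nbrs _, hR.nbrs_time _, ?_⟩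
      refine ⟨by simp [NExp.eval], ?_⟩
      set τ₁ := (τ.setLst 1 (O.nbrs (τ.mdl 0))).setNat 13
        (NExp.eval (τ.setLst 1 (O.nbrs (τ.mdl 0))) (NExp.const 0)) with hτ₁
      have hτ₁' : Frame (searchProg P test).writes τ τ₁ :=
        ((Frame.refl _ τ).setLst rfl _).setNat rfl _
      have h10 : τ₁.mdl 0 = τ.mdl 0 := by simp [hτ₁]
      change swp O U B (.forL 1 1 _) (fun ρ => swp O U B (.ite _ _ _) _ ρ) τ₁
      refine swp_forL (fun pre ρ => (ρ.nat 13 = 0 ∧ ∀ x ∈ pre, ¬ imp (τ.mdl 0) x) ∨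
        (ρ.nat 13 = 1 ∧ imp (τ.mdl 0) (ρ.mdl 2))) (by simp [hτ₁, NExp.eval]) ?_ ?_
      · intro pre s suf ρ hl hFρ hIρ
        have hadj : D.G.Adj (τ.mdl 0) s := by
          rw [← hR.mem_nbrs]
          have : τ₁.lst 1 = O.nbrs (τ.mdl 0) := by simp [hτ₁]
          rw [← this, hl]; simp
        have e0 : (ρ.setMdl 1 s).mdl 0 = τ.mdl 0 := by
          rw [← h10]
          simpa using hFρ.mdl 0 (by simp [Prog.writes, Writes.union, Writes.none, w0])
        have e1 : (ρ.setMdl 1 s).mdl 1 = s := by simp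
        have hρ : Inv (ρ.setMdl 1 s) := by
          exact hInv _ _ hτ (hτ₁'.trans (Frame.setMdl (hFρ.mono
            (((Writes.sub_union_left _ _).trans (Writes.sub_union_right _ _)).trans
              (Writes.sub_union_right _ _))) rfl s))
        have ht := htest _ hρ (by rw [e0, e1]; exact hadj)
        rw [e0, e1] at ht
        refine swp_call (c := test) ht fun π hFπ hπ => ?_
        have e13 : π.nat 13 = ρ.nat 13 := by simpa using hFπ.nat 13 w13
        have e1' : π.mdl 1 = s := by simpa using hFπ.mdl 1 w1
        have e2' : π.mdl 2 = ρ.mdl 2 := by simpa using hFπ.mdl 2 w2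
        refine ⟨fun hb => ?_, fun hb => ?_⟩
        · refine ⟨by simpa [NExp.eval] using hB1, Or.inr ?_⟩
          have : 1 ≤ π.nat 12 := hb
          simpa [NExp.eval, e1', himp, hadj] using hπ.1 this
        · change (_ ∨ _)
          rw [e13, e2']
          rcases hIρ with h | h
          · refine Or.inl ⟨h.1, fun x hx => ?_⟩
            rcases List.mem_append.1 hx with hx | hx
            · exact h.2 x hx
            · rw [List.mem_singleton.1 hx]
              exact fun hi => hb (hπ.2 hi.2)
          · exact Or.inr h
      · intro ρ hFρ hI
        have e0 : ρ.mdl 0 = τ.mdl 0 := by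
          rw [← h10]
          exact hFρ.mdl 0 (by simp [Prog.writes, Writes.union, Writes.none, w0])
        refine ⟨fun hb => Or.inr ?_, fun hb => Or.inl ⟨e0, fun s' hs' => ?_⟩⟩
        · have hb' : 1 ≤ ρ.nat 13 := hb
          rcases hI with h | h
          · omega
          · simpa using h.2
        · have hb' : ¬ 1 ≤ ρ.nat 13 := hb
          rcases hI with h | h
          · refine h.2 s' ?_ hs'
            have : τ₁.lst 1 = O.nbrs (τ.mdl 0) := by simp [hτ₁]
            rw [this, hR.mem_nbrs]
            exact hs'.1
          · omega
    · rintro ρ (⟨h1, h2⟩ | h)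
      · left; rwa [h1]
      · right
        rcases hI with hI | hI
        · exact absurd h (hI _)
        · have := FeedbackGraph.distSum_move hD.preconnected hW h.1 (Nat.cast_nonneg X) h.2.le
          push_cast
          linarith
  · rintro τ hF (h | h) s' hs'
    · by_contra hlt
      exact h s' ⟨hs', not_le.1 hlt⟩
    -- With X P(X) + 1 gains of W > 0 the distance sum would be negative.
    · exfalso
      have hτ : Inv τ := hInv σ τ hσ (hF.mono (Writes.Sub.refl _))
      have h1 := FeedbackGraph.distSum_nonneg (D := D) hW (τ.mdl 0)
      have h2 : ((P.eval n : ℕ) : ℝ) ≤ (P.eval X : ℕ) := by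
        exact_mod_cast polynomial_eval_mono P hn
      simp only [NExp.eval_poly, hX σ hσ, Polynomial.eval_add, Polynomial.eval_mul,
        Polynomial.eval_X, Polynomial.eval_one] at h
      push_cast at h
      have h3 := mul_le_mul_of_nonneg_left h2 (Nat.cast_nonneg (α := ℝ) X)
      have h4 := mul_le_mul_of_nonneg_right h3 hpos.le
      have h5 := mul_nonneg (Nat.cast_nonneg (α := ℝ) X) h1
      nlinarith

/-! ### The test for a list of samples -/

/-- Should one move from model `0` to model `1`, if the weights are the frequencies in list `0`? -/
def countTest : Prog :=
  .seq (.clearQ 1) <| .seq (.pushQ 1 0 1) <| .seq (.setN 14 (.const 0)) <|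
  .seq (.forL 3 0 <| .seq (.check 11 3 1) <| .setN 14 (.add (.var 14) (.var 11))) <|
  .ite (.le (.mul (.mul (.const 2) (.var 10)) (.var 14))
    (.mul (.add (.var 10) (.const 1)) (.lengthL 0))) (.setN 12 (.const 0)) (.setN 12 (.const 1))

open Classical in
/-- The multiplicity of a model in a list. -/
def freq (ls : List V) (t : V) : ℝ := ls.count t

omit [Fintype V] in
open Classical in
lemma countP_eq_sum_freq (ls : List V) (A : Finset V) :
    (ls.countP (· ∈ A) : ℝ) = ∑ t ∈ A, freq ls t := by
  induction ls with
  | nil => simp [freq]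
  | cons s ls ih =>
    simp only [freq, List.count_cons, List.countP_cons] at *
    push_cast
    rw [ih, Finset.sum_add_distrib]
    congr 1
    simp

open Classical in
lemma mass_freq (ls : List V) (s s' : V) :
    D.mass (freq ls) s s' = ls.countP (· ∈ D.reach s s') := by
  have := countP_eq_sum_freq ls (Finset.univ.filter (· ∈ D.reach s s'))
  rw [FeedbackGraph.mass, ← this]
  simp

lemma sum_freq (ls : List V) : ∑ t, freq ls t = ls.length := by
  classical
  rw [← countP_eq_sum_freq]
  simp

omit [Fintype V] in
lemma freq_nonneg (ls : List V) (t : V) : 0 ≤ freq ls t := Nat.cast_nonneg _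

lemma swp_countTest {σ : State V} (hR : O.Ready D B) (hadj : D.G.Adj (σ.mdl 0) (σ.mdl 1))
    (hl : (σ.lst 0).length ≤ B) :
    swp O U B countTest (fun ρ => 1 ≤ ρ.nat 12 ↔
      ((σ.nat 10 : ℝ) + 1) * ∑ t, freq (σ.lst 0) t <
        2 * σ.nat 10 * D.mass (freq (σ.lst 0)) (σ.mdl 0) (σ.mdl 1)) σ := by
  classical
  have hB1 := hR.one_le
  refine ⟨by simpa using hB1, Nat.zero_le _, ?_⟩
  refine swp_forL (fun pre τ => τ.nat 14 = pre.countP (· ∈ D.reach (σ.mdl 0) (σ.mdl 1)))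
    rfl ?_ ?_
  · intro pre s suf τ hls hF hI
    have h1 : τ.resp 1 = [(σ.mdl 0, σ.mdl 1)] := by
      rw [hF.resp 1 rfl]; simp
    have hall : D.Allowed (σ.mdl 0) (σ.mdl 1) := Or.inr hadj
    have hlen : pre.countP (· ∈ D.reach (σ.mdl 0) (σ.mdl 1)) + 1 ≤ B := by
      have : pre.length + 1 ≤ (σ.lst 0).length := by
        simp only [State.lst_setNat, State.lst_setResp] at hls
        rw [hls]; simp
      have := List.countP_le_length (p := (· ∈ D.reach (σ.mdl 0) (σ.mdl 1))) (l := pre)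
      omega
    refine ⟨hB1, ?_, ?_⟩
    · simpa [h1] using hR.check_time _ _ hall _
    · have hc := hR.check_iff _ _ hall s
      simp only [swp, NExp.eval, State.nat_setNat, State.nat_setMdl, State.resp_setMdl, h1,
        State.mdl_setMdl, if_true, hI, List.countP_append, List.countP_singleton, hc,
        decide_eq_true_eq]
      simp only [Nat.reduceEqDiff, if_false]
      split_ifs <;> refine ⟨by omega, by simp⟩
  · intro τ hF hI
    have e10 : τ.nat 10 = σ.nat 10 := by simpa using hF.nat 10 rfl
    have e0 : τ.lst 0 = σ.lst 0 := by simpa using hF.lst 0 rfl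
    have hl0 : (σ.lst 0) = ((((σ.setResp 1 []).setResp 1 (List.append ((σ.setResp 1 []).resp 1)
      [((σ.setResp 1 []).mdl 0, (σ.setResp 1 []).mdl 1)])).setNat 14 (NExp.eval σ (.const 0))).lst 0)
      := rfl
    have hI' : τ.nat 14 = (σ.lst 0).countP (· ∈ D.reach (σ.mdl 0) (σ.mdl 1)) := hI
    rw [sum_freq, mass_freq]
    simp only [swp, BExp.Holds, NExp.eval, e10, e0, hI', State.nat_setNat, if_true]
    refine ⟨fun h => ⟨Nat.zero_le _, ?_⟩, fun h => ⟨hB1, ?_⟩⟩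
    · simp only [nonpos_iff_eq_zero, one_ne_zero, false_iff, not_lt]
      exact_mod_cast h
    · simp only [le_refl, true_iff]
      exact_mod_cast not_le.1 h

/-- Local search for a median of the samples in list `0`. -/
lemma swp_searchProg_countTest {P : Polynomial ℕ} {n X : ℕ} {σ : State V}
    (hR : O.Ready D B) (hD : D.Bounded P n) (hn : n ≤ X) (hB : P.eval X * X + 1 ≤ B)
    (hX : σ.nat 10 = X) (hl : (σ.lst 0).length ≤ B) (hl0 : 0 < (σ.lst 0).length) :
    swp O U B (searchProg P countTest) (fun τ => ∀ s', D.G.Adj (τ.mdl 0) s' →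
      2 * X * D.mass (freq (σ.lst 0)) (τ.mdl 0) s' ≤ ((X : ℝ) + 1) * (σ.lst 0).length) σ := by
  have := swp_searchProg (U := U) (test := countTest) (W := freq (σ.lst 0)) (σ := σ) hR hD hn
    (freq_nonneg _) (by rw [sum_freq]; exact_mod_cast hl0) rfl rfl rfl rfl hB
    (fun τ => τ.nat 10 = X ∧ τ.lst 0 = σ.lst 0)
    (fun τ ρ h hF => ⟨by rw [hF.nat 10 rfl, h.1], by rw [hF.lst 0 rfl, h.2]⟩) (fun τ h => h.1)
    (fun τ h hadj => by
      have := swp_countTest (U := U) hR hadj (by rw [h.2]; exact hl)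
      rw [h.1, h.2] at this
      exact this) ⟨hX, rfl⟩
  rwa [sum_freq] at this

end

end InteractiveLearning

namespace InteractiveLearning

noncomputable section

variable {V : Type}

/-! ## What accurate samples say about the likelihoods -/

section Accuracy

variable [Fintype V] {D : FeedbackGraph V} {μ : PMF V} {E : ℕ} {ls : List V} {w : V → ℝ} {Δ : ℝ}

-- Confirming s leaves only s, so accuracy for the sets R(s,s) is accuracy for single models.
open Classical in
lemma Accurate.count (h : Accurate D μ E ls) (s : V) :
    |(ls.count s : ℝ) - (μ s).toReal * ls.length| * E ≤ ls.length := by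
  have := h s s
  simpa [FeedbackGraph.mem_reach_self, List.count, Finset.sum_filter, beq_eq_decide] using this

/-- The error budget: local optimality for frequencies leaves 1/2 + 1/(2X), the sampling error 1/E
is at most 1/(2X), and passing from the sampled law to the weights costs Δ, once only. -/
lemma Accurate.potential_le (h : Accurate D μ E ls) {X : ℕ} (hX : 1 ≤ X) (hE : 2 * X ≤ E)
    (hl : 0 < ls.length) (hw : 0 < ∑ t, w t) (htv : tvDist w μ ≤ Δ) {s : V} {β : ℝ}
    (hβ : 1 / 2 + Δ + 1 / X ≤ β)
    (hs : ∀ s', D.G.Adj s s' →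
      2 * X * D.mass (freq ls) s s' ≤ ((X : ℝ) + 1) * ls.length) :
    D.potential w s ≤ β := by
  classical
  have hΔ : 0 ≤ Δ := (abs_nonneg _).trans (tvDist_bound hw htv ∅)
  have hX0 : (1 : ℝ) ≤ X := by exact_mod_cast hX
  have hE0 : 2 * (X : ℝ) ≤ E := by exact_mod_cast hE
  have hX1 : (0 : ℝ) < 1 / X := by positivity
  have hl0 : (0 : ℝ) < ls.length := by exact_mod_cast hl
  refine FeedbackGraph.potential_le hw (by linarith) fun s' hadj => ?_
  have h1 := (abs_le.1 (tvDist_bound hw htv {t | t ∈ D.reach s s'})).2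
  have h2 := h s s'
  rw [← mass_freq] at h2
  have h3 := hs s' hadj
  set q := ∑ t with t ∈ D.reach s s', (μ t).toReal with hq
  set c := D.mass (freq ls) s s' with hc
  have h4 : (q * ls.length - c) * E ≤ ls.length := by
    refine le_trans ?_ h2
    refine mul_le_mul_of_nonneg_right ?_ (by linarith)
    rw [abs_sub_comm]
    exact le_abs_self _
  have h5 : q ≤ 1 / 2 + 1 / X := by
    have h6 : (q * ls.length - c) * (2 * X) ≤ ls.length := by
      rcases le_total 0 (q * ls.length - c) with h0 | h0
      · exact (mul_le_mul_of_nonneg_left hE0 h0).trans h4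
      · nlinarith
    have h7 : q * (2 * X) * ls.length ≤ (X + 2) * ls.length := by nlinarith
    have h8 := le_of_mul_le_mul_right h7 hl0
    have h9 : (1 / 2 + 1 / X : ℝ) = (X + 2) / (2 * X) := by field_simp
    rw [h9, le_div_iff₀ (by positivity)]
    exact h8
  have h6 : D.mass w s s' / (∑ t, w t) ≤ β := by
    have : D.mass w s s' / (∑ t, w t) - q ≤ Δ := h1
    linarith
  rwa [div_le_iff₀ hw] at h6

lemma tvDist_apply (hw : 0 < ∑ t, w t) (htv : tvDist w μ ≤ Δ) (s : V) :
    |w s / (∑ t, w t) - (μ s).toReal| ≤ Δ := by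
  simpa using tvDist_bound hw htv {s}

end Accuracy

/-! ## Sure and probable postconditions -/

variable {O : Oracles V} {U : User V} {B : ℕ} [Fintype V]

/-- Started in a bounded state with `S`, the program surely ends in a state with `S'`, in time. If
also `G` holds at the beginning, then `G'` holds at the end, up to an error probability `e`. -/
def HT (O : Oracles V) (U : User V) (B : ℕ) (S G : State V → Prop) (c : Prog)
    (S' G' : State V → Prop) (e : ℝ≥0∞) : Prop :=
  ∀ σ : State V, σ.Bounded B → S σ.erase →
    (∀ τ ∈ (c.run O U σ).support,
      S' τ.erase ∧ τ.Bounded B ∧ τ.time ≤ σ.time + c.timeBound B) ∧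
    (G σ.erase → (c.run O U σ).toOuterMeasure {τ | ¬ G' τ.erase} ≤ e)

namespace HT

variable {S S' S'' G G' G'' : State V → Prop} {c d : Prog} {e e' : ℝ≥0∞}

lemma of_swp (hbits : Nat.clog 2 (Fintype.card V) ≤ B) (h : ∀ σ, S σ → swp O U B c S' σ)
    (h' : ∀ σ, S σ → G σ → swp O U B c G' σ) : HT O U B S G c S' G' 0 := by
  refine fun σ hσ hS => ⟨swp_sound hbits c _ σ hσ (h _ hS), fun hG => ?_⟩
  rw [nonpos_iff_eq_zero, PMF.toOuterMeasure_apply_eq_zero_iff, Set.disjoint_left]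
  exact fun τ hτ hn => hn (swp_sound hbits c _ σ hσ (h' _ hS hG) τ hτ).1

lemma mono (h : HT O U B S G c S' G' e) (he : e ≤ e') : HT O U B S G c S' G' e' :=
  fun σ hσ hS => ⟨(h σ hσ hS).1, fun hG => ((h σ hσ hS).2 hG).trans he⟩

lemma seq (h : HT O U B S G c S' G' e) (h' : HT O U B S' G' d S'' G'' e') :
    HT O U B S G (.seq c d) S'' G'' (e + e') := by
  refine fun σ hσ hS => ⟨fun τ hτ => ?_, fun hG => ?_⟩
  · simp only [Prog.run, PMF.mem_support_bind_iff] at hτ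
    obtain ⟨ρ, hρ, hτ⟩ := hτ
    obtain ⟨h1, h2, h3⟩ := (h σ hσ hS).1 ρ hρ
    obtain ⟨h4, h5, h6⟩ := (h' ρ h2 h1).1 τ hτ
    exact ⟨h4, h5, by simp only [Prog.timeBound]; omega⟩
  · refine toOuterMeasure_bind_le ((h σ hσ hS).2 hG) fun ρ hρ hn => ?_
    obtain ⟨h1, h2, -⟩ := (h σ hσ hS).1 ρ hρ
    exact (h' ρ h2 h1).2 (not_not.1 hn)

lemma ite (hbits : Nat.clog 2 (Fintype.card V) ≤ B) {b : BExp}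
    (h : HT O U B (fun σ => S σ ∧ b.Holds σ) G c S' G' e)
    (h' : HT O U B (fun σ => S σ ∧ ¬ b.Holds σ) G d S' G' e) :
    HT O U B S G (.ite b c d) S' G' e := by
  intro σ hσ hS
  have hb := BExp.cost_le hσ hbits b
  have ht := hσ.tick (1 + b.cost (Nat.clog 2 (Fintype.card V)) σ)
  simp only [Prog.run]
  split_ifs with hif
  · obtain ⟨h1, h2⟩ := h _ ht ⟨hS, (BExp.holds_erase σ b).2 hif⟩
    refine ⟨fun τ hτ => ?_, h2⟩
    obtain ⟨h3, h4, h5⟩ := h1 τ hτ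
    refine ⟨h3, h4, ?_⟩
    simp only [State.tick, Prog.timeBound] at *; omega
  · obtain ⟨h1, h2⟩ := h' _ ht ⟨hS, fun hn => hif ((BExp.holds_erase σ b).1 hn)⟩
    refine ⟨fun τ hτ => ?_, h2⟩
    obtain ⟨h3, h4, h5⟩ := h1 τ hτ
    refine ⟨h3, h4, ?_⟩
    simp only [State.tick, Prog.timeBound] at *; omega

/-- A union bound over the iterations: the error of an iteration is charged only from states in
which the good assertion still holds, while the sure assertion keeps every iteration within its
resources. -/
lemma loop {a : NExp} {N : ℕ} {S G : ℕ → State V → Prop} (hN : ∀ σ, S 0 σ → a.eval σ = N)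
    (hB : N ≤ B) (h : ∀ i < N, HT O U B (S i) (G i) c (S (i + 1)) (G (i + 1)) e) :
    HT O U B (S 0) (G 0) (.loop a c) (S N) (G N) (N * e) := by
  intro σ hσ hS
  have ha := NExp.cost_le hσ a
  have hev : a.eval σ = N := by rw [← NExp.eval_erase, hN _ hS]
  simp only [Prog.run, hev]
  have key : ∀ k ≤ N, (∀ τ ∈ ((fun μ : PMF (State V) => μ.bind fun τ =>
        c.run O U (τ.tick 1))^[k] (PMF.pure (σ.tick (1 + a.cost σ)))).support,
        S k τ.erase ∧ τ.Bounded B ∧ τ.time ≤ σ.time + (1 + a.cost σ) + k * (1 + c.timeBound B)) ∧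
      (G 0 σ.erase → ((fun μ : PMF (State V) => μ.bind fun τ =>
        c.run O U (τ.tick 1))^[k] (PMF.pure (σ.tick (1 + a.cost σ)))).toOuterMeasure
          {τ | ¬ G k τ.erase} ≤ k * e) := by
    intro k
    induction k with
    | zero =>
      intro _
      simp only [Function.iterate_zero, id_eq]
      refine ⟨fun τ hτ => ?_, fun hG => ?_⟩
      · rw [PMF.support_pure, Set.mem_singleton_iff] at hτ
        subst hτ
        exact ⟨hS, hσ.tick _, by simp [State.tick]⟩
      · rw [Nat.cast_zero, zero_mul, nonpos_iff_eq_zero, PMF.toOuterMeasure_apply_eq_zero_iff,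
          PMF.support_pure, Set.disjoint_singleton_left]
        exact fun hn => hn hG
    | succ k ih =>
      intro hk
      obtain ⟨ih1, ih2⟩ := ih (by omega)
      rw [Function.iterate_succ_apply']
      refine ⟨fun τ hτ => ?_, fun hG => ?_⟩
      · rw [PMF.mem_support_bind_iff] at hτ
        obtain ⟨ρ, hρ, hτ⟩ := hτ
        obtain ⟨h1, h2, h3⟩ := ih1 ρ hρ
        obtain ⟨h4, h5, h6⟩ := (h k (by omega) _ (h2.tick 1) h1).1 τ hτ
        refine ⟨h4, h5, ?_⟩
        simp only [State.tick] at h6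
        rw [add_one_mul]
        omega
      · push_cast
        rw [add_one_mul]
        refine toOuterMeasure_bind_le (ih2 hG) fun ρ hρ hn => ?_
        obtain ⟨h1, h2, h3⟩ := ih1 ρ hρ
        exact (h k (by omega) _ (h2.tick 1) h1).2 (not_not.1 hn)
  obtain ⟨h1, h2⟩ := key N le_rfl
  refine ⟨fun τ hτ => ?_, h2⟩
  obtain ⟨h3, h4, h5⟩ := h1 τ hτ
  refine ⟨h3, h4, h5.trans ?_⟩
  have := Nat.mul_le_mul_right (1 + c.timeBound B) hB
  simp only [Prog.timeBound]
  omega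

/-- The only source of error: every other piece of the programs is handled by `of_swp` with error 0.
The length of the list is sure, its accuracy is probable. -/
lemma draw {D : FeedbackGraph V} {P E A : Polynomial ℕ} {n X : ℕ} (hbits : Nat.clog 2 (Fintype.card V) ≤ B)
    (hD : D.Bounded P n) (hn : n ≤ X) (hL : (sampleSize P E A).eval X ≤ B) (hE : 1 ≤ E.eval X)
    (hX : ∀ σ, S σ → σ.nat 10 = X) (ht : ∀ σ, S σ → O.sampleTime (σ.resp 0) ≤ B)
    (hS : ∀ σ τ, S σ → Frame (drawProg (sampleSize P E A)).writes σ τ →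
      (τ.lst 0).length = (sampleSize P E A).eval X → S' τ)
    (hG : ∀ σ τ, S σ → G σ → Frame (drawProg (sampleSize P E A)).writes σ τ →
      (τ.lst 0).length = (sampleSize P E A).eval X →
      Accurate D (O.sample (τ.resp 0)) (E.eval X) (τ.lst 0) → G' τ) :
    HT O U B S G (drawProg (sampleSize P E A)) S' G' ((1 / 2) ^ A.eval X) := by
  intro σ hσ hσS
  have hX' : σ.nat 10 = X := hX σ.erase hσS
  have h1 : swp O U B (drawProg (sampleSize P E A)) (fun τ =>
      Frame (drawProg (sampleSize P E A)).writes σ.erase τ ∧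
      (τ.lst 0).length = (sampleSize P E A).eval X) σ.erase := by
    refine swp_frame (Writes.Sub.refl _) (Frame.refl _ _) ?_
    have := swp_drawProg (O := O) (U := U) (B := B) (L := sampleSize P E A) (σ := σ.erase)
      (by rw [hX _ hσS]; exact hL) (ht _ hσS)
    rwa [hX _ hσS] at this
  have h2 := swp_sound hbits _ _ σ hσ h1
  refine ⟨fun τ hτ => ?_, fun hσG => ?_⟩
  · obtain ⟨h3, h4, h5⟩ := h2 τ hτ
    exact ⟨hS _ _ hσS h3.1 h3.2, h4, h5⟩
  · have h3 := drawProg_accurate (O := O) (U := U) (E := E) (A := A) D hD σ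
      (by rw [hX']; exact hn) (by rw [hX']; exact hE)
    rw [hX'] at h3
    refine le_trans (PMF.toOuterMeasure_mono _ ?_) h3
    rintro τ ⟨hbad, hτ⟩ hacc
    obtain ⟨h4, -, -⟩ := h2 τ hτ
    refine hbad (hG _ _ hσS hσG h4.1 h4.2 ?_)
    rw [h4.1.resp 0 rfl]
    exact hacc

end HT

/-! ## Finding an approximate median -/

lemma FeedbackGraph.Bounded.clog_le {D : FeedbackGraph V} {P : Polynomial ℕ} {n : ℕ}
    (h : D.Bounded P n) : Nat.clog 2 (Fintype.card V) ≤ P.eval n :=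
  Nat.clog_le_of_le_pow h.card_le

lemma one_le_sampleSize_eval {P E A : Polynomial ℕ} {X : ℕ} (hE : 1 ≤ E.eval X) :
    0 < (sampleSize P E A).eval X := by
  simp only [sampleSize, Polynomial.eval_mul, Polynomial.eval_add, Polynomial.eval_pow,
    Polynomial.eval_one, Polynomial.eval_ofNat]
  positivity

open Polynomial in
/-- Draw samples, and search a median of them. -/
def medianProg (P : Polynomial ℕ) : Prog :=
  .seq (.setN 10 (.add (.add (.add (.var 0) (.var 1)) (.var 2)) (.lengthQ 0))) <|
  .seq (drawProg (sampleSize P (2 * X) X)) (searchProg P countTest)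

omit [Fintype V] in
lemma State.initial_bounded {nats : List ℕ} {reals : List ℝ} {Q : List (Response V)} {v₀ : V}
    (h : ∀ x ∈ nats, x.size ≤ B) (hQ : Q.length ≤ B) :
    (State.initial nats reals Q v₀).Bounded B := by
  refine ⟨fun x => ?_, fun l => Nat.zero_le _, fun q => ?_⟩
  · simp only [State.initial, List.getD_eq_getElem?_getD]
    rcases lt_or_ge x nats.length with hx | hx
    · rw [List.getElem?_eq_getElem hx]
      exact h _ (List.getElem_mem hx)
    · rw [List.getElem?_eq_none hx]
      simp
  · simp only [State.initial]
    split_ifs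
    · exact hQ
    · exact Nat.zero_le _

/-- One draw of samples with accuracy 1/(2X), followed by local search. The measure X exceeds n,
1/ε, k and |Q|, so the error 1/2 + Δ + 1/X is within the claim. -/
lemma exists_medianProg (Δ : ℝ) (hΔ₀ : 0 ≤ Δ) (P : Polynomial ℕ) :
    ∃ (c : Prog) (R : Polynomial ℕ), c.RealFree ∧
      ∀ (V : Type) [Fintype V] (D : FeedbackGraph V) (O : Oracles V) (S₀ : Finset V)
        (p : ℝ) (n : ℕ),
        1 / 2 < p → p ≤ 1 → D.Bounded P n → O.Correct D S₀ p Δ P n →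
        ∀ (ε : ℝ), 0 < ε → ∀ (k : ℕ) (Q : List (Response V)), D.ValidResponses Q →
          0 < ∑ t, D.weight p S₀ Q t → ∀ (U : User V) (v₀ : V),
          (∀ σ ∈ (c.run O U (State.initial [n, ⌈1 / ε⌉₊, k] [] Q v₀)).support,
            σ.hist = [] ∧ σ.time ≤ R.eval (n + ⌈1 / ε⌉₊ + k + Q.length)) ∧
          (c.run O U (State.initial [n, ⌈1 / ε⌉₊, k] [] Q v₀)).toOuterMeasure
            {σ | ¬ D.potential (D.weight p S₀ Q) (σ.mdl 0) ≤ 1 / 2 + 2 * Δ + ε} ≤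
              (1 / 2 : ℝ≥0∞) ^ k := by
  obtain ⟨R, hR⟩ := (medianProg P).exists_timeBound_eq_eval
  set L := sampleSize P (2 * Polynomial.X) Polynomial.X with hL
  set BP : Polynomial ℕ := L + P * Polynomial.X + P.comp (Polynomial.X + 1) + Polynomial.X + 1
    with hBP
  refine ⟨medianProg P, R.comp BP, ?_, ?_⟩
  · simp [medianProg, drawProg, searchProg, countTest, Prog.RealFree, BExp.RealFree]
  intro V _ D O S₀ p n hp hp1 hD hO ε hε k Q hQ hpos U v₀
  set m := ⌈1 / ε⌉₊ with hm
  have hm1 : 1 ≤ m := Nat.one_le_ceil_iff.2 (by positivity)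
  set X := n + m + k + Q.length with hX
  set B := BP.eval X with hB
  have hBe : B = L.eval X + P.eval X * X + P.eval (X + 1) + X + 1 := by simp [hB, hBP]
  have hPn : P.eval n ≤ P.eval (X + 1) := polynomial_eval_mono P (by omega)
  have hbits : Nat.clog 2 (Fintype.card V) ≤ B := hD.clog_le.trans (by omega)
  have hr : O.Ready D B := hO.ready hD
    ((polynomial_eval_mono P (by omega : n + 1 ≤ X + 1)).trans (by omega)) (by omega)
  have hE : (2 * Polynomial.X : Polynomial ℕ).eval X = 2 * X := by simp
  have hE1 : 1 ≤ (2 * Polynomial.X : Polynomial ℕ).eval X := by rw [hE]; omega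
  have hL0 : 0 < L.eval X := one_le_sampleSize_eval hE1
  have hεX : 1 / (X : ℝ) ≤ ε := by
    have h1 : 1 / ε ≤ m := Nat.le_ceil _
    have h2 : (m : ℝ) ≤ X := by exact_mod_cast (by omega : m ≤ X)
    rw [div_le_iff₀ (by positivity)] at h1
    rw [div_le_iff₀ (by exact_mod_cast (by omega : 0 < X))]
    nlinarith
  have key : HT O U B (fun σ => σ = State.initial [n, m, k] [] Q v₀) (fun _ => True) (medianProg P)
      (fun σ => σ.hist = [])
      (fun σ => D.potential (D.weight p S₀ Q) (σ.mdl 0) ≤ 1 / 2 + 2 * Δ + ε)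
      (0 + ((1 / 2) ^ (Polynomial.X : Polynomial ℕ).eval X + 0)) := by
    refine HT.seq (S' := fun σ => σ.nat 10 = X ∧ σ.resp 0 = Q ∧ σ.hist = [])
      (G' := fun _ => True) (HT.of_swp hbits ?_ ?_)
      (HT.seq (S' := fun σ => σ.nat 10 = X ∧ (σ.lst 0).length = L.eval X ∧ σ.hist = [])
        (G' := fun σ => Accurate D (O.sample Q) (2 * X) (σ.lst 0)) ?_ (HT.of_swp hbits ?_ ?_))
    · rintro σ rfl
      refine ⟨?_, ?_, rfl, rfl⟩
      · simp only [NExp.eval, State.initial, if_true, List.getD_cons_zero, List.getD_cons_succ]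
        omega
      · simp [NExp.eval, State.initial, hX]
    · rintro σ rfl -
      refine ⟨?_, trivial⟩
      simp only [NExp.eval, State.initial, if_true, List.getD_cons_zero, List.getD_cons_succ]
      omega
    · refine HT.draw hbits hD (by omega) (by rw [← hL]; omega) hE1 (fun σ h => h.1) ?_ ?_ ?_
      · intro σ h
        rw [h.2.1]
        refine (hO.sample_time Q hQ).trans
          ((polynomial_eval_mono P (by omega : n + Q.length ≤ X + 1)).trans (by omega))
      · intro σ τ h hF hlen
        exact ⟨by rw [hF.nat 10 rfl, h.1], hlen, by rw [hF.hist rfl, h.2.2]⟩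
      · intro σ τ h _ hF hlen hacc
        rw [hE, hF.resp 0 rfl, h.2.1] at hacc
        exact hacc
    · rintro σ ⟨h1, h2, h3⟩
      refine swp_call (swp_searchProg_countTest (U := U) hr hD (by omega : n ≤ X) (by omega) h1
        (by omega) (by omega)) fun τ hF _ => ?_
      rw [hF.hist rfl, h3]
    · rintro σ ⟨h1, h2, h3⟩ hacc
      refine swp_call (swp_searchProg_countTest (U := U) hr hD (by omega : n ≤ X) (by omega) h1
        (by omega) (by omega)) fun τ hF hτ => ?_
      exact hacc.potential_le (by omega) le_rfl (by omega) hpos (hO.sample_close Q hQ hpos)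
        (by linarith) hτ
  obtain ⟨h1, h2⟩ := key (State.initial [n, m, k] [] Q v₀)
    (State.initial_bounded (fun x hx => (Nat_size_le_self x).trans (by
      simp only [List.mem_cons, List.not_mem_nil, or_false] at hx; omega)) (by omega)) rfl
  refine ⟨fun τ hτ => ?_, ?_⟩
  · obtain ⟨h3, -, h4⟩ := h1 τ hτ
    refine ⟨h3, h4.trans ?_⟩
    rw [hR, Polynomial.eval_comp, ← hB]
    simp [State.initial]
  · refine (h2 trivial).trans ?_
    rw [Polynomial.eval_X, zero_add, add_zero]
    -- The error obtained is 2^(-X), and k ≤ X.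
    exact pow_le_pow_right_of_le_one' (by rw [one_div]; exact ENNReal.inv_le_one.2 (by norm_num))
      (by omega)

end

end InteractiveLearning

namespace InteractiveLearning

noncomputable section

variable {V : Type} {O : Oracles V} {U : User V} {B : ℕ}

/-! ## Learning without feedback errors -/

/-- Number register `14` receives the multiplicity of model `5` in list `0`. -/
def occProg : Prog :=
  .seq (.setN 14 (.const 0)) <|
  .forL 3 0 <| .ite (.eqM 3 5) (.setN 14 (.add (.var 14) (.const 1))) .skip

open Classical in
lemma swp_occProg {σ : State V} (hl : (σ.lst 0).length ≤ B) :
    swp O U B occProg (fun τ => τ.nat 14 = (σ.lst 0).count (σ.mdl 5)) σ := by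
  refine ⟨Nat.zero_le _, ?_⟩
  refine swp_forL (fun pre τ => τ.nat 14 = pre.count (σ.mdl 5)) rfl ?_ ?_
  · intro pre s suf τ hls hF hI
    have h5 : τ.mdl 5 = σ.mdl 5 := hF.mdl 5 rfl
    have hlen : pre.count (σ.mdl 5) + 1 ≤ B := by
      have h1 : pre.length + 1 ≤ (σ.lst 0).length := by
        simp only [State.lst_setNat] at hls
        rw [hls]; simp
      have := List.count_le_length (l := pre) (a := σ.mdl 5)
      omega
    simp only [swp, BExp.Holds, NExp.eval, State.mdl_setMdl, if_true, State.nat_setMdl,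
      State.nat_setNat, hI, List.count_append, List.count_singleton, Nat.reduceEqDiff, if_false,
      h5, beq_iff_eq]
    refine ⟨fun h => ⟨hlen, by rw [if_pos h]⟩, fun h => by rw [if_neg h, add_zero]⟩
  · exact fun τ hF h => h

/-- Copies a model that makes up more than three quarters of list `0` to register `0`, and raises
the flag `15`. -/
def detectProg : Prog :=
  .forL 5 0 <| .seq occProg <|
    .ite (.le (.mul (.const 4) (.var 14)) (.mul (.const 3) (.lengthL 0))) .skip
      (.seq (.copyM 0 5) (.setN 15 (.const 1)))

open Classical in
lemma swp_detectProg {σ : State V} (hl : (σ.lst 0).length ≤ B) (hB : 1 ≤ B)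
    (h15 : σ.nat 15 = 0) :
    swp O U B detectProg (fun τ =>
      (1 ≤ τ.nat 15 ∧ 3 * (σ.lst 0).length < 4 * (σ.lst 0).count (τ.mdl 0)) ∨
      (τ.nat 15 = 0 ∧ ∀ s, 4 * (σ.lst 0).count s ≤ 3 * (σ.lst 0).length)) σ := by
  refine swp_forL (fun pre τ =>
      (1 ≤ τ.nat 15 ∧ 3 * (σ.lst 0).length < 4 * (σ.lst 0).count (τ.mdl 0)) ∨
      (τ.nat 15 = 0 ∧ ∀ s ∈ pre, 4 * (σ.lst 0).count s ≤ 3 * (σ.lst 0).length))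
      (by simp [h15]) ?_ ?_
  · intro pre s suf τ hls hF hI
    have h0 : τ.lst 0 = σ.lst 0 := hF.lst 0 rfl
    refine swp_call (c := occProg) (swp_occProg (by simpa [h0] using hl)) fun ρ hFρ hρ => ?_
    simp only [State.lst_setMdl, State.mdl_setMdl, if_true, h0] at hρ
    have e0 : ρ.mdl 0 = τ.mdl 0 := by simpa using hFρ.mdl 0 rfl
    have e5 : ρ.mdl 5 = s := by simpa using hFρ.mdl 5 rfl
    have e15 : ρ.nat 15 = τ.nat 15 := by simpa using hFρ.nat 15 rfl
    have el : ρ.lst 0 = σ.lst 0 := by rw [← h0]; simpa using hFρ.lst 0 rfl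
    simp only [swp, BExp.Holds, NExp.eval, hρ, el, e5, e15, State.mdl_setMdl, State.nat_setMdl,
      State.nat_setNat, State.mdl_setNat, if_true]
    refine ⟨fun h => ?_, fun h => ⟨hB, Or.inl ⟨le_rfl, not_le.1 h⟩⟩⟩
    rw [e0]
    refine hI.imp id fun hI => ⟨hI.1, fun t ht => ?_⟩
    rcases List.mem_append.1 ht with ht | ht
    · exact hI.2 t ht
    · rwa [List.mem_singleton.1 ht]
  · rintro τ hF (h | h)
    · exact Or.inl h
    · refine Or.inr ⟨h.1, fun s => ?_⟩
      by_cases hs : s ∈ σ.lst 0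
      · exact h.2 s hs
      · rw [List.count_eq_zero.2 hs]; omega

/-- One round without feedback errors, after samples have been drawn. -/
def noiselessStep (P : Polynomial ℕ) : Prog :=
  .seq detectProg <| .ite (.le (.const 1) (.var 15)) .skip <|
  .seq (searchProg P countTest) <| .seq (.ask 4 0) (.pushQ 0 0 4)

variable {D : FeedbackGraph V}

/-! ### Candidates that are consistent with all responses -/

open Classical in
/-- The models in `S₀` that are consistent with all responses in `Q`. -/
def candidates (D : FeedbackGraph V) (S₀ : Finset V) (Q : List (Response V)) : Finset V :=
  S₀.filter fun s => ∀ r ∈ Q, s ∈ D.reach r.1 r.2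

open Classical in
lemma weight_one (S₀ : Finset V) (Q : List (Response V)) :
    D.weight 1 S₀ Q = fun s => if s ∈ candidates D S₀ Q then 1 else 0 := by
  funext s
  simp only [FeedbackGraph.weight, candidates, Finset.mem_filter, sub_self, ite_and]
  split_ifs with h1 h2
  · refine List.prod_eq_one fun x hx => ?_
    obtain ⟨r, hr, rfl⟩ := List.mem_map.1 hx
    rw [if_pos (h2 r hr)]
  · push Not at h2
    obtain ⟨r, hr, hs⟩ := h2
    exact List.prod_eq_zero (List.mem_map.2 ⟨r, hr, by rw [if_neg hs]⟩)
  · rfl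

open Classical in
lemma candidates_concat (S₀ : Finset V) (Q : List (Response V)) (s s' : V) :
    candidates D S₀ (Q ++ [(s, s')]) = (candidates D S₀ Q).filter (· ∈ D.reach s s') := by
  ext t
  simp [candidates, or_imp, forall_and, and_assoc]

/-- The response is correct for the given ground truth. -/
def CorrectResponse (D : FeedbackGraph V) (target s s' : V) : Prop :=
  (s = target ∧ s' = s) ∨ (s ≠ target ∧ D.G.Adj s s' ∧ D.OnShortestPath s s' target)

lemma CorrectResponse.allowed {target s s' : V} (h : CorrectResponse D target s s') :
    D.Allowed s s' := h.imp (fun h => h.2) fun h => h.2.1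

lemma CorrectResponse.mem_reach {target s s' : V} (h : CorrectResponse D target s s') :
    target ∈ D.reach s s' := by
  rcases h with ⟨rfl, rfl⟩ | ⟨-, h1, h2⟩
  · exact FeedbackGraph.mem_reach_self.2 rfl
  · exact Or.inr ⟨h1.ne', h2⟩

variable [Fintype V]

/-! ### One round without feedback errors, and how it shrinks the candidate set. -/

open Classical in
lemma swp_noiselessStep {P : Polynomial ℕ} {n X : ℕ} {σ : State V}
    (hR : O.Ready D B) (hD : D.Bounded P n) (hn : n ≤ X) (hB : P.eval X * X + 1 ≤ B)
    (hX : σ.nat 10 = X) (hl : (σ.lst 0).length ≤ B) (hl0 : 0 < (σ.lst 0).length)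
    (hQ : (σ.resp 0).length + 1 ≤ B) (h15 : σ.nat 15 = 0) :
    swp O U B (noiselessStep P) (fun τ =>
      (1 ≤ τ.nat 15 ∧ τ.resp 0 = σ.resp 0 ∧ τ.hist = σ.hist ∧
        3 * (σ.lst 0).length < 4 * (σ.lst 0).count (τ.mdl 0)) ∨
      (τ.nat 15 = 0 ∧ (∀ s, 4 * (σ.lst 0).count s ≤ 3 * (σ.lst 0).length) ∧
        ∃ s s', τ.resp 0 = σ.resp 0 ++ [(s, s')] ∧ τ.hist = σ.hist ++ [(s, s')] ∧
          s' ∈ (U σ.hist s).support ∧ ∀ s', D.G.Adj s s' →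
            2 * X * D.mass (freq (σ.lst 0)) s s' ≤ ((X : ℝ) + 1) * (σ.lst 0).length)) σ := by
  refine swp_call (c := detectProg) (swp_detectProg hl hR.one_le h15) fun τ hF hτ => ?_
  have eh : τ.hist = σ.hist := hF.hist rfl
  have eq : τ.resp 0 = σ.resp 0 := hF.resp 0 rfl
  have el : τ.lst 0 = σ.lst 0 := hF.lst 0 rfl
  refine ⟨fun h => Or.inl ?_, fun h => ?_⟩
  · have h : 1 ≤ τ.nat 15 := h
    rcases hτ with hτ | hτ
    · exact ⟨h, eq, eh, hτ.2⟩
    · omega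
  · have h : ¬ 1 ≤ τ.nat 15 := h
    replace hτ := hτ.resolve_left fun hh => h hh.1
    refine swp_call (c := searchProg P countTest) (swp_searchProg_countTest hR hD hn hB
      (by rw [hF.nat 10 rfl, hX]) (by rwa [el]) (by rwa [el])) fun ρ hFρ hρ => ?_
    rw [el] at hρ
    have e15 : ρ.nat 15 = τ.nat 15 := hFρ.nat 15 rfl
    have eh' : ρ.hist = σ.hist := (hFρ.hist rfl).trans eh
    have eq' : ρ.resp 0 = σ.resp 0 := (hFρ.resp 0 rfl).trans eq
    intro s' hs'
    rw [eh'] at hs'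
    refine ⟨by simpa [eq'] using hQ, Or.inr ⟨by simpa [e15] using hτ.1, hτ.2, ρ.mdl 0, s', ?_, ?_,
      hs', hρ⟩⟩
    · simp [eq']
    · simp [eh']

open Classical in
lemma sum_weight_one (S₀ : Finset V) (Q : List (Response V)) :
    ∑ t, D.weight 1 S₀ Q t = (candidates D S₀ Q).card := by
  rw [weight_one]
  simp

/-- Executions of the algorithm for the remaining candidates extend `Q` to executions. -/
def NoiselessPrefix (D : FeedbackGraph V) (β : ℝ) (S₀ : Finset V) (Q : List (Response V)) : Prop :=
  ∀ h out, IsNoiselessRun D β (candidates D S₀ Q) h out → IsNoiselessRun D β S₀ (Q ++ h) out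

lemma NoiselessPrefix.nil (β : ℝ) (S₀ : Finset V) : NoiselessPrefix D β S₀ [] := by
  intro h out hr
  simpa [candidates] using hr

lemma NoiselessPrefix.concat {β : ℝ} {S₀ : Finset V} {Q : List (Response V)} {s s' : V}
    (h : NoiselessPrefix D β S₀ Q) (hc : 1 < (candidates D S₀ Q).card)
    (hs : D.potential (D.weight 1 S₀ Q) s ≤ β) : NoiselessPrefix D β S₀ (Q ++ [(s, s')]) := by
  intro h' out hr
  rw [List.append_assoc, List.singleton_append]
  refine h _ _ ⟨hc, ?_, ?_⟩
  · rwa [weight_one] at hs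
  · rwa [candidates_concat] at hr

-- The potential limits only answers along edges; a confirmation leaves at most one candidate,
-- possibly more than β times their number. Counting candidates minus one covers both cases: after a
-- confirmation this is at most 0, and otherwise βc - 1 ≤ β(c - 1) as β ≤ 1.
open Classical in
lemma card_candidates_concat_le {β : ℝ} (hβ : 0 ≤ β) (hβ1 : β ≤ 1) {S₀ : Finset V}
    {Q : List (Response V)} {target s s' : V} (hc : 0 < (candidates D S₀ Q).card)
    (h : CorrectResponse D target s s') (hs : D.potential (D.weight 1 S₀ Q) s ≤ β) :
    ((candidates D S₀ (Q ++ [(s, s')])).card : ℝ) - 1 ≤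
      β * ((candidates D S₀ Q).card - 1) := by
  have hc' : (1 : ℝ) ≤ (candidates D S₀ Q).card := by exact_mod_cast hc
  rcases h with ⟨rfl, rfl⟩ | ⟨-, hadj, -⟩
  · have h1 : (candidates D S₀ (Q ++ [(s', s')])).card ≤ 1 := by
      rw [candidates_concat, Finset.card_le_one]
      intro a ha b hb
      rw [Finset.mem_filter, FeedbackGraph.mem_reach_self] at ha hb
      rw [ha.2, hb.2]
    have h2 : ((candidates D S₀ (Q ++ [(s', s')])).card : ℝ) ≤ 1 := by exact_mod_cast h1
    nlinarith
  · have h1 := FeedbackGraph.mass_le_of_potential_le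
      (by rw [sum_weight_one]; exact_mod_cast hc) hs hadj
    have h2 : D.mass (D.weight 1 S₀ Q) s s' = (candidates D S₀ (Q ++ [(s, s')])).card := by
      rw [FeedbackGraph.mass, weight_one, candidates_concat, Finset.sum_ite_mem, Finset.sum_const,
        nsmul_one]
      congr 2
      ext t
      simp [and_comm]
    rw [h2, sum_weight_one] at h1
    linarith

open Classical in
/-- Accurate samples tell whether there is only one candidate left. -/
lemma Accurate.candidates_iff {S₀ : Finset V} {Q : List (Response V)} {μ : PMF V} {E : ℕ}
    {ls : List V} {Δ : ℝ} (h : Accurate D μ E ls) (hE : 1 < (1 / 4 - Δ) * E)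
    (hl : 0 < ls.length) (hc : 0 < (candidates D S₀ Q).card)
    (htv : tvDist (D.weight 1 S₀ Q) μ ≤ Δ) (s : V) :
    3 * ls.length < 4 * ls.count s ↔ candidates D S₀ Q = {s} := by
  have hE0 : (0 : ℝ) ≤ E := Nat.cast_nonneg E
  have hl' : (0 : ℝ) < ls.length := by exact_mod_cast hl
  have h1 := h.count s
  have h2 := tvDist_apply (by rw [sum_weight_one]; exact_mod_cast hc) htv s
  rw [sum_weight_one, weight_one] at h2
  set q := (μ s).toReal
  have key : (3 * ls.length < 4 * ls.count s) ↔ (3 * ls.length : ℝ) < 4 * ls.count s := by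
    norm_cast
  -- The sampling error 1/E is smaller than 1/4 - Δ, which is the distance of the threshold 3/4 from
  -- both 1/2 + Δ and 1 - Δ.
  have h3 : ∀ x : ℝ, |x| * E ≤ ls.length → |x| < (1 / 4 - Δ) * ls.length := by
    intro x hx
    have h4 : 0 < (E : ℝ) := by
      rcases hE0.lt_or_eq with h | h
      · exact h
      · rw [← h] at hE; linarith
    nlinarith
  have h4 := abs_lt.1 (h3 _ h1)
  rw [key]
  constructor
  · intro hlt
    by_contra hne
    -- If {s} is not the whole set, then s is no candidate or has at least one rival, so its share
    -- is at most 1/2.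
    have h5 : (if s ∈ candidates D S₀ Q then (1 : ℝ) else 0) / (candidates D S₀ Q).card ≤ 1 / 2 := by
      split_ifs with hs
      · have : 1 < (candidates D S₀ Q).card := by
          by_contra hle
          obtain ⟨t, ht⟩ := Finset.card_eq_one.1 (by omega : (candidates D S₀ Q).card = 1)
          rw [ht, Finset.mem_singleton] at hs
          exact hne (by rw [ht, hs])
        have : (2 : ℝ) ≤ (candidates D S₀ Q).card := by exact_mod_cast this
        exact one_div_le_one_div_of_le (by norm_num) this
      · norm_num
    have h6 := (abs_le.1 h2).1
    have h7 : q ≤ 1 / 2 + Δ := by linarith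
    have h8 := mul_le_mul_of_nonneg_right h7 hl'.le
    linarith
  · intro heq
    rw [heq] at h2
    simp only [Finset.mem_singleton, if_true, Finset.card_singleton, Nat.cast_one, div_one] at h2
    have h6 := (abs_le.1 h2).2
    have h7 : 1 - Δ ≤ q := by linarith
    have h8 := mul_le_mul_of_nonneg_right h7 hl'.le
    linarith

end

end InteractiveLearning

/-! ### The learner without feedback errors. -/

namespace InteractiveLearning

noncomputable section

/-- The union bound over T rounds with error 2^(-(X+T)) each: the number of rounds is absorbed by T
≤ 2^T. -/
lemma half_pow_mul_le (T X k : ℕ) (h : k ≤ X) :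
    (T : ℝ≥0∞) * (1 / 2) ^ (X + T) ≤ (1 / 2) ^ k := by
  have h1 : (1 / 2 : ℝ≥0∞) ≤ 1 := by rw [one_div]; exact ENNReal.inv_le_one.2 (by norm_num)
  have h2 : (T : ℝ≥0∞) ≤ 2 ^ T := by exact_mod_cast Nat.lt_two_pow_self.le
  calc (T : ℝ≥0∞) * (1 / 2) ^ (X + T) ≤ 2 ^ T * (1 / 2) ^ (X + T) := by gcongr
    _ = (2 * (1 / 2)) ^ T * (1 / 2) ^ X := by rw [mul_pow, pow_add]; ring
    _ = (1 / 2) ^ X := by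
        rw [one_div, ENNReal.mul_inv_cancel (by norm_num) (by norm_num), one_pow, one_mul]
    _ ≤ (1 / 2) ^ k := pow_le_pow_right_of_le_one' h1 h

open Polynomial in
/-- A sufficient number of rounds, if each of them removes a fraction `1 / C` of the candidates. -/
def noiselessRounds (P : Polynomial ℕ) (C : ℕ) : Polynomial ℕ := C * (P + 1) + 1

/-- Since (1 - 1/C)^C ≤ exp(-1) ≤ 1/2, every C rounds halve the bound, and b + 1 halvings push N ≤
2^b below 1. -/
lemma pow_mul_card_lt_one {C b N : ℕ} (hC : 1 ≤ C) (hN : N ≤ 2 ^ b) {β : ℝ} (hβ0 : 0 ≤ β)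
    (hβ : β ≤ 1 - 1 / C) : β ^ (C * (b + 1)) * N < 1 := by
  have hC0 : (0 : ℝ) < C := by exact_mod_cast hC
  have h1 : β ^ C ≤ 1 / 2 := by
    calc β ^ C ≤ Real.exp (-(1 / C)) ^ C := by
          gcongr
          linarith [Real.add_one_le_exp (-(1 / C : ℝ))]
      _ = Real.exp (-1) := by rw [← Real.exp_nat_mul]; congr 1; field_simp
      _ ≤ 1 / 2 := by
          rw [Real.exp_neg, one_div]
          exact inv_anti₀ (by norm_num) (by linarith [Real.add_one_le_exp 1])
  have h2 : (N : ℝ) ≤ 2 ^ b := by exact_mod_cast hN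
  calc β ^ (C * (b + 1)) * N ≤ (1 / 2) ^ (b + 1) * 2 ^ b := by
        rw [pow_mul]
        gcongr
    _ = 1 / 2 := by rw [pow_succ, one_div_pow]; field_simp
    _ < 1 := by norm_num

open Polynomial in
/-- The accuracy `1 / (C * X)`, with error probability at most `2 ^ (-k)` over all rounds. -/
def noiselessSamples (P : Polynomial ℕ) (C : ℕ) : Polynomial ℕ :=
  sampleSize P ((C : ℕ[X]) * X) (X + noiselessRounds P C)

/-- Learning without feedback errors. -/
def noiselessProg (P : Polynomial ℕ) (C : ℕ) : Prog :=
  .seq (.setN 10 (.add (.add (.var 0) (.var 1)) (.var 2))) <|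
  .seq (.setN 15 (.const 0)) <|
  .loop (.poly (noiselessRounds P C)) <| .ite (.le (.const 1) (.var 15)) .skip <|
    .seq (drawProg (noiselessSamples P C)) (noiselessStep P)

/-- The sure invariant of `noiselessProg`. -/
structure NoiselessInv {V : Type} (D : FeedbackGraph V) (target : V) (X i : ℕ) (σ : State V) :
    Prop where
  input : σ.nat 10 = X
  hist : σ.hist = σ.resp 0
  correct : ∀ r ∈ σ.resp 0, CorrectResponse D target r.1 r.2
  length : (σ.resp 0).length ≤ i
  flag : ¬ 1 ≤ σ.nat 15 → σ.nat 15 = 0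

open Classical in
/-- The invariant of `noiselessProg` that holds if all samples are accurate. -/
structure NoiselessGood {V : Type} [Fintype V] (D : FeedbackGraph V) (S₀ : Finset V) (β : ℝ)
    (i : ℕ) (σ : State V) : Prop where
  done : 1 ≤ σ.nat 15 → IsNoiselessRun D β S₀ (σ.resp 0) (σ.mdl 0)
  pre : ¬ 1 ≤ σ.nat 15 → NoiselessPrefix D β S₀ (σ.resp 0)
  card : ¬ 1 ≤ σ.nat 15 → ((candidates D S₀ (σ.resp 0)).card : ℝ) - 1 ≤ β ^ i * Fintype.card V
  card' : ¬ 1 ≤ σ.nat 15 → ∀ j, i = j + 1 → (1 : ℝ) ≤ β ^ j * Fintype.card V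

/-- As long as samples are accurate, each round either detects the last candidate or asks a query
that shrinks the candidate set by the factor β; the number of rounds excludes that detection never
happens. A correct user never eliminates the target, so the likelihoods always have positive sum and
the oracle guarantee applies. -/
lemma exists_noiselessProg (Δ : ℝ) (hΔ₀ : 0 ≤ Δ) (hΔ : Δ < 1 / 4) (P : Polynomial ℕ) :
    ∃ ε₀ : ℝ, 0 < ε₀ ∧ ∃ (c : Prog) (R : Polynomial ℕ), c.RealFree ∧
      ∀ (V : Type) [Fintype V] (D : FeedbackGraph V) (O : Oracles V) (S₀ : Finset V) (n : ℕ),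
        D.Bounded P n → O.Correct D S₀ 1 Δ P n →
        ∀ (ε : ℝ), 0 < ε → ε ≤ ε₀ → ∀ (k : ℕ) (target : V), target ∈ S₀ →
          ∀ U : User V, U.IsCorrect D target → ∀ v₀ : V,
          (∀ σ ∈ (c.run O U (State.initial [n, ⌈1 / ε⌉₊, k] [] [] v₀)).support,
            σ.time ≤ R.eval (n + ⌈1 / ε⌉₊ + k)) ∧
          (c.run O U (State.initial [n, ⌈1 / ε⌉₊, k] [] [] v₀)).toOuterMeasure
            {σ | ¬ IsNoiselessRun D (1 / 2 + 2 * Δ + ε) S₀ σ.hist (σ.mdl 0)} ≤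
              (1 / 2 : ℝ≥0∞) ^ k := by
  -- The constant has two uses. For ε ≤ 1/4 - Δ it gives β ≤ 3/4 + Δ ≤ 1 - 1/C, hence geometric
  -- progress; and accuracy 1/(CX) is finer than 1/4 - Δ, as the stopping test requires.
  obtain ⟨C, hC⟩ := exists_nat_gt (1 / (1 / 4 - Δ))
  have hρ : 0 < 1 / 4 - Δ := by linarith
  have hCρ : 1 < (1 / 4 - Δ) * C := by rwa [div_lt_iff₀ hρ, mul_comm] at hC
  have hC4 : 4 < C := by
    have : (4 : ℝ) < C := by nlinarith
    exact_mod_cast this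
  have hC1 : 1 / (C : ℝ) ≤ 1 / 4 - Δ := by
    rw [div_le_iff₀ (by positivity)]; linarith
  obtain ⟨R, hR⟩ := (noiselessProg P C).exists_timeBound_eq_eval
  set L := noiselessSamples P C with hL
  set T := noiselessRounds P C with hT
  set BP : Polynomial ℕ := L + P * Polynomial.X + P.comp (Polynomial.X + T + 1) + Polynomial.X +
    T + 1 with hBP
  refine ⟨1 / 4 - Δ, hρ, noiselessProg P C, R.comp BP, ?_, ?_⟩
  · simp [noiselessProg, noiselessStep, detectProg, occProg, drawProg, searchProg, countTest,
      Prog.RealFree, BExp.RealFree]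
  intro V _ D O S₀ n hD hO ε hε hε₀ k target htar U hU v₀
  set m := ⌈1 / ε⌉₊ with hm
  have hm1 : 1 ≤ m := Nat.one_le_ceil_iff.2 (by positivity)
  set X := n + m + k with hX
  set β := 1 / 2 + 2 * Δ + ε with hβ
  have hβ0 : 0 ≤ β := by positivity
  have hβC : β ≤ 1 - 1 / C := by linarith
  have hβ1 : β ≤ 1 := by
    have : (0 : ℝ) ≤ 1 / C := by positivity
    linarith
  set B := BP.eval X with hB
  have hTe : T.eval X = C * (P.eval X + 1) + 1 := by simp [hT, noiselessRounds]
  have hBe : B = L.eval X + P.eval X * X + P.eval (X + T.eval X + 1) + X + T.eval X + 1 := by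
    simp [hB, hBP]
  have hPn : P.eval n ≤ P.eval (X + T.eval X + 1) := polynomial_eval_mono P (by omega)
  have hbits : Nat.clog 2 (Fintype.card V) ≤ B := hD.clog_le.trans (by omega)
  have hr : O.Ready D B := hO.ready hD
    ((polynomial_eval_mono P (by omega : n + 1 ≤ X + T.eval X + 1)).trans (by omega)) (by omega)
  have hE : ((C : Polynomial ℕ) * Polynomial.X).eval X = C * X := by simp
  have hE1 : 2 * X ≤ C * X := Nat.mul_le_mul_right _ (by omega)
  have hE2 : 1 < (1 / 4 - Δ) * ((C * X : ℕ) : ℝ) := by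
    have : (1 : ℝ) ≤ X := by exact_mod_cast (by omega : 1 ≤ X)
    push_cast
    nlinarith
  have hL0 : 0 < L.eval X := one_le_sampleSize_eval (by rw [hE]; omega)
  have hεX : 1 / (X : ℝ) ≤ ε := by
    have h1 : 1 / ε ≤ m := Nat.le_ceil _
    have h2 : (m : ℝ) ≤ X := by exact_mod_cast (by omega : m ≤ X)
    rw [div_le_iff₀ (by positivity)] at h1
    rw [div_le_iff₀ (by exact_mod_cast (by omega : 0 < X))]
    nlinarith
  have hvalid : ∀ Q, (∀ r ∈ Q, CorrectResponse D target r.1 r.2) → D.ValidResponses Q :=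
    fun Q h r hr => (h r hr).allowed
  have hcand : ∀ Q, (∀ r ∈ Q, CorrectResponse D target r.1 r.2) →
      0 < (candidates D S₀ Q).card := fun Q h => Finset.card_pos.2
    ⟨target, by
      simp only [candidates, Finset.mem_filter]
      exact ⟨htar, fun r hr => (h r hr).mem_reach⟩⟩
  have hstep : ∀ i < T.eval X, ∀ σ, NoiselessInv D target X i σ → ¬ 1 ≤ σ.nat 15 →
      (σ.lst 0).length = L.eval X →
      swp O U B (noiselessStep P) (fun τ => NoiselessInv D target X (i + 1) τ ∧
        (NoiselessGood D S₀ β i σ → Accurate D (O.sample (σ.resp 0)) (C * X) (σ.lst 0) →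
          NoiselessGood D S₀ β (i + 1) τ)) σ := by
    classical
    intro i hi σ hσ hf hlen
    have hQ := hσ.length
    have hc := hcand _ hσ.correct
    refine swp_call (swp_noiselessStep hr hD (by omega : n ≤ X) (by omega) hσ.input (by omega)
      (by omega) (by omega) (hσ.flag hf)) fun τ hF hτ => ?_
    have e10 : τ.nat 10 = X := by rw [hF.nat 10 rfl, hσ.input]
    have hpos : 0 < ∑ t, D.weight 1 S₀ (σ.resp 0) t := by
      rw [sum_weight_one]; exact_mod_cast hc
    have hclose := hO.sample_close _ (hvalid _ hσ.correct) hpos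
    rcases hτ with ⟨h15, hq, hh, hd⟩ | ⟨h15, hnd, s, s', hq, hh, hs', hopt⟩
    · refine ⟨⟨e10, by rw [hq, hh, hσ.hist], by rw [hq]; exact hσ.correct, by rw [hq]; omega,
        fun h => absurd h15 h⟩, fun hg hacc => ⟨fun _ => ?_, fun h => absurd h15 h,
        fun h => absurd h15 h, fun h => absurd h15 h⟩⟩
      -- The detected model is the only candidate left, so the empty continuation completes the
      -- execution.
      rw [hacc.candidates_iff hE2 (by omega) hc hclose] at hd
      have := hg.pre hf [] (τ.mdl 0) hd
      rwa [hq, ← List.append_nil (σ.resp 0)]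
    · have hcor : CorrectResponse D target s s' := hU _ _ _ hs'
      refine ⟨⟨e10, by rw [hq, hh, hσ.hist], ?_, by rw [hq]; simpa using hQ, fun _ => h15⟩,
        fun hg hacc => ?_⟩
      · rw [hq]
        intro r hr
        rcases List.mem_append.1 hr with hr | hr
        · exact hσ.correct r hr
        · rw [List.mem_singleton.1 hr]; exact hcor
      -- A single candidate would have been detected, so asking a query is what the algorithm does
      -- here.
      · have hc1 : 1 < (candidates D S₀ (σ.resp 0)).card := by
          by_contra hle
          obtain ⟨t, ht⟩ := Finset.card_eq_one.1
            (by omega : (candidates D S₀ (σ.resp 0)).card = 1)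
          rw [← hacc.candidates_iff hE2 (by omega) hc hclose] at ht
          have := hnd t
          omega
        have hpot : D.potential (D.weight 1 S₀ (σ.resp 0)) s ≤ β :=
          hacc.potential_le (by omega) hE1 (by omega) hpos hclose (by linarith) hopt
        have hc1' : (2 : ℝ) ≤ (candidates D S₀ (σ.resp 0)).card := by exact_mod_cast hc1
        have hcard := hg.card hf
        refine ⟨fun h => by omega, fun _ => ?_, fun _ => ?_, fun _ j hj => ?_⟩
        · rw [hq]
          exact (hg.pre hf).concat hc1 hpot
        · rw [hq, pow_succ', mul_assoc]
          exact (card_candidates_concat_le hβ0 hβ1 hc hcor hpot).trans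
            (mul_le_mul_of_nonneg_left hcard hβ0)
        -- At least two candidates before the query of round i force β^i N ≥ 1. This is what
        -- contradicts too many rounds without detection.
        · obtain rfl : i = j := by omega
          linarith
  have key : HT O U B (fun σ => σ = State.initial [n, m, k] [] [] v₀) (fun _ => True)
      (noiselessProg P C) (NoiselessInv D target X (T.eval X))
      (NoiselessGood D S₀ β (T.eval X))
      (0 + (0 + (T.eval X : ℕ) * (1 / 2) ^ (Polynomial.X + T : Polynomial ℕ).eval X)) := by
    refine HT.seq (S' := fun σ => σ.nat 10 = X ∧ σ.resp 0 = [] ∧ σ.hist = [])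
      (G' := fun _ => True) (HT.of_swp hbits ?_ ?_)
      (HT.seq (S' := NoiselessInv D target X 0) (G' := NoiselessGood D S₀ β 0)
        (HT.of_swp hbits ?_ ?_) (HT.loop ?_ (by omega) fun i hi => HT.ite hbits ?_ ?_))
    · rintro σ rfl
      refine ⟨?_, ?_, rfl, rfl⟩
      · simp only [NExp.eval, State.initial, List.getD_cons_zero, List.getD_cons_succ]
        omega
      · simp [NExp.eval, State.initial, hX]
    · rintro σ rfl -
      refine ⟨?_, trivial⟩
      simp only [NExp.eval, State.initial, List.getD_cons_zero, List.getD_cons_succ]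
      omega
    · rintro σ ⟨h1, h2, h3⟩
      exact ⟨Nat.zero_le _, ⟨by simpa using h1, by simp [h2, h3], by simp [h2], by simp [h2],
        fun _ => by simp [NExp.eval]⟩⟩
    · rintro σ ⟨h1, h2, h3⟩ -
      refine ⟨Nat.zero_le _, ⟨fun h => by simp [NExp.eval] at h, fun _ => ?_, fun _ => ?_,
        fun _ j hj => by omega⟩⟩
      · simp only [State.resp_setNat, h2]
        exact NoiselessPrefix.nil _ _
      · have : (candidates D S₀ ((σ.setNat 15 (NExp.eval σ (.const 0))).resp 0)).card ≤
          Fintype.card V := Finset.card_le_univ _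
        have : ((candidates D S₀ ((σ.setNat 15 (NExp.eval σ (.const 0))).resp 0)).card : ℝ) ≤
          Fintype.card V := by exact_mod_cast this
        rw [pow_zero, one_mul]
        linarith
    · intro σ h
      rw [NExp.eval_poly, h.input]
    · refine (HT.of_swp hbits ?_ ?_).mono zero_le
      · rintro σ ⟨hσ, -⟩
        exact ⟨hσ.input, hσ.hist, hσ.correct, hσ.length.trans (Nat.le_succ _), hσ.flag⟩
      · rintro σ ⟨hσ, hb⟩ hg
        have hb : 1 ≤ σ.nat 15 := hb
        exact ⟨hg.done, fun h => absurd hb h, fun h => absurd hb h, fun h => absurd hb h⟩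
    · rw [← add_zero ((1 / 2 : ℝ≥0∞) ^ (Polynomial.X + T : Polynomial ℕ).eval X)]
      refine HT.seq (S' := fun σ => NoiselessInv D target X i σ ∧ ¬ 1 ≤ σ.nat 15 ∧
          (σ.lst 0).length = L.eval X)
        (G' := fun σ => NoiselessGood D S₀ β i σ ∧
          Accurate D (O.sample (σ.resp 0)) (C * X) (σ.lst 0)) ?_ (HT.of_swp hbits ?_ ?_)
      · refine HT.draw hbits hD (by omega) (by change L.eval X ≤ B; omega) (by rw [hE]; omega)
          (fun σ h => h.1.input) ?_ ?_ ?_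
        · intro σ h
          have := h.1.length
          refine (hO.sample_time _ (hvalid _ h.1.correct)).trans ((polynomial_eval_mono P
            (by omega : n + (σ.resp 0).length ≤ X + T.eval X + 1)).trans (by omega))
        · rintro σ τ ⟨h, hb⟩ hF hlen
          have e15 : τ.nat 15 = σ.nat 15 := hF.nat 15 rfl
          refine ⟨⟨by rw [hF.nat 10 rfl, h.input], ?_, ?_, ?_, ?_⟩, ?_, hlen⟩
          · rw [hF.hist rfl, hF.resp 0 rfl, h.hist]
          · rw [hF.resp 0 rfl]; exact h.correct
          · rw [hF.resp 0 rfl]; exact h.length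
          · rw [e15]; exact h.flag
          · rw [e15]; exact hb
        · rintro σ τ ⟨h, hb⟩ hg hF hlen hacc
          have hb : ¬ 1 ≤ σ.nat 15 := hb
          have e15 : τ.nat 15 = σ.nat 15 := hF.nat 15 rfl
          rw [hE] at hacc
          have eq : τ.resp 0 = σ.resp 0 := hF.resp 0 rfl
          refine ⟨⟨fun h => absurd h (by rwa [e15]), fun _ => ?_, fun _ => ?_, fun _ => ?_⟩, hacc⟩
          · rw [eq]; exact hg.pre hb
          · rw [eq]; exact hg.card hb
          · exact hg.card' hb
      · rintro σ ⟨h, hf, hlen⟩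
        exact swp_mono (hstep i hi σ h hf hlen) fun τ hτ => hτ.1
      · rintro σ ⟨h, hf, hlen⟩ ⟨hg, hacc⟩
        exact swp_mono (hstep i hi σ h hf hlen) fun τ hτ => hτ.2 hg hacc
  obtain ⟨h1, h2⟩ := key (State.initial [n, m, k] [] [] v₀)
    (State.initial_bounded (fun x hx => (Nat_size_le_self x).trans (by
      simp only [List.mem_cons, List.not_mem_nil, or_false] at hx; omega)) (by simp)) rfl
  refine ⟨fun τ hτ => ?_, ?_⟩
  · obtain ⟨-, -, h4⟩ := h1 τ hτ
    refine h4.trans ?_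
    rw [hR, Polynomial.eval_comp, ← hB]
    simp [State.initial]
  · refine le_trans (PMF.toOuterMeasure_mono _ ?_) ((h2 trivial).trans ?_)
    · rintro τ ⟨hbad, hτ⟩ hg
      have hinv := (h1 τ hτ).1
      refine hbad ?_
      by_cases hf : 1 ≤ τ.nat 15
      · have := hg.done hf
        rw [← hinv.hist] at this
        exact this
      -- The additional round in T makes the exponent here exactly C (P(X) + 1).
      · have h3 := hg.card' hf _ hTe
        have h4 := pow_mul_card_lt_one (by omega : 1 ≤ C) (hD.card_le.trans
          (Nat.pow_le_pow_right (by norm_num) (polynomial_eval_mono P (by omega : n ≤ X))))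
          hβ0 hβC
        linarith
    · rw [Polynomial.eval_add, Polynomial.eval_X, zero_add, zero_add]
      exact half_pow_mul_le _ _ _ (by omega)

end

end InteractiveLearning

namespace InteractiveLearning

noncomputable section

/-! ## The numbers of rounds of learning with imperfect feedback -/

lemma tau_eq (p β : ℝ) : tau p β = (1 - p) + β * (2 * p - 1) := by
  rw [tau]; ring

lemma one_sub_le_tau {p β : ℝ} (hp : 1 / 2 < p) (hβ : 0 ≤ β) : 1 - p ≤ tau p β := by
  rw [tau_eq]; nlinarith

/-- The gap is continuous in ε at 0, so near 0 it is at least half its limit. A lower bound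
independent of ε is needed, as the gap occurs in denominators of the round numbers. -/
lemma exists_gap_bound {p b : ℝ} (hp : 1 / 2 < p) (hp1 : p < 1) (hb : 0 ≤ b)
    (hgap : 0 < gap p (tau p b)) :
    ∃ ε₀ : ℝ, 0 < ε₀ ∧ ∃ g : ℝ, 0 < g ∧ ∀ ε, 0 < ε → ε ≤ ε₀ → g ≤ gap p (tau p (b + ε)) := by
  have hτ : 0 < tau p b := lt_of_lt_of_le (by linarith) (one_sub_le_tau hp hb)
  have hcont : ContinuousAt (fun ε => gap p (tau p (b + ε))) 0 := by
    have h0 : tau p (b + 0) ≠ 0 := by rw [add_zero]; exact hτ.ne'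
    have h1 : ContinuousAt (fun ε => tau p (b + ε)) 0 := by
      simp only [tau_eq]; fun_prop
    have h2 : ContinuousAt (fun ε => 1 / tau p (b + ε)) 0 := continuousAt_const.div h1 h0
    simp only [gap, Real.logb]
    exact ((h2.log (one_div_ne_zero h0)).div_const _).sub continuousAt_const
  have h0 : gap p (tau p b) / 2 < gap p (tau p (b + 0)) := by rw [add_zero]; linarith
  obtain ⟨r, hr, h⟩ := Metric.eventually_nhds_iff.1
    (hcont.eventually_const_lt h0)
  refine ⟨r / 2, by positivity, gap p (tau p b) / 2, by positivity, fun ε h1 h2 => (h ?_).le⟩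
  rw [Real.dist_eq, sub_zero, abs_of_pos h1]
  linarith

lemma log_le_logb_two {x : ℝ} (hx : 1 ≤ x) : Real.log x ≤ Real.logb 2 x := by
  rw [Real.logb, le_div_iff₀ (Real.log_pos (by norm_num))]
  have h1 := Real.log_nonneg hx
  have h2 : Real.log 2 ≤ 1 := by linarith [Real.log_two_lt_d9]
  nlinarith

lemma logb_two_le_self {x : ℝ} (hx : 1 ≤ x) : Real.logb 2 x ≤ x := by
  rw [Real.logb, div_le_iff₀ (Real.log_pos (by norm_num))]
  have h1 : Real.log (x / 2) ≤ x / 2 - 1 := Real.log_le_sub_one_of_pos (by positivity)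
  rw [Real.log_div (by positivity) (by norm_num)] at h1
  have h2 := Real.log_two_gt_d9
  have h3 := Real.log_two_lt_d9
  nlinarith

lemma log_five_le : Real.log 5 ≤ 2 := by
  rw [Real.log_le_iff_le_exp (by norm_num)]
  have h1 := Real.exp_one_gt_d9
  have h2 : Real.exp 2 = Real.exp 1 * Real.exp 1 := by rw [← Real.exp_add]; norm_num
  nlinarith

lemma log_inv_error_le {δ x : ℝ} (hδ : 0 < δ) (hδ1 : δ < 1) (hx : Real.logb 2 (1 / δ) ≤ x) :
    Real.log (1 / (δ / 5)) ≤ 2 + x := by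
  have h1 : 1 / (δ / 5) = 5 * (1 / δ) := by field_simp
  rw [h1, Real.log_mul (by norm_num) (by positivity)]
  have h2 : 1 ≤ 1 / δ := by rw [le_div_iff₀ hδ]; linarith
  linarith [log_five_le, log_le_logb_two h2]

/-- For λ ≤ λ₂ the denominator gap - λℓ is at least half the gap, by the choice of λ₂. The second
quotient is bounded because 1/δ' > 5 makes its denominator at least 1 and τ ≥ 1 - p bounds its
numerator. -/
lemma rounds_le {p τ δ lam g ci x y : ℝ} {N : ℕ} (hp : 1 / 2 < p) (hp1 : p < 1) (hδ : 0 < δ)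
    (hδ1 : δ < 1) (hτ : 1 - p ≤ τ) (hτ1 : τ ≤ 1) (hg : 0 < g) (hgap : g ≤ gap p τ)
    (hlam : lam ≤ lambda2 p τ) (hci : 1 / lam ^ 2 ≤ ci)
    (hx : Real.logb 2 (1 / δ) ≤ x) (hy : Real.logb 2 N ≤ y) (hN : 1 ≤ N) :
    rounds p τ (δ / 5) lam N ≤
      2 / g * y + Real.logb 2 (1 / (1 - p)) + (2 + x) * ci + 1 := by
  have hq : 0 < 1 - p := by linarith
  have hτ0 : 0 < τ := by linarith
  have hl : 0 < Real.logb 2 (p / (1 - p)) :=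
    Real.logb_pos (by norm_num) (by rw [lt_div_iff₀ hq]; linarith)
  have hy0 : 0 ≤ Real.logb 2 N := Real.logb_nonneg (by norm_num) (by exact_mod_cast hN)
  have hc : 0 ≤ Real.logb 2 (1 / (1 - p)) :=
    Real.logb_nonneg (by norm_num) (by rw [le_div_iff₀ hq]; linarith)
  have hx0 : 0 ≤ Real.logb 2 (1 / δ) :=
    Real.logb_nonneg (by norm_num) (by rw [le_div_iff₀ hδ]; linarith)
  have hci0 : 0 ≤ ci := le_trans (by positivity) hci
  have h1 : Real.logb 2 N / (gap p τ - lam * Real.logb 2 (p / (1 - p))) ≤ 2 / g * y := by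
    have h2 : lam * Real.logb 2 (p / (1 - p)) ≤ gap p τ / 2 := by
      refine (mul_le_mul_of_nonneg_right hlam hl.le).trans (le_of_eq ?_)
      rw [lambda2]; field_simp
    have h3 : g / 2 ≤ gap p τ - lam * Real.logb 2 (p / (1 - p)) := by linarith
    calc _ ≤ Real.logb 2 N / (g / 2) := by gcongr
      _ = 2 / g * Real.logb 2 N := by field_simp
      _ ≤ 2 / g * y := by gcongr
  have h2 : Real.logb 2 (1 / τ) / Real.logb 2 (1 / (δ / 5)) ≤ Real.logb 2 (1 / (1 - p)) := by
    have h3 : 1 ≤ Real.logb 2 (1 / (δ / 5)) := by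
      rw [Real.le_logb_iff_rpow_le (by norm_num) (by positivity), Real.rpow_one,
        le_div_iff₀ (by positivity)]
      linarith
    have h4 : Real.logb 2 (1 / τ) ≤ Real.logb 2 (1 / (1 - p)) :=
      Real.logb_le_logb_of_le (by norm_num) (by positivity) (by gcongr)
    have h5 : 0 ≤ Real.logb 2 (1 / τ) :=
      Real.logb_nonneg (by norm_num) (by rw [le_div_iff₀ hτ0]; linarith)
    exact (div_le_self h5 h3).trans h4
  have h3 : Real.log (1 / (δ / 5)) / lam ^ 2 ≤ (2 + x) * ci := by
    rw [div_eq_mul_one_div]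
    exact mul_le_mul (log_inv_error_le hδ hδ1 hx) hci (by positivity) (by linarith)
  have h4 : 0 ≤ (2 + x) * ci := mul_nonneg (by linarith) hci0
  have h5 : 0 ≤ 2 / g * y := mul_nonneg (by positivity) (by linarith)
  rw [rounds]
  have := max_le (a := Real.logb 2 N / (gap p τ - lam * Real.logb 2 (p / (1 - p))) +
      Real.logb 2 (1 / τ) / Real.logb 2 (1 / (δ / 5)))
    (b := Real.log (1 / (δ / 5)) / lam ^ 2)
    (c := 2 / g * y + Real.logb 2 (1 / (1 - p)) + (2 + x) * ci) (by linarith) (by linarith)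
  linarith

/-- In the branch N > 2 the inverse square of λ₁ is either log log N, which is at most log N, or the
inverse square of λ₂. -/
lemma one_div_lambda1_sq_le {p τ c y : ℝ} {N : ℕ} (hc : 1 / lambda2 p τ ^ 2 ≤ c) (hc0 : 0 ≤ c)
    (hy : Real.logb 2 N ≤ y) (hN : 1 ≤ N) : 1 / lambda1 p τ N ^ 2 ≤ y + c := by
  have hy0 : 0 ≤ Real.logb 2 N := Real.logb_nonneg (by norm_num) (by exact_mod_cast hN)
  rw [lambda1]
  split_ifs with h
  · linarith
  · rcases min_choice (Real.sqrt (1 / Real.logb 2 (Real.logb 2 N))) (lambda2 p τ) with h' | h'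
    · rw [h']
      have h1 : 1 < Real.logb 2 N := by
        rw [Real.lt_logb_iff_rpow_lt (by norm_num) (by positivity), Real.rpow_one]
        exact_mod_cast not_le.1 h
      have h2 : 0 < Real.logb 2 (Real.logb 2 N) := Real.logb_pos (by norm_num) h1
      rw [Real.sq_sqrt (by positivity), one_div_one_div]
      linarith [logb_two_le_self h1.le]
    · rw [h']; linarith

lemma lambda1_le (p τ : ℝ) (N : ℕ) : lambda1 p τ N ≤ lambda2 p τ := by
  rw [lambda1]; split_ifs
  · exact le_rfl
  · exact min_le_right _ _

lemma verification_le {p δ x y : ℝ} {N : ℕ} (hp : 1 / 2 < p) (hδ : 0 < δ)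
    (hδ1 : δ < 1) (hx : Real.logb 2 (1 / δ) ≤ x) (hy : Real.logb 2 N ≤ y) :
    2 * Real.log (N / (δ / 5)) / (2 * p - 1) ^ 2 ≤ 2 / (2 * p - 1) ^ 2 * (y + (2 + x)) := by
  have hx0 : 0 ≤ Real.logb 2 (1 / δ) :=
    Real.logb_nonneg (by norm_num) (by rw [le_div_iff₀ hδ]; linarith)
  have h0 : 0 < 2 * p - 1 := by linarith
  have h1 : Real.log (N / (δ / 5)) ≤ y + (2 + x) := by
    -- With no candidates both logarithms take the default value 0.
    rcases N.eq_zero_or_pos with rfl | hN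
    · simp only [Nat.cast_zero, zero_div, Real.log_zero, Real.logb_zero] at *
      linarith
    · have h2 : (1 : ℝ) ≤ N := by exact_mod_cast hN
      rw [div_eq_mul_one_div, Real.log_mul (by positivity) (by positivity)]
      linarith [log_le_logb_two h2, log_inv_error_le hδ hδ1 hx]
  calc _ = 2 / (2 * p - 1) ^ 2 * Real.log (N / (δ / 5)) := by ring
    _ ≤ _ := by gcongr

open Polynomial in
/-- Polynomial bounds for the numbers of rounds. -/
lemma exists_rounds_bound {p Δ : ℝ} (hp : 1 / 2 < p) (hp1 : p < 1) (hΔ₀ : 0 ≤ Δ) (hΔ : Δ < 1 / 4)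
    (hgap : 0 < gap p (tau p (1 / 2 + 2 * Δ))) (P : Polynomial ℕ) :
    ∃ ε₀ : ℝ, 0 < ε₀ ∧ ε₀ ≤ 1 / 4 ∧ ∃ K : Polynomial ℕ, ∀ (ε δ : ℝ) (X N : ℕ), 0 < ε → ε ≤ ε₀ →
      0 < δ → δ < 1 → Real.logb 2 (1 / δ) ≤ X → Real.logb 2 N ≤ P.eval X →
      (1 ≤ N →
        ⌈rounds p (tau p (1 / 2 + 2 * Δ + ε)) (δ / 5)
          (lambda1 p (tau p (1 / 2 + 2 * Δ + ε)) N) N⌉₊ ≤ K.eval X ∧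
        ⌈rounds p (tau p (1 / 2 + 2 * Δ + ε)) (δ / 5)
          (lambda2 p (tau p (1 / 2 + 2 * Δ + ε))) N⌉₊ ≤ K.eval X) ∧
      ⌈2 * Real.log (N / (δ / 5)) / (2 * p - 1) ^ 2⌉₊ ≤ K.eval X := by
  obtain ⟨ε₁, hε₁, g, hg, hgε⟩ := exists_gap_bound hp hp1 (by positivity) hgap
  set l := Real.logb 2 (p / (1 - p)) with hl
  have hq : 0 < 1 - p := by linarith
  have hl0 : 0 < l := Real.logb_pos (by norm_num) (by rw [lt_div_iff₀ hq]; linarith)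
  -- One integer that dominates all constants depending on p and Δ: the factor 2/g of log N,
  -- log(1/τ), 1/λ₂² and the factor in the number of proposals.
  obtain ⟨c, hc⟩ := exists_nat_ge (max (max (2 / g) (Real.logb 2 (1 / (1 - p))))
    (max ((2 * l / g) ^ 2) (2 / (2 * p - 1) ^ 2)))
  obtain ⟨⟨hc1, hc2⟩, hc3, hc4⟩ := by simpa only [max_le_iff] using hc
  have hc0 : (0 : ℝ) ≤ c := Nat.cast_nonneg c
  -- The bound 1/2 - 2Δ keeps β ≤ 1 and hence τ ≤ 1. The bound 1/4 serves later, to keep the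
  -- threshold for marking by frequencies positive.
  refine ⟨min ε₁ (min (1 / 4) (1 / 2 - 2 * Δ)), by
    refine lt_min hε₁ (lt_min (by norm_num) (by linarith)), (min_le_right _ _).trans
    (min_le_left _ _), (c : ℕ[X]) * P + (c : ℕ[X]) + (2 + X) * (P + (c : ℕ[X])) + 1 +
      (c : ℕ[X]) * (P + (2 + X)), ?_⟩
  intro ε δ x N hε hε₀ hδ hδ1 hx hN
  rw [le_min_iff, le_min_iff] at hε₀
  set τ := tau p (1 / 2 + 2 * Δ + ε) with hτ
  have hτ0 : 1 - p ≤ τ := one_sub_le_tau hp (by linarith)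
  have hτ1 : τ ≤ 1 := by
    rw [hτ, tau_eq]
    nlinarith [hε₀.2.2]
  have hgε' := hgε ε hε hε₀.1
  rw [← hτ] at hgε'
  have hlam2 : 1 / lambda2 p τ ^ 2 ≤ c := by
    refine le_trans ?_ hc3
    rw [lambda2, ← hl, div_pow, one_div_div, ← div_pow]
    have := hg.trans_le hgε'
    gcongr
  have hP0 : (0 : ℝ) ≤ P.eval x := Nat.cast_nonneg _
  have hx0 : (0 : ℝ) ≤ x := Nat.cast_nonneg _
  have main : ∀ lam, lam ≤ lambda2 p τ → 1 / lam ^ 2 ≤ (P.eval x : ℕ) + c → 1 ≤ N →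
      rounds p τ (δ / 5) lam N ≤ c * (P.eval x : ℕ) + c + (2 + x) * ((P.eval x : ℕ) + c) + 1 := by
    intro lam h1 h2 h3
    refine (rounds_le hp hp1 hδ hδ1 hτ0 hτ1 hg hgε' h1 h2 hx hN h3).trans ?_
    gcongr
  have hv := verification_le hp hδ hδ1 hx hN
  have hv' : 2 / (2 * p - 1) ^ 2 * ((P.eval x : ℕ) + (2 + x) : ℝ) ≤
      c * ((P.eval x : ℕ) + (2 + x)) := by gcongr
  have p1 : (0 : ℝ) ≤ c * ((P.eval x : ℕ) + (2 + x)) := by positivity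
  have p2 : (0 : ℝ) ≤ c * (P.eval x : ℕ) + c + (2 + x) * ((P.eval x : ℕ) + c) + 1 := by positivity
  refine ⟨fun h => ⟨?_, ?_⟩, ?_⟩
  · rw [Nat.ceil_le]
    have := main _ (lambda1_le p τ N) (one_div_lambda1_sq_le hlam2 hc0 hN h) h
    simp only [eval_add, eval_mul, eval_natCast, eval_X, eval_ofNat, eval_one]
    push_cast at this ⊢
    linarith
  · rw [Nat.ceil_le]
    have := main _ le_rfl (by linarith) h
    simp only [eval_add, eval_mul, eval_natCast, eval_X, eval_ofNat, eval_one]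
    push_cast at this ⊢
    linarith
  · rw [Nat.ceil_le]
    simp only [eval_add, eval_mul, eval_natCast, eval_X, eval_ofNat, eval_one]
    push_cast at *
    linarith

/-! ## Executions of the multiplicative weights procedure -/

variable {V : Type} [Fintype V] {D : FeedbackGraph V} {p β θ : ℝ} {S₀ : Finset V}

lemma IsMultWeightsRun.nil : IsMultWeightsRun D p β θ S₀ [] ∅ :=
  ⟨fun _ => ∅, fun i hi => absurd hi (Nat.not_lt_zero i), by simp⟩

/-- Earlier iterations look only at prefixes of h, which remain the same; the new iteration sees the
weights after all of h. -/
lemma IsMultWeightsRun.concat {h : List (Response V)} {M M' Mi : Finset V} {s s' : V}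
    (hM : IsMultWeightsRun D p β θ S₀ h M) (hM' : ∀ t, t ∈ M' ↔ t ∈ M ∨ t ∈ Mi)
    (h1 : ∀ t, (1 / 2) * ∑ t, D.weight p S₀ h t ≤ D.weight p S₀ h t → t ∈ Mi)
    (h2 : ∀ t ∈ Mi, θ * ∑ t, D.weight p S₀ h t ≤ D.weight p S₀ h t)
    (h3 : D.potential (D.weight p S₀ h) s ≤ β) :
    IsMultWeightsRun D p β θ S₀ (h ++ [(s, s')]) M' := by
  classical
  obtain ⟨mark, hm, hMm⟩ := hM
  refine ⟨Function.update mark h.length Mi, fun i hi => ?_, ?_⟩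
  · rw [List.length_append, List.length_singleton] at hi
    rcases Nat.lt_succ_iff_lt_or_eq.1 hi with hi' | rfl
    · rw [List.take_append_of_le_length hi'.le, Function.update_of_ne hi'.ne,
        List.getElem_append_left hi']
      exact hm i hi'
    · rw [List.take_left, Function.update_self]
      refine ⟨h1, h2, ?_⟩
      rw [List.getElem_append_right le_rfl]
      simpa using h3
  · ext t
    rw [hM', hMm]
    simp only [Finset.mem_biUnion, Finset.mem_range, List.length_append, List.length_singleton]
    constructor
    · rintro (⟨i, hi, ht⟩ | ht)
      · exact ⟨i, by omega, by rwa [Function.update_of_ne hi.ne]⟩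
      · exact ⟨h.length, by omega, by rwa [Function.update_self]⟩
    · rintro ⟨i, hi, ht⟩
      rcases Nat.lt_succ_iff_lt_or_eq.1 hi with hi' | rfl
      · rw [Function.update_of_ne hi'.ne] at ht
        exact Or.inl ⟨i, hi', ht⟩
      · rw [Function.update_self] at ht
        exact Or.inr ht

end

end InteractiveLearning

namespace InteractiveLearning

noncomputable section

variable {V : Type} {O : Oracles V} {U : User V} {B : ℕ} {D : FeedbackGraph V}

/-! ## Subprograms for learning with imperfect feedback -/

/-- Appends model `5` to list `l` unless it is there already. -/
def addProg (l : ℕ) : Prog :=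
  .seq (.setN 16 (.const 0)) <|
  .seq (.forL 6 l <| .ite (.eqM 6 5) (.setN 16 (.const 1)) .skip) <|
  .ite (.le (.const 1) (.var 16)) .skip (.pushL l 5)

lemma swp_addProg {l : ℕ} {σ : State V} (hB : (σ.lst l).length + 1 ≤ B)
    (hnd : (σ.lst l).Nodup) :
    swp O U B (addProg l) (fun τ => (τ.lst l).Nodup ∧
      (∀ t, t ∈ τ.lst l ↔ t ∈ σ.lst l ∨ t = σ.mdl 5) ∧
      (τ.lst l).length ≤ (σ.lst l).length + 1) σ := by
  refine ⟨Nat.zero_le _, ?_⟩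
  refine swp_forL (fun pre τ => 1 ≤ τ.nat 16 ↔ σ.mdl 5 ∈ pre) (by simp [NExp.eval]) ?_ ?_
  · intro pre s suf τ hls hF hI
    have h5 : τ.mdl 5 = σ.mdl 5 := hF.mdl 5 rfl
    refine ⟨fun h => ⟨(show (1 : ℕ) ≤ B by omega), ?_⟩, fun h => ?_⟩
    · have h : s = σ.mdl 5 := by simpa [BExp.Holds, h5] using h
      simp [NExp.eval, h]
    · have h : ¬ s = σ.mdl 5 := by simpa [BExp.Holds, h5] using h
      have h' : ¬ σ.mdl 5 = s := fun h' => h h'.symm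
      simpa [swp, h'] using hI
  · intro τ hF hI
    have h5 : τ.mdl 5 = σ.mdl 5 := hF.mdl 5 rfl
    have hl : τ.lst l = σ.lst l := hF.lst l rfl
    refine ⟨fun h => ?_, fun h => ?_⟩
    · have h : 1 ≤ τ.nat 16 := h
      have hmem : σ.mdl 5 ∈ σ.lst l := hI.1 h
      simp only [swp, hl]
      refine ⟨hnd, fun t => ⟨Or.inl, ?_⟩, by omega⟩
      rintro (h | rfl)
      · exact h
      · exact hmem
    · have h : ¬ 1 ≤ τ.nat 16 := h
      have hmem : σ.mdl 5 ∉ σ.lst l := fun hm => h (hI.2 hm)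
      simp only [swp, hl, h5, State.lst_setLst, if_true, List.length_append, List.length_singleton]
      refine ⟨hB, ?_, by simp, le_rfl⟩
      rw [List.nodup_append]
      refine ⟨hnd, by simp, fun a ha b hb => ?_⟩
      rw [List.mem_singleton.1 hb]
      rintro rfl
      exact hmem ha

/-- The number one half. -/
def RExp.half : RExp := .div (.nat (.const 1)) (.nat (.const 2))

@[simp] lemma RExp.eval_half (σ : State V) : RExp.half.eval σ = 1 / 2 := by
  simp [RExp.half, RExp.eval, NExp.eval]

/-- Adds the models with frequency at least `1/2 - Δ - ε/2` in list `0` to list `2`. -/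
def markProg : Prog :=
  .forL 5 0 <| .seq occProg <|
    .ite (.leR (.mul (.sub (.sub .half (.var 1)) (.mul .half (.var 0))) (.nat (.lengthL 0)))
      (.nat (.var 14))) (addProg 2) .skip

open Classical in
lemma swp_markProg {σ : State V} (hl : (σ.lst 0).length ≤ B)
    (hB : (σ.lst 2).length + (σ.lst 0).length ≤ B) (hnd : (σ.lst 2).Nodup) :
    swp O U B markProg (fun τ => (τ.lst 2).Nodup ∧
      (∀ t, t ∈ τ.lst 2 ↔ t ∈ σ.lst 2 ∨ (t ∈ σ.lst 0 ∧
        (1 / 2 - σ.real 1 - 1 / 2 * σ.real 0) * (σ.lst 0).length ≤ (σ.lst 0).count t)) ∧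
      (τ.lst 2).length ≤ (σ.lst 2).length + (σ.lst 0).length) σ := by
  refine swp_forL (fun pre τ => (τ.lst 2).Nodup ∧
      (∀ t, t ∈ τ.lst 2 ↔ t ∈ σ.lst 2 ∨ (t ∈ pre ∧
        (1 / 2 - σ.real 1 - 1 / 2 * σ.real 0) * (σ.lst 0).length ≤ (σ.lst 0).count t)) ∧
      (τ.lst 2).length ≤ (σ.lst 2).length + pre.length) ⟨hnd, by simp, by simp⟩ ?_ ?_
  · intro pre s suf τ hls hF ⟨hI1, hI2, hI3⟩
    have hlen : pre.length + 1 ≤ (σ.lst 0).length := by rw [hls]; simp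
    have h0 : τ.lst 0 = σ.lst 0 := hF.lst 0 rfl
    refine swp_call (c := occProg) (swp_occProg (by simpa [h0] using hl)) fun ρ hFρ hρ => ?_
    simp only [State.lst_setMdl, State.mdl_setMdl, if_true, h0] at hρ
    have e5 : ρ.mdl 5 = s := by simpa using hFρ.mdl 5 rfl
    have el : ρ.lst 0 = σ.lst 0 := by rw [← h0]; simpa using hFρ.lst 0 rfl
    have e2 : ρ.lst 2 = τ.lst 2 := by simpa using hFρ.lst 2 rfl
    have r0 : ρ.real 0 = σ.real 0 := by rw [← hF.real 0 rfl]; simpa using hFρ.real 0 rfl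
    have r1 : ρ.real 1 = σ.real 1 := by rw [← hF.real 1 rfl]; simpa using hFρ.real 1 rfl
    have hb : (BExp.leR (.mul (.sub (.sub .half (.var 1)) (.mul .half (.var 0)))
        (.nat (.lengthL 0))) (.nat (.var 14))).Holds ρ ↔
        (1 / 2 - σ.real 1 - 1 / 2 * σ.real 0) * (σ.lst 0).length ≤ (σ.lst 0).count s := by
      simp only [BExp.Holds, RExp.eval, RExp.eval_half, NExp.eval, r0, r1, el, hρ]
    refine ⟨fun h => ?_, fun h => ?_⟩
    · rw [hb] at h
      refine swp_mono (swp_addProg (by rw [e2]; omega) (by rw [e2]; exact hI1)) fun π hπ => ?_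
      rw [e2, e5] at hπ
      refine ⟨hπ.1, fun t => ?_, by rw [List.length_append, List.length_singleton]; omega⟩
      rw [hπ.2.1, hI2, List.mem_append, List.mem_singleton]
      constructor
      · rintro ((h' | h') | rfl)
        · exact Or.inl h'
        · exact Or.inr ⟨Or.inl h'.1, h'.2⟩
        · exact Or.inr ⟨Or.inr rfl, h⟩
      · rintro (h' | ⟨h' | h', h''⟩)
        · exact Or.inl (Or.inl h')
        · exact Or.inl (Or.inr ⟨h', h''⟩)
        · exact Or.inr h'
    · rw [hb] at h
      simp only [swp, e2]
      refine ⟨hI1, fun t => ?_, by rw [List.length_append, List.length_singleton]; omega⟩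
      rw [hI2, List.mem_append, List.mem_singleton]
      constructor
      · rintro (h' | h')
        · exact Or.inl h'
        · exact Or.inr ⟨Or.inl h'.1, h'.2⟩
      · rintro (h' | ⟨h' | rfl, h''⟩)
        · exact Or.inl h'
        · exact Or.inr ⟨h', h''⟩
        · exact absurd h'' h
  · exact fun τ hF h => h

/-! ### Exact likelihoods -/

open Classical in
/-- The likelihood of the responses if the target is `s`. -/
def likelihood (D : FeedbackGraph V) (p : ℝ) (Q : List (Response V)) (s : V) : ℝ :=
  (Q.map fun r => if s ∈ D.reach r.1 r.2 then p else 1 - p).prod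

lemma weight_eq_likelihood {p : ℝ} {S₀ : Finset V} {Q : List (Response V)} {s : V} (h : s ∈ S₀) :
    D.weight p S₀ Q s = likelihood D p Q s := by
  rw [FeedbackGraph.weight, if_pos h, likelihood]

lemma likelihood_pos {p : ℝ} (hp : 0 < p) (hp1 : p < 1) (Q : List (Response V)) (s : V) :
    0 < likelihood D p Q s := by
  refine List.prod_pos fun x hx => ?_
  obtain ⟨r, -, rfl⟩ := List.mem_map.1 hx
  split_ifs <;> linarith

/-- This turns sums over all models into sums over a short list, which a program can compute; the
list must be free of repetitions. -/
lemma sum_weight_toFinset [Fintype V] [DecidableEq V] (p : ℝ) {l : List V} (hl : l.Nodup)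
    (Q : List (Response V)) :
    ∑ t, D.weight p l.toFinset Q t = (l.map (likelihood D p Q)).sum := by
  rw [← List.sum_toFinset _ hl, ← Finset.sum_subset (Finset.subset_univ l.toFinset)]
  · exact Finset.sum_congr rfl fun t ht => weight_eq_likelihood ht
  · intro t _ ht
    rw [FeedbackGraph.weight, if_neg ht]

open Classical in
lemma mass_weight_toFinset [Fintype V] (p : ℝ) {l : List V} (hl : l.Nodup)
    (Q : List (Response V)) (s s' : V) :
    D.mass (D.weight p l.toFinset Q) s s' =
      (l.map fun t => if t ∈ D.reach s s' then likelihood D p Q t else 0).sum := by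
  rw [FeedbackGraph.mass, ← List.sum_toFinset _ hl, Finset.sum_filter,
    ← Finset.sum_subset (Finset.subset_univ l.toFinset)]
  · refine Finset.sum_congr rfl fun t ht => ?_
    rw [weight_eq_likelihood ht]
  · intro t _ ht
    rw [FeedbackGraph.weight, if_neg ht, ite_self]

/-- Real register `10` receives the likelihood of model `3`, for response list `3`. -/
def weighProg : Prog :=
  .seq (.setR 10 (.nat (.const 1))) <| .forQ 7 8 3 <|
  .seq (.clearQ 2) <| .seq (.pushQ 2 7 8) <| .seq (.check 11 3 2) <|
  .ite (.le (.const 1) (.var 11)) (.setR 10 (.mul (.var 10) (.var 2)))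
    (.setR 10 (.mul (.var 10) (.sub (.nat (.const 1)) (.var 2))))

lemma swp_weighProg {σ : State V} (hR : O.Ready D B) (hQ : D.ValidResponses (σ.resp 3)) :
    swp O U B weighProg
      (fun τ => τ.real 10 = likelihood D (σ.real 2) (σ.resp 3) (σ.mdl 3)) σ := by
  classical
  refine swp_forQ (fun pre τ => τ.real 10 = likelihood D (σ.real 2) pre (σ.mdl 3))
    (by simp [RExp.eval, NExp.eval, likelihood]) ?_ ?_
  · intro pre r suf τ hls hF hI
    have hr : D.Allowed r.1 r.2 := hQ r (by
      have : σ.resp 3 = pre ++ r :: suf := hls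
      rw [this]; simp)
    have h3 : τ.mdl 3 = σ.mdl 3 := hF.mdl 3 rfl
    have h2 : τ.real 2 = σ.real 2 := hF.real 2 rfl
    have hc := hR.check_iff _ _ hr (σ.mdl 3)
    simp only [swp, State.resp_setResp, if_true, State.mdl_setResp, State.mdl_setMdl,
      List.nil_append, List.length_nil, Nat.reduceEqDiff, if_false, h3, BExp.Holds, NExp.eval,
      State.nat_setNat, RExp.eval, State.real_setNat, State.real_setResp, State.real_setMdl,
      State.real_setReal, hI, h2, likelihood, List.map_append, List.map_singleton,
      List.prod_append, List.prod_singleton, hc]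
    refine ⟨hR.one_le, hR.one_le, hR.check_time _ _ hr _, ?_⟩
    by_cases hm : σ.mdl 3 ∈ D.reach r.1 r.2
    · simp [hm]
    · simp [hm]
  · exact fun τ hF h => h

/-- Real register `12` receives the total likelihood of the models in list `2`. -/
def totalProg : Prog :=
  .seq (.setR 12 (.nat (.const 0))) <|
  .forL 3 2 <| .seq weighProg <| .setR 12 (.add (.var 12) (.var 10))

lemma swp_totalProg {σ : State V} (hR : O.Ready D B) (hQ : D.ValidResponses (σ.resp 3)) :
    swp O U B totalProg (fun τ => τ.real 12 =
      ((σ.lst 2).map (likelihood D (σ.real 2) (σ.resp 3))).sum) σ := by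
  refine swp_forL (fun pre τ => τ.real 12 =
    (pre.map (likelihood D (σ.real 2) (σ.resp 3))).sum) (by simp [RExp.eval, NExp.eval]) ?_ ?_
  · intro pre s suf τ hls hF hI
    have hq : τ.resp 3 = σ.resp 3 := hF.resp 3 rfl
    have h2 : τ.real 2 = σ.real 2 := hF.real 2 rfl
    refine swp_call (c := weighProg) (swp_weighProg (σ := τ.setMdl 3 s) hR (by simpa [hq] using hQ))
      fun ρ hFρ hρ => ?_
    have h12 : ρ.real 12 = τ.real 12 := hFρ.real 12 rfl
    simp only [State.real_setMdl, h2, State.resp_setMdl, hq, State.mdl_setMdl, if_true] at hρ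
    simp only [swp, RExp.eval, State.real_setReal, if_true, h12, hI, hρ, List.map_append,
      List.sum_append, List.map_singleton, List.sum_singleton]
  · exact fun τ hF h => h

/-- Adds the models of list `2` that carry at least half of the total likelihood to list `3`. -/
def markExactProg : Prog :=
  .forL 3 2 <| .seq weighProg <|
    .ite (.leR (.mul .half (.var 12)) (.var 10)) (.seq (.copyM 5 3) (addProg 3)) .skip

lemma swp_markExactProg {σ : State V} (hR : O.Ready D B) (hQ : D.ValidResponses (σ.resp 3))
    (hB : (σ.lst 2).length + 1 ≤ B) (hnd : (σ.lst 3).Nodup) (hsub : σ.lst 3 ⊆ σ.lst 2) :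
    swp O U B markExactProg (fun τ => (τ.lst 3).Nodup ∧
      (∀ t, t ∈ τ.lst 3 ↔ t ∈ σ.lst 3 ∨ (t ∈ σ.lst 2 ∧
        1 / 2 * σ.real 12 ≤ likelihood D (σ.real 2) (σ.resp 3) t))) σ := by
  refine swp_forL (fun pre τ => (τ.lst 3).Nodup ∧
      (∀ t, t ∈ τ.lst 3 ↔ t ∈ σ.lst 3 ∨ (t ∈ pre ∧
        1 / 2 * σ.real 12 ≤ likelihood D (σ.real 2) (σ.resp 3) t))) ⟨hnd, by simp⟩ ?_ ?_
  · intro pre s suf τ hls hF ⟨hI1, hI2⟩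
    have hlen : (τ.lst 3).length ≤ (σ.lst 2).length := by
      refine (List.subperm_of_subset hI1 fun t ht => ?_).length_le
      rcases (hI2 t).1 ht with h | h
      · exact hsub h
      · rw [hls]; exact List.mem_append_left _ h.1
    have hq : τ.resp 3 = σ.resp 3 := hF.resp 3 rfl
    have h2 : τ.real 2 = σ.real 2 := hF.real 2 rfl
    have h12 : τ.real 12 = σ.real 12 := hF.real 12 rfl
    refine swp_call (c := weighProg) (swp_weighProg (σ := τ.setMdl 3 s) hR (by simpa [hq] using hQ))
      fun ρ hFρ hρ => ?_
    have e12 : ρ.real 12 = σ.real 12 := (hFρ.real 12 rfl).trans h12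
    have e3 : ρ.mdl 3 = s := by simpa using hFρ.mdl 3 rfl
    have el : ρ.lst 3 = τ.lst 3 := hFρ.lst 3 rfl
    simp only [State.real_setMdl, h2, State.resp_setMdl, hq, State.mdl_setMdl, if_true] at hρ
    refine ⟨fun h => ?_, fun h => ?_⟩
    · simp only [BExp.Holds, RExp.eval, RExp.eval_half, e12, hρ] at h
      refine swp_mono (c := addProg 3) (swp_addProg (σ := ρ.setMdl 5 (ρ.mdl 3))
        (by simp only [State.lst_setMdl, el]; omega) (by simpa [el] using hI1)) fun π hπ => ?_
      simp only [State.lst_setMdl, State.mdl_setMdl, if_true, el, e3] at hπ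
      refine ⟨hπ.1, fun t => ?_⟩
      rw [hπ.2.1, hI2, List.mem_append, List.mem_singleton]
      constructor
      · rintro ((h' | h') | rfl)
        · exact Or.inl h'
        · exact Or.inr ⟨Or.inl h'.1, h'.2⟩
        · exact Or.inr ⟨Or.inr rfl, h⟩
      · rintro (h' | ⟨h' | h', h''⟩)
        · exact Or.inl (Or.inl h')
        · exact Or.inl (Or.inr ⟨h', h''⟩)
        · exact Or.inr h'
    · simp only [BExp.Holds, RExp.eval, RExp.eval_half, e12, hρ] at h
      simp only [swp, el]
      refine ⟨hI1, fun t => ?_⟩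
      rw [hI2, List.mem_append, List.mem_singleton]
      constructor
      · rintro (h' | h')
        · exact Or.inl h'
        · exact Or.inr ⟨Or.inl h'.1, h'.2⟩
      · rintro (h' | ⟨h' | rfl, h''⟩)
        · exact Or.inl h'
        · exact Or.inr ⟨h', h''⟩
        · exact absurd h'' h
  · exact fun τ hF h => h

/-- Should one move from model `0` to model `1`, for the likelihoods of the models in list `2`? -/
def weightTest : Prog :=
  .seq (.clearQ 1) <| .seq (.pushQ 1 0 1) <| .seq (.setR 11 (.nat (.const 0))) <|
  .seq (.forL 3 2 <| .seq weighProg <| .seq (.check 11 3 1) <|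
    .ite (.le (.const 1) (.var 11)) (.setR 11 (.add (.var 11) (.var 10))) .skip) <|
  .ite (.leR (.mul (.mul (.nat (.const 2)) (.nat (.var 10))) (.var 11))
    (.mul (.add (.nat (.var 10)) (.nat (.const 1))) (.var 12)))
    (.setN 12 (.const 0)) (.setN 12 (.const 1))

open Classical in
lemma swp_weightTest {σ : State V} (hR : O.Ready D B) (hadj : D.G.Adj (σ.mdl 0) (σ.mdl 1))
    (hQ : D.ValidResponses (σ.resp 3)) :
    swp O U B weightTest (fun ρ => 1 ≤ ρ.nat 12 ↔
      ((σ.nat 10 : ℝ) + 1) * σ.real 12 < 2 * σ.nat 10 *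
        ((σ.lst 2).map fun t => if t ∈ D.reach (σ.mdl 0) (σ.mdl 1) then
          likelihood D (σ.real 2) (σ.resp 3) t else 0).sum) σ := by
  have hB1 := hR.one_le
  refine ⟨by simpa using hB1, ?_⟩
  refine swp_forL (fun pre τ => τ.real 11 =
    (pre.map fun t => if t ∈ D.reach (σ.mdl 0) (σ.mdl 1) then
          likelihood D (σ.real 2) (σ.resp 3) t else 0).sum)
    (by simp [NExp.eval, RExp.eval]) ?_ ?_
  · intro pre s suf τ hls hF hI
    have h1 : τ.resp 1 = [(σ.mdl 0, σ.mdl 1)] := hF.resp 1 rfl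
    have hall : D.Allowed (σ.mdl 0) (σ.mdl 1) := Or.inr hadj
    have hq : τ.resp 3 = σ.resp 3 := hF.resp 3 rfl
    have h2 : τ.real 2 = σ.real 2 := hF.real 2 rfl
    refine swp_call (c := weighProg) (swp_weighProg (σ := τ.setMdl 3 s) hR (by simpa [hq] using hQ))
      fun ρ hFρ hρ => ?_
    have e1 : ρ.resp 1 = [(σ.mdl 0, σ.mdl 1)] := (hFρ.resp 1 rfl).trans h1
    have e3 : ρ.mdl 3 = s := by simpa using hFρ.mdl 3 rfl
    have e11 : ρ.real 11 = τ.real 11 := hFρ.real 11 rfl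
    have hc := hR.check_iff _ _ hall s
    simp only [State.real_setMdl, h2, State.resp_setMdl, hq, State.mdl_setMdl, if_true] at hρ
    simp only [swp, e1, e3, hc, BExp.Holds, NExp.eval, State.nat_setNat, if_true,
      RExp.eval, State.real_setNat, State.real_setReal, e11, hI, hρ, List.map_append,
      List.sum_append, List.map_singleton, List.sum_singleton]
    refine ⟨hB1, hR.check_time _ _ hall _, ?_⟩
    by_cases hm : s ∈ D.reach (σ.mdl 0) (σ.mdl 1)
    · simp [hm]
    · simp [hm]
  · intro τ hF hI
    have e10 : τ.nat 10 = σ.nat 10 := hF.nat 10 rfl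
    have e12 : τ.real 12 = σ.real 12 := hF.real 12 rfl
    have hI' : τ.real 11 = ((σ.lst 2).map fun t => if t ∈ D.reach (σ.mdl 0) (σ.mdl 1) then
          likelihood D (σ.real 2) (σ.resp 3) t else 0).sum := hI
    simp only [swp, BExp.Holds, NExp.eval, RExp.eval, e10, e12, hI', State.nat_setNat, if_true,
      Nat.cast_ofNat, Nat.cast_one]
    refine ⟨fun h => ⟨Nat.zero_le _, ?_⟩, fun h => ⟨hB1, ?_⟩⟩
    · simp only [nonpos_iff_eq_zero, one_ne_zero, false_iff, not_lt]
      exact h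
    · simp only [le_refl, true_iff]
      exact not_le.1 h

/-! ### Rounding -/

/-- Number register `x` receives the value of real register `26`, rounded up. -/
def ceilProg (K : Polynomial ℕ) (x : ℕ) : Prog :=
  .seq (.setN x (.const 0)) <| .loop (.poly K) <|
    .ite (.leR (.var 26) (.nat (.var x))) .skip (.setN x (.add (.var x) (.const 1)))

/-- The machine cannot round, so it counts up until the real number is reached, after at most K
steps. Register 10 is excluded as target because the polynomial is evaluated there. -/
lemma swp_ceilProg {K : Polynomial ℕ} {x : ℕ} (hx : x ≠ 10) {σ : State V}
    (hK : ⌈σ.real 26⌉₊ ≤ K.eval (σ.nat 10)) (hB : K.eval (σ.nat 10) ≤ B) :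
    swp O U B (ceilProg K x) (fun τ => τ.nat x = ⌈σ.real 26⌉₊) σ := by
  refine ⟨Nat.zero_le _, ?_⟩
  have hev : (NExp.poly K).eval (σ.setNat x ((NExp.const 0).eval σ)) = K.eval (σ.nat 10) := by
    simp [hx.symm]
  refine swp_loop (fun i τ => τ.nat x = min i ⌈σ.real 26⌉₊) (by rw [hev]; exact hB)
    (by simp [NExp.eval]) ?_ ?_
  · intro i τ hi hF hI
    rw [hev] at hi
    have h26 : τ.real 26 = σ.real 26 := hF.real 26 rfl
    refine ⟨fun h => ?_, fun h => ?_⟩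
    · simp only [BExp.Holds, RExp.eval, NExp.eval, h26, ← Nat.ceil_le] at h
      simp only [swp]
      omega
    · simp only [BExp.Holds, RExp.eval, NExp.eval, h26, ← Nat.ceil_le] at h
      simp only [swp, NExp.eval, State.nat_setNat, if_true]
      omega
  · intro τ hF hI
    rw [hev, min_eq_right hK] at hI
    exact hI

/-! ### Verification -/

/-- Proposes the models in list `3` in turn, `nat 19` times each, until one of them is confirmed in
half of the cases. It is put into register `0`, and the flag `15` is raised. -/
def verifyProg : Prog :=
  .seq (.setN 15 (.const 0)) <| .forL 5 3 <| .ite (.le (.const 1) (.var 15)) .skip <|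
  .seq (.setN 14 (.const 0)) <|
  .seq (.loop (.var 19) <| .seq (.ask 4 5) <|
    .ite (.eqM 4 5) (.setN 14 (.add (.var 14) (.const 1))) .skip) <|
  .ite (.le (.var 19) (.mul (.const 2) (.var 14)))
    (.seq (.copyM 0 5) (.setN 15 (.const 1))) .skip

/-- The output after verification. -/
def verifyOutput (τ : State V) : Option V := if τ.nat 15 = 0 then none else some (τ.mdl 0)

open Classical in
lemma isVerificationRun_cons_none {r : ℕ} {s : V} {l : List V} {h₁ h : List (Response V)}
    {out : Option V} (hlen : h₁.length = r) (hs : ∀ x ∈ h₁, x.1 = s)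
    (hc : ¬ r ≤ 2 * h₁.countP (fun x => x.2 = s)) (h' : IsVerificationRun r l h out) :
    IsVerificationRun r (s :: l) (h₁ ++ h) out :=
  ⟨h₁, h, rfl, hlen, hs, by rw [if_neg hc]; exact h'⟩

open Classical in
lemma isVerificationRun_cons_some {r : ℕ} {s : V} {l : List V} {h₁ : List (Response V)}
    (hlen : h₁.length = r) (hs : ∀ x ∈ h₁, x.1 = s)
    (hc : r ≤ 2 * h₁.countP (fun x => x.2 = s)) :
    IsVerificationRun r (s :: l) h₁ (some s) :=
  ⟨h₁, [], by simp, hlen, hs, by rw [if_pos hc]; exact ⟨rfl, rfl⟩⟩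

lemma swp_verifyProg {σ : State V} (hr : σ.nat 19 ≤ B) (hB : 1 ≤ B) :
    swp O U B verifyProg (fun τ => (τ.nat 15 = 0 ∨ τ.nat 15 = 1) ∧ ∃ h,
      τ.hist = σ.hist ++ h ∧
      IsVerificationRun (σ.nat 19) (σ.lst 3) h (verifyOutput τ)) σ := by
  classical
  set r := σ.nat 19 with hrdef
  refine ⟨Nat.zero_le _, ?_⟩
  -- The invariant speaks about continuations. With the flag down, every verification run of the
  -- remaining list extends to one of the whole list. With the flag up, the run is complete,
  -- whatever models remain in the list.
  refine swp_forL (fun pre τ => (τ.nat 15 = 0 ∨ τ.nat 15 = 1) ∧ ∃ h, τ.hist = σ.hist ++ h ∧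
    (τ.nat 15 = 0 → ∀ l h' out, IsVerificationRun r l h' out →
      IsVerificationRun r (pre ++ l) (h ++ h') out) ∧
    (τ.nat 15 = 1 → ∀ l, IsVerificationRun r (pre ++ l) h (some (τ.mdl 0)))) ?_ ?_ ?_
  · refine ⟨Or.inl (by simp [NExp.eval]), [], by simp, fun _ l h' out h => h,
      fun h => by simp [NExp.eval] at h⟩
  · intro pre s suf τ hls hF ⟨hflag, h, hh, hI0, hI1⟩
    refine ⟨fun hb => ?_, fun hb => ?_⟩
    · have hb : 1 ≤ τ.nat 15 := hb
      have h1 : τ.nat 15 = 1 := by omega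
      refine ⟨hflag, h, hh, fun h => ?_, fun _ l => ?_⟩
      · simp only [State.nat_setMdl] at h; omega
      · rw [List.append_assoc]
        exact hI1 h1 _
    · have hb : ¬ 1 ≤ τ.nat 15 := hb
      have h0 : τ.nat 15 = 0 := by omega
      have e19 : τ.nat 19 = r := hF.nat 19 rfl
      refine ⟨Nat.zero_le _, ?_⟩
      set τ₁ := (τ.setMdl 5 s).setNat 14 ((NExp.const 0).eval (τ.setMdl 5 s)) with hτ₁
      have hev : (NExp.var 19).eval τ₁ = r := by simp [NExp.eval, hτ₁, e19]
      refine swp_loop (σ := τ₁) (fun i ρ => ∃ h₁ : List (Response V), ρ.hist = σ.hist ++ h ++ h₁ ∧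
        h₁.length = i ∧ (∀ x ∈ h₁, x.1 = s) ∧ ρ.nat 14 = h₁.countP (fun x => x.2 = s)) ?_ ?_ ?_ ?_
      · rw [hev]; exact hr
      · exact ⟨[], by simp [hτ₁, hh], rfl, by simp, by simp [hτ₁, NExp.eval]⟩
      · rintro i ρ hi hFρ ⟨h₁, g1, g2, g3, g4⟩
        have e5 : ρ.mdl 5 = s := by simpa [hτ₁] using hFρ.mdl 5 rfl
        intro s' hs'
        rw [hev] at hi
        have hcl := List.countP_le_length (p := fun x : Response V => x.2 = s) (l := h₁)
        simp only [swp, BExp.Holds, State.mdl_addHist, State.mdl_setMdl, if_true, NExp.eval,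
          State.nat_addHist, State.nat_setMdl, State.hist_setNat, State.hist_addHist,
          State.hist_setMdl, State.nat_setNat, Nat.reduceEqDiff, if_false, e5, g1, g4]
        refine ⟨fun heq => ⟨by omega, h₁ ++ [(s, s')], by simp, by simp [g2], ?_, ?_⟩,
          fun hne => ⟨h₁ ++ [(s, s')], by simp, by simp [g2], ?_, ?_⟩⟩
        · intro x hx
          rcases List.mem_append.1 hx with hx | hx
          · exact g3 x hx
          · rw [List.mem_singleton.1 hx]
        · simp [heq, List.countP_append]
        · intro x hx
          rcases List.mem_append.1 hx with hx | hx
          · exact g3 x hx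
          · rw [List.mem_singleton.1 hx]
        · simp [hne, List.countP_append]
      · rintro ρ hFρ ⟨h₁, g1, g2, g3, g4⟩
        rw [hev] at g2
        have e5 : ρ.mdl 5 = s := by simpa [hτ₁] using hFρ.mdl 5 rfl
        have e15 : ρ.nat 15 = 0 := by rw [← h0]; simpa [hτ₁] using hFρ.nat 15 rfl
        have e19' : ρ.nat 19 = r := by rw [← e19]; simpa [hτ₁] using hFρ.nat 19 rfl
        simp only [swp, BExp.Holds, NExp.eval, e19', g4, e5, State.nat_setNat, if_true,
          State.hist_setNat, State.hist_setMdl, State.mdl_setNat, State.mdl_setMdl, e15]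
        refine ⟨fun hc => ⟨hB, Or.inr trivial, h ++ h₁, by rw [g1, List.append_assoc],
          fun h => by omega, fun _ l => ?_⟩, fun hc => ⟨Or.inl trivial, h ++ h₁,
            by rw [g1, List.append_assoc], fun _ l h' out hv => ?_, fun h => by omega⟩⟩
        · rw [List.append_assoc]
          exact hI0 h0 _ _ _ (isVerificationRun_cons_some g2 g3 hc)
        · rw [List.append_assoc, List.append_assoc]
          exact hI0 h0 _ _ _ (isVerificationRun_cons_none g2 g3 hc hv)
  · rintro τ hF ⟨hflag, h, hh, hI0, hI1⟩
    refine ⟨hflag, h, hh, ?_⟩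
    have hl : (σ.setNat 15 ((NExp.const 0).eval σ)).lst 3 = σ.lst 3 := rfl
    rw [hl] at hI0 hI1
    rcases hflag with h0 | h1
    · have := hI0 h0 [] [] none ⟨rfl, rfl⟩
      rw [List.append_nil, List.append_nil] at this
      simpa [verifyOutput, h0] using this
    · have := hI1 h1 []
      rw [List.append_nil] at this
      simpa [verifyOutput, h1] using this

end

end InteractiveLearning

namespace InteractiveLearning

noncomputable section

variable {V : Type} {O : Oracles V} {U : User V} {B : ℕ} {D : FeedbackGraph V}

/-! ## Computing the parameters -/

namespace RExp

/-- A natural number constant. -/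
def num (k : ℕ) : RExp := .nat (.const k)

/-- The logarithm to base `2`. -/
def logb2 (a : RExp) : RExp := .div (.ln a) (.ln (num 2))

@[simp] lemma eval_num (σ : State V) (k : ℕ) : (num k).eval σ = k := rfl

@[simp] lemma eval_logb2 (σ : State V) (a : RExp) : (logb2 a).eval σ = Real.logb 2 (a.eval σ) := by
  simp [logb2, eval, Real.logb]

end RExp

/-- The parameters of learning with imperfect feedback are in their registers. -/
structure Params (ε Δ p δ : ℝ) (σ : State V) : Prop where
  eps : σ.real 0 = ε
  err : σ.real 1 = Δ
  prob : σ.real 2 = p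
  del : σ.real 3 = δ
  tau : σ.real 20 = tau p (1 / 2 + 2 * Δ + ε)
  gap : σ.real 21 = gap p (InteractiveLearning.tau p (1 / 2 + 2 * Δ + ε))
  ell : σ.real 22 = Real.logb 2 (p / (1 - p))
  lam : σ.real 23 = lambda2 p (InteractiveLearning.tau p (1 / 2 + 2 * Δ + ε))

lemma Params.congr {ε Δ p δ : ℝ} {σ τ : State V} (h : Params ε Δ p δ σ)
    (h0 : τ.real 0 = σ.real 0) (h1 : τ.real 1 = σ.real 1) (h2 : τ.real 2 = σ.real 2)
    (h3 : τ.real 3 = σ.real 3) (h4 : τ.real 20 = σ.real 20) (h5 : τ.real 21 = σ.real 21)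
    (h6 : τ.real 22 = σ.real 22) (h7 : τ.real 23 = σ.real 23) : Params ε Δ p δ τ :=
  ⟨h0.trans h.eps, h1.trans h.err, h2.trans h.prob, h3.trans h.del, h4.trans h.tau,
    h5.trans h.gap, h6.trans h.ell, h7.trans h.lam⟩

/-- Computes the parameters from the inputs. -/
def paramsProg : Prog :=
  .seq (.setR 24 (.add (.add .half (.mul (.num 2) (.var 1))) (.var 0))) <|
  .seq (.setR 20 (.add (.mul (.var 24) (.var 2))
    (.mul (.sub (.num 1) (.var 24)) (.sub (.num 1) (.var 2))))) <|
  .seq (.setR 21 (.sub (.logb2 (.div (.num 1) (.var 20)))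
    (.sub (.mul (.sub (.num 0) (.var 2)) (.logb2 (.var 2)))
      (.mul (.sub (.num 1) (.var 2)) (.logb2 (.sub (.num 1) (.var 2))))))) <|
  .seq (.setR 22 (.logb2 (.div (.var 2) (.sub (.num 1) (.var 2))))) <|
  .setR 23 (.div (.var 21) (.mul (.num 2) (.var 22)))

lemma swp_paramsProg {ε Δ p δ : ℝ} {σ : State V} (h0 : σ.real 0 = ε) (h1 : σ.real 1 = Δ)
    (h2 : σ.real 2 = p) (h3 : σ.real 3 = δ) : swp O U B paramsProg (Params ε Δ p δ) σ := by
  simp only [paramsProg, swp, RExp.eval]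
  constructor <;>
    simp [RExp.eval, h0, h1, h2, h3, InteractiveLearning.tau, InteractiveLearning.gap, entropy,
      lambda2]

/-- Real register `25` receives `λ₁`. -/
def lambda1Prog : Prog :=
  .ite (.le (.var 4) (.const 2)) (.setR 25 (.var 23)) <|
  .seq (.setR 25 (.sqrt (.div (.num 1) (.logb2 (.logb2 (.nat (.var 4))))))) <|
  .ite (.leR (.var 23) (.var 25)) (.setR 25 (.var 23)) .skip

lemma swp_lambda1Prog {ε Δ p δ : ℝ} {σ : State V} (h : Params ε Δ p δ σ) :
    swp O U B lambda1Prog (fun τ => τ.real 25 = lambda1 p (tau p (1 / 2 + 2 * Δ + ε)) (σ.nat 4))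
      σ := by
  simp only [lambda1Prog, swp, BExp.Holds, NExp.eval, RExp.eval, State.real_setReal, h.lam, if_true,
    RExp.eval_logb2, RExp.eval_num, lambda1, Nat.reduceEqDiff, if_false, Nat.cast_one]
  refine ⟨fun h => by rw [if_pos h], fun h => ?_⟩
  rw [if_neg h]
  exact ⟨fun h' => (min_eq_right h').symm, fun h' => (min_eq_left (not_le.1 h').le).symm⟩

/-- Real register `26` receives the parameter `K`, for `λ` in real register `lam` and `N`
candidates. -/
def roundsProg (lam : ℕ) (N : NExp) : Prog :=
  .seq (.setR 26 (.add
    (.div (.logb2 (.nat N)) (.sub (.var 21) (.mul (.var lam) (.var 22))))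
    (.div (.logb2 (.div (.num 1) (.var 20)))
      (.logb2 (.div (.num 1) (.div (.var 3) (.num 5))))))) <|
  .seq (.setR 27 (.div (.ln (.div (.num 1) (.div (.var 3) (.num 5))))
    (.mul (.var lam) (.var lam)))) <|
  .seq (.ite (.leR (.var 26) (.var 27)) (.setR 26 (.var 27)) .skip) <|
  .setR 26 (.add (.var 26) (.num 1))

lemma swp_roundsProg {ε Δ p δ lam' : ℝ} {lam : ℕ} {N : NExp} {σ : State V}
    (h : Params ε Δ p δ σ) (h26 : lam ≠ 26) (hlam : σ.real lam = lam') :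
    swp O U B (roundsProg lam N) (fun τ => τ.real 26 =
      rounds p (tau p (1 / 2 + 2 * Δ + ε)) (δ / 5) lam' (N.eval σ)) σ := by
  simp only [roundsProg, swp, BExp.Holds, RExp.eval, State.real_setReal, h.gap, h.ell,
    h.tau, h.del, hlam, if_true, RExp.eval_logb2, RExp.eval_num, rounds, Nat.reduceEqDiff,
    if_false, Nat.cast_one, Nat.cast_ofNat, h26, ← pow_two]
  exact ⟨fun h => by rw [max_eq_right h], fun h => by rw [max_eq_left (not_le.1 h).le]⟩

/-! ## The phase with sampled likelihoods -/

section Heavy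

variable [Fintype V] {μ : PMF V} {E : ℕ} {ls : List V} {w : V → ℝ} {Δ ε : ℝ}

open Classical in
/-- Accurate frequencies tell which models carry a large part of the likelihood. -/
lemma Accurate.heavy (h : Accurate D μ E ls) (hε : 0 < ε) (hE : 2 ≤ ε * E) (hl : 0 < ls.length)
    (hw : 0 < ∑ t, w t) (htv : tvDist w μ ≤ Δ) (s : V) :
    (1 / 2 * ∑ t, w t ≤ w s →
      (1 / 2 - Δ - 1 / 2 * ε) * ls.length ≤ ls.count s) ∧
    ((1 / 2 - Δ - 1 / 2 * ε) * ls.length ≤ ls.count s →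
      (1 / 2 - 2 * Δ - ε) * ∑ t, w t ≤ w s) := by
  have h1 := h.count s
  have h2 := abs_le.1 (tvDist_apply hw htv s)
  have hl0 : (0 : ℝ) < ls.length := Nat.cast_pos.2 hl
  set q := (μ s).toReal
  -- Sampling error ε/2 and total variation Δ are each spent on both sides of the threshold 1/2 - Δ
  -- - ε/2: weight 1/2 is surely above it, and weight below 1/2 - 2Δ - ε surely under it.
  have h3 : |(ls.count s : ℝ) - q * ls.length| ≤ ε / 2 * ls.length := by
    have h4 : |(ls.count s : ℝ) - q * ls.length| * 2 ≤
        |(ls.count s : ℝ) - q * ls.length| * (ε * E) := by gcongr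
    nlinarith
  have h4 := abs_le.1 h3
  constructor
  · intro hs
    have h5 : 1 / 2 ≤ w s / ∑ t, w t := by rwa [le_div_iff₀ hw]
    have h6 : (1 / 2 - Δ) * ls.length ≤ q * ls.length :=
      mul_le_mul_of_nonneg_right (by linarith) hl0.le
    linarith
  · intro hs
    rw [← le_div_iff₀ hw]
    have h5 : (1 / 2 - Δ - ε) * ls.length ≤ q * ls.length := by linarith
    have h6 := le_of_mul_le_mul_right h5 hl0
    linarith

end Heavy

/-- One round with imperfect feedback, after samples have been drawn. -/
def noisyStep (P : Polynomial ℕ) : Prog :=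
  .seq markProg <| .seq (searchProg P countTest) <| .seq (.ask 4 0) (.pushQ 0 0 4)

open Classical in
lemma swp_noisyStep [Fintype V] {P : Polynomial ℕ} {n X : ℕ} {σ : State V}
    (hR : O.Ready D B) (hD : D.Bounded P n) (hn : n ≤ X) (hB : P.eval X * X + 1 ≤ B)
    (hX : σ.nat 10 = X) (hl0 : 0 < (σ.lst 0).length)
    (hl : (σ.lst 2).length + (σ.lst 0).length ≤ B)
    (hQ : (σ.resp 0).length + 1 ≤ B) (hnd : (σ.lst 2).Nodup) :
    swp O U B (noisyStep P) (fun τ =>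
      (τ.lst 2).Nodup ∧ (τ.lst 2).length ≤ (σ.lst 2).length + (σ.lst 0).length ∧
      (∀ t, t ∈ τ.lst 2 ↔ t ∈ σ.lst 2 ∨ (t ∈ σ.lst 0 ∧
        (1 / 2 - σ.real 1 - 1 / 2 * σ.real 0) * (σ.lst 0).length ≤ (σ.lst 0).count t)) ∧
        ∃ s s', τ.resp 0 = σ.resp 0 ++ [(s, s')] ∧ τ.hist = σ.hist ++ [(s, s')] ∧
          s' ∈ (U σ.hist s).support ∧ ∀ s', D.G.Adj s s' →
            2 * X * D.mass (freq (σ.lst 0)) s s' ≤ ((X : ℝ) + 1) * (σ.lst 0).length) σ := by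
  refine swp_call (c := markProg) (swp_markProg (by omega) hl hnd) fun τ hF hτ => ?_
  have el : τ.lst 0 = σ.lst 0 := hF.lst 0 rfl
  refine swp_call (c := searchProg P countTest) (swp_searchProg_countTest hR hD hn hB
    (by rw [hF.nat 10 rfl, hX]) (by rw [el]; omega) (by rwa [el])) fun ρ hFρ hρ => ?_
  rw [el] at hρ
  have eh : ρ.hist = σ.hist := (hFρ.hist rfl).trans (hF.hist rfl)
  have eq : ρ.resp 0 = σ.resp 0 := (hFρ.resp 0 rfl).trans (hF.resp 0 rfl)
  have e2 : ρ.lst 2 = τ.lst 2 := hFρ.lst 2 rfl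
  intro s' hs'
  rw [eh] at hs'
  refine ⟨by simpa [eq] using hQ, ?_⟩
  simp only [State.lst_setResp, State.lst_addHist, State.lst_setMdl, e2]
  exact ⟨hτ.1, hτ.2.2, hτ.2.1, ρ.mdl 0, s', by simp [eq], by simp [eh], hs', hρ⟩

/-! ## The phase with exact likelihoods -/

/-- One round with exact likelihoods. -/
def exactStep (P : Polynomial ℕ) : Prog :=
  .seq totalProg <| .seq markExactProg <| .seq (searchProg P weightTest) <|
  .seq (.ask 4 0) (.pushQ 3 0 4)

-- No sampling is involved, so the conclusion is sure: the total likelihood of a nonempty list is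
-- positive as 0 < p < 1, the marks are exact, and local optimality gives potential at most 1/2 +
-- 1/(2X).
open Classical in
lemma swp_exactStep [Fintype V] {P : Polynomial ℕ} {n X : ℕ} {p β θ : ℝ} {σ : State V}
    (hR : O.Ready D B) (hD : D.Bounded P n) (hn : n ≤ X) (hX1 : 1 ≤ X)
    (hB : P.eval X * X + 1 ≤ B) (hX : σ.nat 10 = X) (hp : 0 < p) (hp1 : p < 1)
    (hσp : σ.real 2 = p) (hβ : 1 / 2 + 1 / (2 * X) ≤ β) (hθ : θ ≤ 1 / 2)
    (hQ : D.ValidResponses (σ.resp 3)) (hQB : (σ.resp 3).length + 1 ≤ B)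
    (hU : U.IsAllowed D) (hne : σ.lst 2 ≠ []) (hnd2 : (σ.lst 2).Nodup)
    (hlB : (σ.lst 2).length + 1 ≤ B) (hnd : (σ.lst 3).Nodup) (hsub : σ.lst 3 ⊆ σ.lst 2)
    (hrun : IsMultWeightsRun D p β θ (σ.lst 2).toFinset (σ.resp 3) (σ.lst 3).toFinset) :
    swp O U B (exactStep P) (fun τ =>
      (τ.lst 3).Nodup ∧ τ.lst 3 ⊆ σ.lst 2 ∧
      IsMultWeightsRun D p β θ (σ.lst 2).toFinset (τ.resp 3) (τ.lst 3).toFinset ∧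
      D.ValidResponses (τ.resp 3) ∧
      ∃ r, τ.resp 3 = σ.resp 3 ++ [r] ∧ τ.hist = σ.hist ++ [r]) σ := by
  set W := D.weight p (σ.lst 2).toFinset (σ.resp 3) with hW
  have hWnn : ∀ t, 0 ≤ W t := FeedbackGraph.weight_nonneg hp.le hp1.le _ _
  have hsum := sum_weight_toFinset (D := D) p hnd2 (σ.resp 3)
  rw [← hW] at hsum
  have hpos : 0 < ∑ t, W t := by
    obtain ⟨s, hs⟩ := List.exists_mem_of_ne_nil _ hne
    refine lt_of_lt_of_le ?_ (Finset.single_le_sum (fun t _ => hWnn t) (Finset.mem_univ s))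
    rw [hW, weight_eq_likelihood (List.mem_toFinset.2 hs)]
    exact likelihood_pos hp hp1 _ _
  refine swp_call (c := totalProg) (swp_totalProg hR hQ) fun τ hF hτ => ?_
  rw [hσp, ← hsum] at hτ
  have l2 : τ.lst 2 = σ.lst 2 := hF.lst 2 rfl
  have l3 : τ.lst 3 = σ.lst 3 := hF.lst 3 rfl
  have q3 : τ.resp 3 = σ.resp 3 := hF.resp 3 rfl
  have r2 : τ.real 2 = p := (hF.real 2 rfl).trans hσp
  refine swp_call (c := markExactProg) (swp_markExactProg hR (by rwa [q3]) (by rwa [l2])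
    (by rwa [l3]) (by rwa [l2, l3])) fun ρ hFρ ⟨hρ1, hρ2⟩ => ?_
  rw [l2, l3, q3, r2, hτ] at hρ2
  have l2' : ρ.lst 2 = σ.lst 2 := (hFρ.lst 2 rfl).trans l2
  have q3' : ρ.resp 3 = σ.resp 3 := (hFρ.resp 3 rfl).trans q3
  have r2' : ρ.real 2 = p := (hFρ.real 2 rfl).trans r2
  have r12' : ρ.real 12 = ∑ t, W t := (hFρ.real 12 rfl).trans hτ
  have x' : ρ.nat 10 = X := (hFρ.nat 10 rfl).trans ((hF.nat 10 rfl).trans hX)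
  have hh' : ρ.hist = σ.hist := (hFρ.hist rfl).trans (hF.hist rfl)
  refine swp_call (c := searchProg P weightTest) (swp_searchProg (n := n) (X := X) (W := W) hR hD hn
    hWnn hpos rfl rfl rfl rfl hB
    (fun π => π.nat 10 = X ∧ π.lst 2 = σ.lst 2 ∧ π.resp 3 = σ.resp 3 ∧ π.real 2 = p ∧
      π.real 12 = ∑ t, W t)
    (fun π π' h hF => ⟨(hF.nat 10 rfl).trans h.1, (hF.lst 2 rfl).trans h.2.1,
      (hF.resp 3 rfl).trans h.2.2.1, (hF.real 2 rfl).trans h.2.2.2.1,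
      (hF.real 12 rfl).trans h.2.2.2.2⟩) (fun π h => h.1) (fun π h hadj => ?_)
    ⟨x', l2', q3', r2', r12'⟩) fun π hFπ hπ => ?_
  · have := swp_weightTest (U := U) hR hadj (by rw [h.2.2.1]; exact hQ)
    rw [h.1, h.2.1, h.2.2.1, h.2.2.2.1, h.2.2.2.2, ← mass_weight_toFinset p hnd2] at this
    exact this
  · have l3'' : π.lst 3 = ρ.lst 3 := hFπ.lst 3 rfl
    have q3'' : π.resp 3 = σ.resp 3 := (hFπ.resp 3 rfl).trans q3'
    have hh'' : π.hist = σ.hist := (hFπ.hist rfl).trans hh'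
    intro s' hs'
    have hall : D.Allowed (π.mdl 0) s' := hU _ _ _ hs'
    refine ⟨by simpa [q3''] using hQB, ?_⟩
    have hX0 : (0 : ℝ) < X := by exact_mod_cast hX1
    have hpot : D.potential W (π.mdl 0) ≤ β := by
      have h0 : (0 : ℝ) < 1 / (2 * X) := by positivity
      refine FeedbackGraph.potential_le hpos (by linarith) fun t ht => ?_
      have h1 := hπ t ht
      have h2 : D.mass W (π.mdl 0) t ≤ (1 / 2 + 1 / (2 * X)) * ∑ t, W t := by
        have : (1 / 2 + 1 / (2 * X) : ℝ) = (X + 1) / (2 * X) := by field_simp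
        rw [this, div_mul_eq_mul_div, le_div_iff₀ (by positivity)]
        linarith
      exact h2.trans (mul_le_mul_of_nonneg_right hβ hpos.le)
    have hWl : ∀ t, t ∈ σ.lst 2 → W t = likelihood D p (σ.resp 3) t := fun t ht =>
      weight_eq_likelihood (List.mem_toFinset.2 ht)
    have hsub' : ρ.lst 3 ⊆ σ.lst 2 := fun t ht => by
      rcases (hρ2 t).1 ht with h | h
      · exact hsub h
      · exact h.1
    simp only [State.resp_setResp, State.resp_addHist, State.resp_setMdl, State.mdl_addHist,
      State.mdl_setMdl, State.hist_setResp, State.hist_addHist, State.hist_setMdl,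
      State.lst_setResp, State.lst_addHist, State.lst_setMdl, if_true, OfNat.zero_ne_ofNat,
      if_false, l3'', q3'', hh'']
    refine ⟨hρ1, hsub', hrun.concat (Mi := (σ.lst 2).toFinset.filter fun t =>
      1 / 2 * ∑ t, W t ≤ likelihood D p (σ.resp 3) t) (fun t => ?_) (fun t ht => ?_)
      (fun t ht => ?_) hpot, ?_, _, rfl, rfl⟩
    · simp only [List.mem_toFinset, hρ2, Finset.mem_filter]
    -- Outside the list the weight is 0 and cannot be half of a positive total.
    · have ht2 : t ∈ σ.lst 2 := by
        by_contra hn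
        have : W t = 0 := by
          rw [hW, FeedbackGraph.weight, if_neg (by rwa [List.mem_toFinset])]
        rw [← hW] at ht
        linarith
      rw [Finset.mem_filter, List.mem_toFinset]
      refine ⟨ht2, ?_⟩
      rw [← hWl t ht2]
      exact ht
    · rw [Finset.mem_filter, List.mem_toFinset] at ht
      rw [← hWl t ht.1] at ht
      refine le_trans ?_ ht.2
      exact mul_le_mul_of_nonneg_right hθ hpos.le
    · intro r hr
      rcases List.mem_append.1 hr with hr | hr
      · exact hQ r hr
      · rw [List.mem_singleton.1 hr]; exact hall

end

end InteractiveLearning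

/-! ### The rounds with exact likelihoods and the verification, put together. -/

namespace InteractiveLearning

noncomputable section

variable {V : Type} [Fintype V] {O : Oracles V} {U : User V} {B : ℕ} {D : FeedbackGraph V}

/-- Number register `18` receives the number of rounds with exact likelihoods. -/
def exactRoundsProg (K : Polynomial ℕ) : Prog :=
  .ite (.le (.lengthL 2) (.const 0)) (.setN 18 (.const 0)) <|
  .seq (roundsProg 23 (.lengthL 2)) <| .seq (ceilProg K 18) <|
  .setN 18 (.add (.var 18) (.const 1))

omit [Fintype V] in
lemma swp_exactRoundsProg {K : Polynomial ℕ} {ε Δ p δ : ℝ} {σ : State V} (h : Params ε Δ p δ σ)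
    (hK : σ.lst 2 ≠ [] → ⌈rounds p (tau p (1 / 2 + 2 * Δ + ε)) (δ / 5)
      (lambda2 p (tau p (1 / 2 + 2 * Δ + ε))) (σ.lst 2).length⌉₊ ≤ K.eval (σ.nat 10))
    (hB : K.eval (σ.nat 10) + 1 ≤ B) :
    swp O U B (exactRoundsProg K) (fun τ => τ.nat 18 = if σ.lst 2 = [] then 0 else
      ⌈rounds p (tau p (1 / 2 + 2 * Δ + ε)) (δ / 5)
        (lambda2 p (tau p (1 / 2 + 2 * Δ + ε))) (σ.lst 2).length⌉₊ + 1) σ := by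
  refine ⟨fun hb => ⟨Nat.zero_le _, ?_⟩, fun hb => ?_⟩
  · have hb : σ.lst 2 = [] := by simpa [BExp.Holds, NExp.eval] using hb
    simp [hb, NExp.eval]
  · have hb : σ.lst 2 ≠ [] := by simpa [BExp.Holds, NExp.eval] using hb
    refine swp_call (c := roundsProg 23 (.lengthL 2))
      (swp_roundsProg h (by norm_num) h.lam) fun τ hF hτ => ?_
    have e10 : τ.nat 10 = σ.nat 10 := hF.nat 10 rfl
    have hτ' : ⌈τ.real 26⌉₊ ≤ K.eval (σ.nat 10) := by rw [hτ]; exact hK hb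
    refine swp_mono (c := ceilProg K 18) (swp_ceilProg (by norm_num) (by rwa [e10])
      (by rw [e10]; omega)) fun ρ hρ => ?_
    refine ⟨?_, ?_⟩
    · simp only [NExp.eval, hρ]; omega
    · simp only [NExp.eval, State.nat_setNat, if_true, hρ, hτ, if_neg hb]

/-- Real register `26` receives the number of proposals per candidate, before rounding. -/
def proposalsProg : Prog :=
  .setR 26 (.div (.mul (.num 2) (.ln (.div (.nat (.lengthL 3)) (.div (.var 3) (.num 5)))))
    (.mul (.sub (.mul (.num 2) (.var 2)) (.num 1)) (.sub (.mul (.num 2) (.var 2)) (.num 1))))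

/-- The part of learning with imperfect feedback that follows the rounds with samples. -/
def finalProg (P K : Polynomial ℕ) : Prog :=
  .seq (exactRoundsProg K) <| .seq (.loop (.var 18) (exactStep P)) <|
  .seq proposalsProg <| .seq (ceilProg K 19) <| .seq verifyProg <| .setN 0 (.var 15)

-- List 2 holds S₁ and list 3 collects S₂, a sublist up to order, which bounds its length. If S₁ is
-- empty, the loop makes no round, and verification of the empty list returns failure.
open Classical in
lemma swp_finalProg {P K : Polynomial ℕ} {n X : ℕ} {ε Δ p δ β θ : ℝ} {σ : State V}
    (hR : O.Ready D B) (hD : D.Bounded P n) (hn : n ≤ X) (hX1 : 1 ≤ X)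
    (hB : P.eval X * X + 1 ≤ B) (hX : σ.nat 10 = X) (hσ : Params ε Δ p δ σ)
    (hp : 0 < p) (hp1 : p < 1) (hβ : 1 / 2 + 1 / (2 * X) ≤ β) (hθ : θ ≤ 1 / 2)
    (hU : U.IsAllowed D) (hnd : (σ.lst 2).Nodup) (hlB : (σ.lst 2).length + 1 ≤ B)
    (hl3 : σ.lst 3 = []) (hq3 : σ.resp 3 = []) (hKB : K.eval X + 2 ≤ B)
    (hK : σ.lst 2 ≠ [] → ⌈rounds p (tau p (1 / 2 + 2 * Δ + ε)) (δ / 5)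
      (lambda2 p (tau p (1 / 2 + 2 * Δ + ε))) (σ.lst 2).length⌉₊ ≤ K.eval X)
    (hK' : ∀ N ≤ (σ.lst 2).length, ⌈2 * Real.log (N / (δ / 5)) / (2 * p - 1) ^ 2⌉₊ ≤ K.eval X) :
    swp O U B (finalProg P K) (fun τ => ∃ (h₂ h₃ : List (Response V)) (S₂ : Finset V),
      τ.hist = σ.hist ++ h₂ ++ h₃ ∧
      (if (σ.lst 2).toFinset = ∅ then h₂ = [] ∧ S₂ = ∅
        else h₂.length = ⌈rounds p (tau p (1 / 2 + 2 * Δ + ε)) (δ / 5)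
          (lambda2 p (tau p (1 / 2 + 2 * Δ + ε))) (σ.lst 2).toFinset.card⌉₊ + 1 ∧
        IsMultWeightsRun D p β θ (σ.lst 2).toFinset h₂ S₂) ∧
      ∃ order : List V, order.Nodup ∧ (∀ s, s ∈ order ↔ s ∈ S₂) ∧
        IsVerificationRun ⌈2 * Real.log (S₂.card / (δ / 5)) / (2 * p - 1) ^ 2⌉₊ order h₃
          τ.output) σ := by
  refine swp_call (c := exactRoundsProg K) (swp_exactRoundsProg hσ (by rwa [hX])
    (by rw [hX]; omega)) fun τ hF hτ => ?_
  have l2 : τ.lst 2 = σ.lst 2 := hF.lst 2 rfl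
  have x10 : τ.nat 10 = X := (hF.nat 10 rfl).trans hX
  have r2 : τ.real 2 = p := (hF.real 2 rfl).trans hσ.prob
  have r3 : τ.real 3 = δ := (hF.real 3 rfl).trans hσ.del
  have h18 : τ.nat 18 ≤ K.eval X + 1 := by
    rw [hτ]
    split_ifs with h
    · omega
    · have := hK h
      omega
  refine swp_loop (fun i ρ => (ρ.lst 3).Nodup ∧ ρ.lst 3 ⊆ σ.lst 2 ∧
    IsMultWeightsRun D p β θ (σ.lst 2).toFinset (ρ.resp 3) (ρ.lst 3).toFinset ∧
    D.ValidResponses (ρ.resp 3) ∧ (ρ.resp 3).length = i ∧ ρ.hist = σ.hist ++ ρ.resp 3)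
    (by simp only [NExp.eval]; omega) ?_ ?_ ?_
  · have e1 : τ.lst 3 = [] := (hF.lst 3 rfl).trans hl3
    have e2 : τ.resp 3 = [] := (hF.resp 3 rfl).trans hq3
    have e3 : τ.hist = σ.hist := hF.hist rfl
    rw [e1, e2, e3]
    exact ⟨List.nodup_nil, List.nil_subset _, by simpa using IsMultWeightsRun.nil,
      fun r hr => absurd hr List.not_mem_nil, rfl, (List.append_nil _).symm⟩
  · rintro i ρ hi hFρ ⟨h1, h2, h3, h4, h5, h6⟩
    have hi : i < τ.nat 18 := hi
    have hne : σ.lst 2 ≠ [] := by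
      rintro h
      rw [hτ, if_pos h] at hi
      omega
    have l2' : ρ.lst 2 = σ.lst 2 := (hFρ.lst 2 rfl).trans l2
    refine swp_mono (c := exactStep P) (swp_exactStep (p := p) hR hD hn hX1 hB
      ((hFρ.nat 10 rfl).trans x10) hp hp1 ((hFρ.real 2 rfl).trans r2) hβ hθ h4 (by omega) hU
      (by rwa [l2']) (by rwa [l2']) (by rwa [l2']) h1 (by rwa [l2']) (by rwa [l2']))
      fun π hπ => ?_
    rw [l2'] at hπ
    obtain ⟨g1, g2, g3, g4, r, g5, g6⟩ := hπ
    exact ⟨g1, g2, g3, g4, by rw [g5, List.length_append, h5, List.length_singleton],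
      by rw [g6, g5, h6, List.append_assoc]⟩
  · rintro ρ hFρ ⟨h1, h2, h3, h4, h5, h6⟩
    have h5 : (ρ.resp 3).length = τ.nat 18 := h5
    have x10' : ρ.nat 10 = X := (hFρ.nat 10 rfl).trans x10
    have r2' : ρ.real 2 = p := (hFρ.real 2 rfl).trans r2
    have r3' : ρ.real 3 = δ := (hFρ.real 3 rfl).trans r3
    have hlen : (ρ.lst 3).length ≤ (σ.lst 2).length := (List.subperm_of_subset h1 h2).length_le
    refine swp_call (O := O) (U := U) (B := B) (c := proposalsProg) (P := fun π => π.real 26 =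
      2 * Real.log ((ρ.lst 3).length / (δ / 5)) / (2 * p - 1) ^ 2) ?_ fun π hFπ hπ => ?_
    · simp [proposalsProg, swp, RExp.eval, NExp.eval, r2', r3', pow_two]
    have x10'' : π.nat 10 = X := (hFπ.nat 10 rfl).trans x10'
    have l3 : π.lst 3 = ρ.lst 3 := hFπ.lst 3 rfl
    have hh : π.hist = ρ.hist := hFπ.hist rfl
    have hc := hK' _ hlen
    refine swp_call (c := ceilProg K 19) (swp_ceilProg (by norm_num)
      (by rw [hπ, x10'']; exact hc) (by rw [x10'']; omega)) fun π₁ hF₁ hπ₁ => ?_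
    have l3' : π₁.lst 3 = ρ.lst 3 := (hF₁.lst 3 rfl).trans l3
    have hh' : π₁.hist = ρ.hist := (hF₁.hist rfl).trans hh
    rw [hπ] at hπ₁
    refine swp_mono (c := verifyProg) (swp_verifyProg (by omega) (by omega)) ?_
    rintro π₂ ⟨hflag, h₃, hh₃, hver⟩
    rw [hh'] at hh₃
    rw [hπ₁, l3'] at hver
    refine ⟨by simp only [NExp.eval]; omega, ρ.resp 3, h₃, (ρ.lst 3).toFinset, ?_, ?_, ρ.lst 3, h1,
      fun s => List.mem_toFinset.symm, ?_⟩
    · rw [State.hist_setNat, hh₃, h6]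
    · rw [hτ] at h5
      rw [List.toFinset_card_of_nodup hnd]
      split_ifs with h <;> rw [List.toFinset_eq_empty_iff] at h
      · rw [if_pos h] at h5
        rw [h, List.subset_nil] at h2
        exact ⟨List.length_eq_zero_iff.1 h5, by rw [h2]; rfl⟩
      · rw [if_neg h] at h5
        exact ⟨h5, h3⟩
    · rw [List.toFinset_card_of_nodup h1]
      have : (π₂.setNat 0 ((NExp.var 15).eval π₂)).output = verifyOutput π₂ := by
        simp [State.output, verifyOutput, NExp.eval]
      rw [this]
      exact hver

end

end InteractiveLearning

/-! ### The learner with imperfect feedback. -/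

namespace InteractiveLearning

noncomputable section

variable {V : Type} {O : Oracles V} {U : User V} {B : ℕ} {D : FeedbackGraph V}

/-- Computes the parameters and the number of rounds with samples. -/
def setupProg (K : Polynomial ℕ) : Prog :=
  .seq (.setN 10 (.add (.add (.add (.var 0) (.var 1)) (.var 2)) (.var 3))) <|
  .seq paramsProg <| .seq lambda1Prog <| .seq (roundsProg 25 (.var 4)) <| ceilProg K 17

/-- Register 4 holds the number of initial candidates. It is left out of X, being possibly
exponential, and enters the real formulas through logarithms. -/
lemma swp_setupProg {K : Polynomial ℕ} {ε Δ p δ : ℝ} {σ : State V} {X : ℕ} (h0 : σ.real 0 = ε)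
    (h1 : σ.real 1 = Δ) (h2 : σ.real 2 = p) (h3 : σ.real 3 = δ)
    (hX : σ.nat 0 + σ.nat 1 + σ.nat 2 + σ.nat 3 = X) (hXB : X ≤ B) (hKB : K.eval X ≤ B)
    (hK : ⌈rounds p (tau p (1 / 2 + 2 * Δ + ε)) (δ / 5)
      (lambda1 p (tau p (1 / 2 + 2 * Δ + ε)) (σ.nat 4)) (σ.nat 4)⌉₊ ≤ K.eval X) :
    swp O U B (setupProg K) (fun τ => τ.nat 10 = X ∧ Params ε Δ p δ τ ∧
      τ.nat 17 = ⌈rounds p (tau p (1 / 2 + 2 * Δ + ε)) (δ / 5)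
        (lambda1 p (tau p (1 / 2 + 2 * Δ + ε)) (σ.nat 4)) (σ.nat 4)⌉₊) σ := by
  refine ⟨by simp only [NExp.eval]; omega, ?_⟩
  refine swp_call (O := O) (U := U) (B := B) (c := paramsProg) (swp_paramsProg h0 h1 h2 h3) fun τ hF hτ => ?_
  have e4 : τ.nat 4 = σ.nat 4 := hF.nat 4 rfl
  have e10 : τ.nat 10 = X := by
    rw [hF.nat 10 rfl]
    simpa [NExp.eval] using hX
  refine swp_call (O := O) (U := U) (B := B) (c := lambda1Prog) (swp_lambda1Prog hτ) fun ρ hFρ hρ => ?_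
  have e4' : ρ.nat 4 = σ.nat 4 := (hFρ.nat 4 rfl).trans e4
  have e10' : ρ.nat 10 = X := (hFρ.nat 10 rfl).trans e10
  rw [e4] at hρ
  have hP : Params ε Δ p δ ρ := hτ.congr (hFρ.real _ rfl) (hFρ.real _ rfl) (hFρ.real _ rfl)
    (hFρ.real _ rfl) (hFρ.real _ rfl) (hFρ.real _ rfl) (hFρ.real _ rfl) (hFρ.real _ rfl)
  refine swp_call (c := roundsProg 25 (.var 4)) (swp_roundsProg hP (by norm_num) hρ)
    fun π hFπ hπ => ?_
  have e10'' : π.nat 10 = X := (hFπ.nat 10 rfl).trans e10'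
  have hv : (NExp.var 4).eval ρ = σ.nat 4 := e4'
  rw [hv] at hπ
  have hP' : Params ε Δ p δ π := hP.congr (hFπ.real _ rfl) (hFπ.real _ rfl) (hFπ.real _ rfl)
    (hFπ.real _ rfl) (hFπ.real _ rfl) (hFπ.real _ rfl) (hFπ.real _ rfl) (hFπ.real _ rfl)
  refine swp_call (c := ceilProg K 17) (swp_ceilProg (by norm_num) (by rw [hπ, e10'']; exact hK)
    (by rwa [e10''])) fun π' hF' hπ' => ?_
  rw [hπ] at hπ'
  exact ⟨(hF'.nat 10 rfl).trans e10'', hP'.congr (hF'.real _ rfl) (hF'.real _ rfl)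
    (hF'.real _ rfl) (hF'.real _ rfl) (hF'.real _ rfl) (hF'.real _ rfl) (hF'.real _ rfl)
    (hF'.real _ rfl), hπ'⟩

open Polynomial in
/-- The accuracy `1 / (2 * X)`, with error probability at most `2 ^ (-k)` over all rounds. -/
def noisySamples (P K : Polynomial ℕ) : Polynomial ℕ := sampleSize P (2 * X) (X + (K + 1))

/-- Learning with imperfect feedback. -/
def noisyProg (P K : Polynomial ℕ) : Prog :=
  .seq (setupProg K) <|
  .seq (.loop (.add (.var 17) (.const 1)) (.seq (drawProg (noisySamples P K)) (noisyStep P))) <|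
  finalProg P K

/-- The sure invariant of the rounds with samples. -/
structure NoisyInv (D : FeedbackGraph V) (ε Δ p δ : ℝ) (X N L i : ℕ) (σ : State V) : Prop where
  input : σ.nat 10 = X
  params : Params ε Δ p δ σ
  rounds : σ.nat 17 = N
  hist : σ.hist = σ.resp 0
  valid : D.ValidResponses (σ.resp 0)
  length : (σ.resp 0).length = i
  nodup : (σ.lst 2).Nodup
  size : (σ.lst 2).length ≤ i * L
  lst3 : σ.lst 3 = []
  resp3 : σ.resp 3 = []

lemma Nat_size_le_of_le_two_pow {x b : ℕ} (h : x ≤ 2 ^ b) : x.size ≤ b + 1 :=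
  Nat.size_le.2 (h.trans_lt (Nat.pow_lt_pow_right (by norm_num) (Nat.lt_succ_self b)))

lemma FeedbackGraph.Bounded.logb_le [Fintype V] {P : Polynomial ℕ} {n N : ℕ} (h : D.Bounded P n)
    (hN : N ≤ Fintype.card V) : Real.logb 2 N ≤ P.eval n := by
  rcases N.eq_zero_or_pos with rfl | h0
  · simp
  · exact (Real.logb_le_logb_of_le (by norm_num) (by exact_mod_cast h0)
      (by exact_mod_cast hN)).trans h.1

/-- For p < 1 no answer rules a model out, so the oracle guarantee holds whatever the user says. -/
lemma sum_weight_pos [Fintype V] {p : ℝ} (hp : 0 < p) (hp1 : p < 1) {S₀ : Finset V}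
    (hS : S₀.Nonempty) (Q : List (Response V)) : 0 < ∑ t, D.weight p S₀ Q t := by
  obtain ⟨s, hs⟩ := hS
  refine lt_of_lt_of_le ?_ (Finset.single_le_sum
    (fun t _ => FeedbackGraph.weight_nonneg hp.le hp1.le _ _ t) (Finset.mem_univ s))
  rw [weight_eq_likelihood hs]
  exact likelihood_pos hp hp1 _ _

/-- Only the first run of multiplicative weights can fail, through inaccurate samples. Each of its
rounds marks at most as many models as there are samples, so S₁ has polynomial size and the exact
second run is affordable. -/
lemma exists_noisyProg (Δ : ℝ) (hΔ₀ : 0 ≤ Δ) (hΔ : Δ < 1 / 4) (P : Polynomial ℕ) (p : ℝ)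
    (hp : 1 / 2 < p) (hp1 : p < 1) (hgap : 0 < gap p (tau p (1 / 2 + 2 * Δ))) :
    ∃ ε₀ : ℝ, 0 < ε₀ ∧ ∃ (c : Prog) (R : Polynomial ℕ),
      ∀ (V : Type) [Fintype V] (D : FeedbackGraph V) (O : Oracles V) (S₀ : Finset V) (n : ℕ),
        D.Bounded P n → O.Correct D S₀ p Δ P n → S₀.Nonempty →
        ∀ (ε : ℝ), 0 < ε → ε ≤ ε₀ → ∀ (δ : ℝ), 0 < δ → δ < 1 → ∀ (k : ℕ),
          ∀ U : User V, U.IsAllowed D → ∀ v₀ : V,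
          (∀ σ ∈ (c.run O U (State.initial [n, ⌈1 / ε⌉₊, k, ⌈Real.logb 2 (1 / δ)⌉₊, S₀.card]
              [ε, Δ, p, δ] [] v₀)).support,
            σ.time ≤ R.eval (n + ⌈1 / ε⌉₊ + k + ⌈Real.logb 2 (1 / δ)⌉₊)) ∧
          (c.run O U (State.initial [n, ⌈1 / ε⌉₊, k, ⌈Real.logb 2 (1 / δ)⌉₊, S₀.card]
              [ε, Δ, p, δ] [] v₀)).toOuterMeasure
            {σ | ¬ IsNoisyRun D p (1 / 2 + 2 * Δ + ε) (1 / 2 - 2 * Δ - ε)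
                (tau p (1 / 2 + 2 * Δ + ε)) δ S₀ σ.hist σ.output} ≤
              (1 / 2 : ℝ≥0∞) ^ k := by
  obtain ⟨ε₀, hε₀0, hε₀, K, hK⟩ := exists_rounds_bound hp hp1 hΔ₀ hΔ hgap P
  obtain ⟨R, hR⟩ := (noisyProg P K).exists_timeBound_eq_eval
  set L := noisySamples P K with hL
  set BP : Polynomial ℕ := (K + 2) * L + P * Polynomial.X + P.comp (Polynomial.X + K + 2) +
    Polynomial.X + K + 3 with hBP
  refine ⟨ε₀, hε₀0, noisyProg P K, R.comp BP, ?_⟩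
  intro V _ D O S₀ n hD hO hS ε hε hεε₀ δ hδ hδ1 k U hU v₀
  classical
  have hp0 : 0 < p := by linarith
  set m := ⌈1 / ε⌉₊ with hm
  have hm1 : 1 ≤ m := Nat.one_le_ceil_iff.2 (by positivity)
  set d := ⌈Real.logb 2 (1 / δ)⌉₊ with hd
  set X := n + m + k + d with hX
  set β := 1 / 2 + 2 * Δ + ε with hβ
  set θ := 1 / 2 - 2 * Δ - ε with hθ
  set B := BP.eval X with hB
  set N := ⌈rounds p (tau p β) (δ / 5) (lambda1 p (tau p β) S₀.card) S₀.card⌉₊ with hN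
  have hBe : B = (K.eval X + 2) * L.eval X + P.eval X * X + P.eval (X + K.eval X + 2) + X +
      K.eval X + 3 := by
    simp [hB, hBP]
  have hPn : P.eval n ≤ P.eval (X + K.eval X + 2) := polynomial_eval_mono P (by omega)
  have hbits : Nat.clog 2 (Fintype.card V) ≤ B := hD.clog_le.trans (by omega)
  have hr : O.Ready D B := hO.ready hD
    ((polynomial_eval_mono P (by omega : n + 1 ≤ X + K.eval X + 2)).trans (by omega)) (by omega)
  have hE : (2 * Polynomial.X : Polynomial ℕ).eval X = 2 * X := by simp
  have hL0 : 0 < L.eval X := one_le_sampleSize_eval (by rw [hE]; omega)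
  have hLB : L.eval X ≤ (K.eval X + 2) * L.eval X := Nat.le_mul_of_pos_left _ (by omega)
  have hX0 : (0 : ℝ) < X := by exact_mod_cast (by omega : 0 < X)
  have hεX' : 1 ≤ ε * X := by
    have h1 : 1 / ε ≤ m := Nat.le_ceil _
    have h2 : (m : ℝ) ≤ X := by exact_mod_cast (by omega : m ≤ X)
    rw [div_le_iff₀ hε] at h1
    nlinarith
  have hεX : 1 / (X : ℝ) ≤ ε := by rwa [div_le_iff₀ hX0]
  have hlogδ : Real.logb 2 (1 / δ) ≤ X :=
    (Nat.le_ceil _).trans (by exact_mod_cast (by omega : d ≤ X))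
  have hlogN : ∀ M ≤ Fintype.card V, Real.logb 2 M ≤ P.eval X := fun M hM =>
    (hD.logb_le hM).trans (by exact_mod_cast polynomial_eval_mono P (by omega : n ≤ X))
  have hbound := fun M hM => hK ε δ X M hε hεε₀ hδ hδ1 hlogδ (hlogN M hM)
  have hNK : N ≤ K.eval X := ((hbound _ (Finset.card_le_univ _)).1 hS.card_pos).1
  have hpos : ∀ Q, 0 < ∑ t, D.weight p S₀ Q t := fun Q => sum_weight_pos hp0 hp1 hS Q
  have hiL : ∀ i ≤ N + 1, i * L.eval X + L.eval X ≤ (K.eval X + 2) * L.eval X := fun i hi => by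
    rw [← Nat.succ_mul]
    exact Nat.mul_le_mul_right _ (by omega)
  -- The first conjunct must not depend on accuracy, since it guarantees the running time in all
  -- cases.
  have hstep : ∀ i < N + 1, ∀ σ, NoisyInv D ε Δ p δ X N (L.eval X) i σ →
      (σ.lst 0).length = L.eval X →
      swp O U B (noisyStep P) (fun τ => NoisyInv D ε Δ p δ X N (L.eval X) (i + 1) τ ∧
        (IsMultWeightsRun D p β θ S₀ (σ.resp 0) (σ.lst 2).toFinset →
          Accurate D (O.sample (σ.resp 0)) (2 * X) (σ.lst 0) →
          IsMultWeightsRun D p β θ S₀ (τ.resp 0) (τ.lst 2).toFinset)) σ := by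
    intro i hi σ hσ hlen
    have hQ := hσ.length
    have hsz := hσ.size
    have hiL' := hiL i hi.le
    refine swp_call (c := noisyStep P) (swp_noisyStep hr hD (by omega : n ≤ X) (by omega) hσ.input
      (by omega) (by omega) (by omega) hσ.nodup) fun τ hF hτ => ?_
    obtain ⟨hnd, hle, hmem, s, s', hq, hh, hs', hopt⟩ := hτ
    refine ⟨⟨(hF.nat 10 rfl).trans hσ.input, hσ.params.congr (hF.real _ rfl) (hF.real _ rfl)
      (hF.real _ rfl) (hF.real _ rfl) (hF.real _ rfl) (hF.real _ rfl) (hF.real _ rfl)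
      (hF.real _ rfl), (hF.nat 17 rfl).trans hσ.rounds, by rw [hh, hq, hσ.hist], ?_,
      by rw [hq, List.length_append, hQ, List.length_singleton], hnd, ?_,
      (hF.lst 3 rfl).trans hσ.lst3, (hF.resp 3 rfl).trans hσ.resp3⟩, fun hg hacc => ?_⟩
    · rw [hq]
      intro r hr
      rcases List.mem_append.1 hr with hr | hr
      · exact hσ.valid r hr
      · rw [List.mem_singleton.1 hr]; exact hU _ _ _ hs'
    · rw [Nat.succ_mul]; omega
    · have hclose := hO.sample_close _ hσ.valid (hpos _)
      have hheavy := hacc.heavy (ε := ε) hε (by push_cast; linarith) (by omega) (hpos _) hclose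
      rw [hσ.params.err, hσ.params.eps] at hmem
      rw [hq]
      refine hg.concat (Mi := (σ.lst 0).toFinset.filter fun t =>
        (1 / 2 - Δ - 1 / 2 * ε) * (σ.lst 0).length ≤ (σ.lst 0).count t) (fun t => ?_)
        (fun t ht => ?_) (fun t ht => ?_)
        (hacc.potential_le (by omega) le_rfl (by omega) (hpos _) hclose (by linarith) hopt)
      · rw [List.mem_toFinset, hmem, Finset.mem_filter, List.mem_toFinset, List.mem_toFinset]
      · have h1 := (hheavy t).1 ht
        rw [Finset.mem_filter, List.mem_toFinset]
        -- Only models that occur among the samples are inspected. A heavy model does occur, because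
        -- the threshold for its frequency is positive.
        refine ⟨List.count_pos_iff.1 ?_, h1⟩
        have h2 : (0 : ℝ) < (σ.lst 0).length := by exact_mod_cast (by omega : 0 < (σ.lst 0).length)
        have h3 : 0 < (1 / 2 - Δ - 1 / 2 * ε) * (σ.lst 0).length :=
          mul_pos (by linarith) h2
        exact_mod_cast h3.trans_le h1
      · exact (hheavy t).2 (Finset.mem_filter.1 ht).2
  have key : HT O U B (fun σ => σ = State.initial [n, m, k, d, S₀.card] [ε, Δ, p, δ] [] v₀)
      (fun _ => True) (noisyProg P K) (fun _ => True)
      (fun τ => IsNoisyRun D p β θ (tau p β) δ S₀ τ.hist τ.output)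
      (0 + ((N + 1 : ℕ) * (1 / 2) ^ (Polynomial.X + (K + 1) : Polynomial ℕ).eval X + 0)) := by
    refine HT.seq (S' := NoisyInv D ε Δ p δ X N (L.eval X) 0)
      (G' := fun σ => IsMultWeightsRun D p β θ S₀ (σ.resp 0) (σ.lst 2).toFinset)
      (HT.of_swp hbits ?_ ?_)
      (HT.seq (S' := NoisyInv D ε Δ p δ X N (L.eval X) (N + 1))
        (G' := fun σ => IsMultWeightsRun D p β θ S₀ (σ.resp 0) (σ.lst 2).toFinset)
        (HT.loop (S := NoisyInv D ε Δ p δ X N (L.eval X))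
          (G := fun _ σ => IsMultWeightsRun D p β θ S₀ (σ.resp 0) (σ.lst 2).toFinset)
          ?_ (by omega) fun i hi => ?_)
        (HT.of_swp hbits ?_ ?_))
    · rintro σ rfl
      refine swp_call (c := setupProg K) (swp_setupProg (X := X) rfl rfl rfl rfl rfl (by omega)
        (by omega) hNK) fun τ hF ⟨h1, h2, h3⟩ => ?_
      have e2 : τ.lst 2 = [] := hF.lst 2 rfl
      have eq : τ.resp 0 = [] := hF.resp 0 rfl
      exact ⟨h1, h2, h3, (hF.hist rfl).trans eq.symm, by rw [eq]; simp [FeedbackGraph.ValidResponses],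
        by rw [eq]; rfl, by rw [e2]; exact List.nodup_nil, by rw [e2]; exact Nat.zero_le _,
        hF.lst 3 rfl, hF.resp 3 rfl⟩
    · rintro σ rfl -
      refine swp_call (c := setupProg K) (swp_setupProg (X := X) rfl rfl rfl rfl rfl (by omega)
        (by omega) hNK) fun τ hF _ => ?_
      have e2 : τ.lst 2 = [] := hF.lst 2 rfl
      have eq : τ.resp 0 = [] := hF.resp 0 rfl
      rw [e2, eq]
      exact IsMultWeightsRun.nil
    · intro σ h
      simp only [NExp.eval, h.rounds]
    · rw [← add_zero ((1 / 2 : ℝ≥0∞) ^ (Polynomial.X + (K + 1) : Polynomial ℕ).eval X)]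
      refine HT.seq (S' := fun σ => NoisyInv D ε Δ p δ X N (L.eval X) i σ ∧
          (σ.lst 0).length = L.eval X)
        (G' := fun σ => IsMultWeightsRun D p β θ S₀ (σ.resp 0) (σ.lst 2).toFinset ∧
          Accurate D (O.sample (σ.resp 0)) (2 * X) (σ.lst 0)) ?_ (HT.of_swp hbits ?_ ?_)
      · refine HT.draw hbits hD (by omega) (by change L.eval X ≤ B; omega) (by rw [hE]; omega)
          (fun σ h => h.input) ?_ ?_ ?_
        · intro σ h
          have := h.length
          refine (hO.sample_time _ h.valid).trans ((polynomial_eval_mono P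
            (by omega : n + (σ.resp 0).length ≤ X + K.eval X + 2)).trans (by omega))
        · rintro σ τ h hF hlen
          have eq : τ.resp 0 = σ.resp 0 := hF.resp 0 rfl
          have e2 : τ.lst 2 = σ.lst 2 := hF.lst 2 rfl
          exact ⟨⟨(hF.nat 10 rfl).trans h.input, h.params.congr (hF.real _ rfl) (hF.real _ rfl)
            (hF.real _ rfl) (hF.real _ rfl) (hF.real _ rfl) (hF.real _ rfl) (hF.real _ rfl)
            (hF.real _ rfl), (hF.nat 17 rfl).trans h.rounds,
            by rw [hF.hist rfl, eq, h.hist], by rw [eq]; exact h.valid, by rw [eq]; exact h.length,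
            by rw [e2]; exact h.nodup, by rw [e2]; exact h.size, (hF.lst 3 rfl).trans h.lst3,
            (hF.resp 3 rfl).trans h.resp3⟩, hlen⟩
        · rintro σ τ h hg hF hlen hacc
          rw [hE] at hacc
          have eq : τ.resp 0 = σ.resp 0 := hF.resp 0 rfl
          have e2 : τ.lst 2 = σ.lst 2 := hF.lst 2 rfl
          exact ⟨by rw [eq, e2]; exact hg, hacc⟩
      · rintro σ ⟨h, hlen⟩
        exact swp_mono (hstep i hi σ h hlen) fun τ hτ => hτ.1
      · rintro σ ⟨h, hlen⟩ ⟨hg, hacc⟩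
        exact swp_mono (hstep i hi σ h hlen) fun τ hτ => hτ.2 hg hacc
    -- The sure and the good claim about the final phase have the same proof; the good one only adds
    -- the execution of the first run.
    all_goals
      intro σ h
      have hsz := h.size
      have hiL' := hiL _ le_rfl
      have hcard : (σ.lst 2).length ≤ Fintype.card V := h.nodup.length_le_card
      have hfin := swp_finalProg (K := K) (θ := θ) (β := β) hr hD (by omega : n ≤ X) (by omega)
        (by omega) h.input h.params hp0 hp1 (by
          have : 1 / (2 * (X : ℝ)) ≤ 1 / X := by
            rw [div_le_div_iff₀ (by positivity) hX0]; linarith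
          linarith) (by linarith) hU h.nodup (by omega) h.lst3 h.resp3 (by omega)
        (fun hne => ((hbound _ hcard).1 (List.length_pos_iff.2 hne)).2)
        (fun M hM => (hbound M (hM.trans hcard)).2)
    · exact swp_mono hfin fun _ _ => trivial
    · intro hg
      refine swp_mono hfin ?_
      rintro τ ⟨h₂, h₃, S₂, hh, h2, h3⟩
      rw [h.hist] at hh
      exact ⟨σ.resp 0, h₂, h₃, _, S₂, hh, h.length, hg, by convert h2, h3⟩
  obtain ⟨h1, h2⟩ := key (State.initial [n, m, k, d, S₀.card] [ε, Δ, p, δ] [] v₀)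
    (State.initial_bounded (fun x hx => by
      simp only [List.mem_cons, List.not_mem_nil, or_false] at hx
      rcases hx with rfl | rfl | rfl | rfl | rfl
      · exact (Nat_size_le_self _).trans (by omega)
      · exact (Nat_size_le_self _).trans (by omega)
      · exact (Nat_size_le_self _).trans (by omega)
      · exact (Nat_size_le_self _).trans (by omega)
      -- The number of candidates is at most 2^(P(n)), so it has at most P(n) + 1 bits.
      · exact (Nat_size_le_of_le_two_pow ((Finset.card_le_univ _).trans hD.card_le)).trans
          (by omega)) (by simp)) rfl
  refine ⟨fun τ hτ => ?_, ?_⟩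
  · obtain ⟨-, -, h4⟩ := h1 τ hτ
    refine h4.trans ?_
    rw [hR, Polynomial.eval_comp, ← hB]
    simp [State.initial]
  · refine le_trans (h2 trivial) ?_
    rw [zero_add, add_zero]
    -- The true number of rounds N + 1 depends on the instance; its polynomial bound K(X) + 1 was
    -- built into the error of each draw.
    refine le_trans ?_ (half_pow_mul_le (K.eval X + 1) X k (by omega))
    simp only [Polynomial.eval_add, Polynomial.eval_X, Polynomial.eval_one]
    gcongr

end

end InteractiveLearning

theorem theorem3 (Δ : ℝ) (hΔ₀ : 0 ≤ Δ) (hΔ : Δ < 1 / 4) (P : Polynomial ℕ) :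
    -- finding an approximate median, for given query responses `Q`
    (∃ (c : Prog) (R : Polynomial ℕ), c.RealFree ∧
      ∀ (V : Type) [Fintype V] (D : FeedbackGraph V) (O : Oracles V) (S₀ : Finset V)
        (p : ℝ) (n : ℕ),
        1 / 2 < p → p ≤ 1 → D.Bounded P n → O.Correct D S₀ p Δ P n →
        ∀ (ε : ℝ), 0 < ε → ∀ (k : ℕ) (Q : List (Response V)), D.ValidResponses Q →
          0 < ∑ t, D.weight p S₀ Q t → ∀ (U : User V) (v₀ : V),
          (∀ σ ∈ (c.run O U (State.initial [n, ⌈1 / ε⌉₊, k] [] Q v₀)).support,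
            σ.hist = [] ∧ σ.time ≤ R.eval (n + ⌈1 / ε⌉₊ + k + Q.length)) ∧
          (c.run O U (State.initial [n, ⌈1 / ε⌉₊, k] [] Q v₀)).toOuterMeasure
            {σ | ¬ D.potential (D.weight p S₀ Q) (σ.mdl 0) ≤ 1 / 2 + 2 * Δ + ε} ≤
              (1 / 2 : ℝ≥0∞) ^ k) ∧
    -- learning without feedback errors
    (∃ ε₀ : ℝ, 0 < ε₀ ∧ ∃ (c : Prog) (R : Polynomial ℕ), c.RealFree ∧
      ∀ (V : Type) [Fintype V] (D : FeedbackGraph V) (O : Oracles V) (S₀ : Finset V) (n : ℕ),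
        D.Bounded P n → O.Correct D S₀ 1 Δ P n →
        ∀ (ε : ℝ), 0 < ε → ε ≤ ε₀ → ∀ (k : ℕ) (target : V), target ∈ S₀ →
          ∀ U : User V, U.IsCorrect D target → ∀ v₀ : V,
          (∀ σ ∈ (c.run O U (State.initial [n, ⌈1 / ε⌉₊, k] [] [] v₀)).support,
            σ.time ≤ R.eval (n + ⌈1 / ε⌉₊ + k)) ∧
          (c.run O U (State.initial [n, ⌈1 / ε⌉₊, k] [] [] v₀)).toOuterMeasure
            {σ | ¬ IsNoiselessRun D (1 / 2 + 2 * Δ + ε) S₀ σ.hist (σ.mdl 0)} ≤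
              (1 / 2 : ℝ≥0∞) ^ k) ∧
    -- learning with imperfect feedback
    (∀ p : ℝ, 1 / 2 < p → p < 1 → 0 < gap p (tau p (1 / 2 + 2 * Δ)) →
      ∃ ε₀ : ℝ, 0 < ε₀ ∧ ∃ (c : Prog) (R : Polynomial ℕ),
      ∀ (V : Type) [Fintype V] (D : FeedbackGraph V) (O : Oracles V) (S₀ : Finset V) (n : ℕ),
        D.Bounded P n → O.Correct D S₀ p Δ P n → S₀.Nonempty →
        ∀ (ε : ℝ), 0 < ε → ε ≤ ε₀ → ∀ (δ : ℝ), 0 < δ → δ < 1 → ∀ (k : ℕ),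
          ∀ U : User V, U.IsAllowed D → ∀ v₀ : V,
          (∀ σ ∈ (c.run O U (State.initial [n, ⌈1 / ε⌉₊, k, ⌈Real.logb 2 (1 / δ)⌉₊, S₀.card]
              [ε, Δ, p, δ] [] v₀)).support,
            σ.time ≤ R.eval (n + ⌈1 / ε⌉₊ + k + ⌈Real.logb 2 (1 / δ)⌉₊)) ∧
          (c.run O U (State.initial [n, ⌈1 / ε⌉₊, k, ⌈Real.logb 2 (1 / δ)⌉₊, S₀.card]
              [ε, Δ, p, δ] [] v₀)).toOuterMeasure
            {σ | ¬ IsNoisyRun D p (1 / 2 + 2 * Δ + ε) (1 / 2 - 2 * Δ - ε)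
                (tau p (1 / 2 + 2 * Δ + ε)) δ S₀ σ.hist σ.output} ≤
              (1 / 2 : ℝ≥0∞) ^ k) := by
  exact ⟨exists_medianProg Δ hΔ₀ P, exists_noiselessProg Δ hΔ₀ hΔ P,
    fun p hp hp1 hgap => exists_noisyProg Δ hΔ₀ hΔ P p hp hp1 hgap⟩
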